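/- \textbf{Definitions.} For entire $f$ let $f^*(z)=\overline{f(\bar z)}$. An entire function $E$ is Hermite--Biehler ($E\in\mathcal{HB}$) if $|E(\bar z)|<|E(z)|$ whenever $\operatorname{Im} z>0$. The de Branges space $\mathcal H(E)$ consists of the entire $f$ with $\int_{\mathbb R}|f/E|^2\,dt<\infty$ such that $f/E$ and $f^*/E$ are of bounded type and of nonpositive mean type in the upper half-plane; its inner product is $\langle f,g\rangle_E=\int_{\mathbb R} f\bar g\,|E|^{-2}\,dt$, and its reproducing kernel is $$K_E(w,z)=\frac{\overline{E(w)}E(z)-E(\bar w)E^*(z)}{2\pi i(\bar w-z)},$$ extended by continuity to $z=\bar w$. A phase function of $E$ is a continuous strictly increasing $\varphi_E:\mathbb R\to\mathbb R$ with $E(x)=|E(x)|e^{-i\varphi_E(x)}$ for all $x\in\mathbb R$. A sequence $\{x_n\}$ in a Hilbert space is a Parseval frame if $\sum_n|\langle f,x_n\rangle|^2=\|f\|^2$ for all $f$. An isometric embedding $T:\mathcal H\to\mathcal K$ is said to embed a sequence $\{x_n\}\subset\mathcal H$ into a sequence $\{e_n\}\subset\mathcal K$ if $P e_n=Tx_n$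 for all $n$, where $P$ is the orthogonal projection of $\mathcal K$ onto $T(\mathcal H)$. \textbf{Corollary.} Let $E,F\in\mathcal{HB}$ have no real zeros, let $\varphi_{EF}$ be a phase function of $EF$, let $\alpha\in[0,\pi)$, and let $\{\lambda_n\}_{n\in\mathbb Z}\subset\mathbb R$ satisfy $\varphi_{EF}(\lambda_n)=n\pi+\alpha$ for all $n\in\mathbb Z$. Suppose that $\{K_E(\lambda_n,\cdot)\}_{n\in\mathbb Z}$ is a Parseval frame for $\mathcal H(E)$. Put $h_\alpha=e^{i\alpha}EF-e^{-i\alpha}E^*F^*$, and let $\mathcal K(\alpha)=\mathcal H(EF)$ if $h_\alpha\notin\mathcal H(EF)$ and $\mathcal K(\alpha)=\mathcal H(EF)\ominus\operatorname{span}\{h_\alpha\}$ if $h_\alpha\in\mathcal H(EF)$. Then: (1) $\mathcal I f=fF$ and $\mathcal J g=gE^*$ define linear isometries $\mathcal I:\mathcal H(E)\to\mathcal H(EF)$ and $\mathcal J:\mathcal H(F)\to\mathcal H(EF)$, and $\mathcal H(EF)=\mathcal I(\mathcal H(E))\oplus\mathcal J(\mathcal H(F))$ (orthogonal sum). In particular,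 if $h_\alpha\notin\mathcal H(EF)$, then $\mathcal I$ maps $\mathcal H(E)$ into $\mathcal K(\alpha)$. (2) The functions $$e_n=\frac{\overline{F(\lambda_n)}\,\mathcal I(K_E(\lambda_n,\cdot))}{\sqrt{K_{EF}(\lambda_n,\lambda_n)}}\ \oplus\ \frac{E(\lambda_n)\,\mathcal J(K_F(\lambda_n,\cdot))}{\sqrt{K_{EF}(\lambda_n,\lambda_n)}},\qquad n\in\mathbb Z,$$ form an orthonormal basis of $\mathcal K(\alpha)$. (3) There is a linear isometric embedding $T:\mathcal H(E)\to\mathcal K(\alpha)$ that embeds the Parseval frame $\{K_E(\lambda_n,\cdot)\}_n$ into the orthonormal basis $\{e_n\}_n$. -/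

import Mathlib

open scoped ComplexConjugate InnerProductSpace

/-- The open upper half-plane `ℂ⁺`. -/
def upperHalf : Set ℂ := {z | 0 < z.im}

/-- The involution `f ↦ f*`, `f*(z) = conj (f (conj z))`. -/
def starFun (f : ℂ → ℂ) : ℂ → ℂ := fun z => conj (f (conj z))

/-- `f` is of bounded type in the upper half-plane: there it is the quotient `P / Q` of two bounded
analytic functions, with `Q` not identically zero (written as `f Q = P`). -/
def IsBoundedType (f : ℂ → ℂ) : Prop :=
  ∃ P Q : ℂ → ℂ, DifferentiableOn ℂ P upperHalf ∧ DifferentiableOn ℂ Q upperHalf ∧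
    (∃ C : ℝ, ∀ z ∈ upperHalf, ‖P z‖ ≤ C) ∧ (∃ C : ℝ, ∀ z ∈ upperHalf, ‖Q z‖ ≤ C) ∧
    (∃ z ∈ upperHalf, Q z ≠ 0) ∧ ∀ z ∈ upperHalf, f z * Q z = P z

/-- The mean type `limsup_{y → +∞} (log |f (i y)|) / y`, an extended real number
(with `log 0 = -∞`). -/
noncomputable def meanType (f : ℂ → ℂ) : EReal :=
  Filter.limsup (fun y : ℝ => ENNReal.log ‖f (y * Complex.I)‖ₑ / (y : EReal)) Filter.atTop

/-- A function of the Hermite-Biehler class: an entire function `E` with `|E (conj z)| < |E z|`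
on the open upper half-plane. -/
structure HermiteBiehler where
  toFun : ℂ → ℂ
  differentiable' : Differentiable ℂ toFun
  norm_conj_lt' : ∀ z ∈ upperHalf, ‖toFun (conj z)‖ < ‖toFun z‖

instance : CoeFun HermiteBiehler (fun _ => ℂ → ℂ) := ⟨HermiteBiehler.toFun⟩

theorem isOpen_upperHalf : IsOpen upperHalf := isOpen_lt continuous_const Complex.continuous_im

theorem isPreconnected_upperHalf : IsPreconnected upperHalf :=
  (convex_halfSpace_im_gt 0).isPreconnected

theorem I_mem_upperHalf : Complex.I ∈ upperHalf := by simp [upperHalf]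

theorem starFun_starFun (f : ℂ → ℂ) : starFun (starFun f) = f := by
  funext z; simp [starFun]

theorem Differentiable.starFun {f : ℂ → ℂ} (hf : Differentiable ℂ f) :
    Differentiable ℂ (starFun f) := by
  intro z
  have h := (hf (conj z)).conj_conj
  rw [Complex.conj_conj] at h
  exact h

theorem IsBoundedType.add {f g : ℂ → ℂ} (hf : IsBoundedType f) (hg : IsBoundedType g) :
    IsBoundedType (f + g) := by
  obtain ⟨P, Q, hP, hQ, ⟨a, ha⟩, ⟨b, hb⟩, ⟨u, hu, hQu⟩, h⟩ := hf
  obtain ⟨P', Q', hP', hQ', ⟨a', ha'⟩, ⟨b', hb'⟩, ⟨u', hu', hQu'⟩, h'⟩ := hg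
  refine ⟨fun z => P z * Q' z + P' z * Q z, fun z => Q z * Q' z, (hP.mul hQ').add (hP'.mul hQ),
    hQ.mul hQ', ⟨a * b' + a' * b, fun z hz => ?_⟩, ⟨b * b', fun z hz => ?_⟩, ?_, fun z hz => ?_⟩
  · have h1 := ha z hz
    have h2 := hb z hz
    have h3 := ha' z hz
    have h4 := hb' z hz
    refine (norm_add_le _ _).trans (add_le_add ?_ ?_)
    · rw [norm_mul]; exact mul_le_mul h1 h4 (norm_nonneg _) ((norm_nonneg _).trans h1)
    · rw [norm_mul]; exact mul_le_mul h3 h2 (norm_nonneg _) ((norm_nonneg _).trans h3)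
  · rw [norm_mul]
    exact mul_le_mul (hb z hz) (hb' z hz) (norm_nonneg _) ((norm_nonneg _).trans (hb z hz))
  · by_contra hcon
    push Not at hcon
    have hne : ∀ᶠ z in nhds u, Q z ≠ 0 :=
      (hQ.differentiableAt (isOpen_upperHalf.mem_nhds hu)).continuousAt.eventually_ne hQu
    refine hQu' ((hQ'.analyticOnNhd
      isOpen_upperHalf).eqOn_zero_of_preconnected_of_eventuallyEq_zero isPreconnected_upperHalf hu
      ?_ hu')
    filter_upwards [hne, isOpen_upperHalf.mem_nhds hu] with z hz hz'
    exact (mul_eq_zero.1 (hcon z hz')).resolve_left hz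
  · simp only [Pi.add_apply]
    rw [← h z hz, ← h' z hz]; ring

theorem IsBoundedType.const_mul {f : ℂ → ℂ} (hf : IsBoundedType f) (c : ℂ) :
    IsBoundedType (fun z => c * f z) := by
  obtain ⟨P, Q, hP, hQ, ⟨a, ha⟩, hb, hu, h⟩ := hf
  refine ⟨fun z => c * P z, Q, hP.const_mul c, hQ, ⟨‖c‖ * a, fun z hz => ?_⟩, hb, hu,
    fun z hz => ?_⟩
  · rw [norm_mul]; exact mul_le_mul_of_nonneg_left (ha z hz) (norm_nonneg _)
  · simp only [← h z hz]; ring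

theorem isBoundedType_zero : IsBoundedType 0 :=
  ⟨0, 1, differentiableOn_const 0, differentiableOn_const 1, ⟨0, by simp⟩, ⟨1, by simp⟩,
    ⟨Complex.I, I_mem_upperHalf, by simp⟩, by simp⟩

theorem meanType_nonpos_iff (f : ℂ → ℂ) :
    meanType f ≤ 0 ↔ ∀ ε : ℝ, 0 < ε →
      ∀ᶠ y : ℝ in Filter.atTop, ‖f (y * Complex.I)‖ ≤ Real.exp (ε * y) := by
  have key : ∀ ε y : ℝ, 0 < y → (ENNReal.log ‖f (y * Complex.I)‖ₑ / (y : EReal) ≤ (ε : EReal) ↔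
      ‖f (y * Complex.I)‖ ≤ Real.exp (ε * y)) := by
    intro ε y hy
    rw [EReal.div_le_iff_le_mul (by exact_mod_cast hy) (EReal.coe_ne_top _), ← EReal.coe_mul,
      ← EReal.log_exp ((y * ε : ℝ) : EReal), ENNReal.log_le_log_iff, EReal.exp_coe,
      ← ofReal_norm, ENNReal.ofReal_le_ofReal_iff (Real.exp_pos _).le, mul_comm y]
  unfold meanType
  rw [Filter.limsup_le_iff']
  constructor
  · intro h ε hε
    filter_upwards [h (ε : EReal) (by exact_mod_cast hε), Filter.eventually_gt_atTop (0 : ℝ)]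
      with y hy hy0
    exact (key ε y hy0).1 hy
  · intro h b hb
    obtain ⟨ε, hε, hεb⟩ := EReal.lt_iff_exists_real_btwn.1 hb
    filter_upwards [h ε (by exact_mod_cast hε), Filter.eventually_gt_atTop (0 : ℝ)] with y hy hy0
    exact ((key ε y hy0).2 hy).trans hεb.le

theorem meanType_add_nonpos {f g : ℂ → ℂ} (hf : meanType f ≤ 0) (hg : meanType g ≤ 0) :
    meanType (f + g) ≤ 0 := by
  rw [meanType_nonpos_iff] at *
  intro ε hε
  filter_upwards [hf (ε / 2) (by linarith), hg (ε / 2) (by linarith),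
    Filter.eventually_ge_atTop (2 / ε)] with y h1 h2 h3
  have h4 : 1 ≤ ε / 2 * y := by
    rw [div_le_iff₀ hε] at h3; linarith
  have h5 := Real.add_one_le_exp (ε / 2 * y)
  have h6 : Real.exp (ε * y) = Real.exp (ε / 2 * y) * Real.exp (ε / 2 * y) := by
    rw [← Real.exp_add]; ring_nf
  rw [h6, Pi.add_apply]
  have := norm_add_le (f (y * Complex.I)) (g (y * Complex.I))
  nlinarith [Real.exp_pos (ε / 2 * y)]

theorem meanType_nonpos_of_bounded {f : ℂ → ℂ} {C : ℝ}
    (h : ∀ᶠ y : ℝ in Filter.atTop, ‖f (y * Complex.I)‖ ≤ C) : meanType f ≤ 0 := by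
  rw [meanType_nonpos_iff]
  intro ε hε
  filter_upwards [h, Filter.eventually_ge_atTop (C / ε)] with y h1 h2
  have h5 := Real.add_one_le_exp (ε * y)
  rw [div_le_iff₀ hε] at h2
  linarith

theorem meanType_const_mul_nonpos {f : ℂ → ℂ} (hf : meanType f ≤ 0) (c : ℂ) :
    meanType (fun z => c * f z) ≤ 0 := by
  rw [meanType_nonpos_iff] at *
  intro ε hε
  filter_upwards [hf (ε / 2) (by linarith),
    Filter.eventually_ge_atTop (2 * ‖c‖ / ε)] with y h1 h3
  have h4 : ‖c‖ ≤ ε / 2 * y := by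
    rw [div_le_iff₀ hε] at h3; linarith
  have h5 := Real.add_one_le_exp (ε / 2 * y)
  have h6 : Real.exp (ε * y) = Real.exp (ε / 2 * y) * Real.exp (ε / 2 * y) := by
    rw [← Real.exp_add]; ring_nf
  rw [h6, norm_mul]
  exact mul_le_mul (by linarith) h1 (norm_nonneg _) (Real.exp_pos _).le

namespace HermiteBiehler

theorem differentiable (E : HermiteBiehler) : Differentiable ℂ E := E.differentiable'

theorem ne_zero (E : HermiteBiehler) {z : ℂ} (hz : z ∈ upperHalf) : E z ≠ 0 :=
  norm_pos_iff.1 ((norm_nonneg _).trans_lt (E.norm_conj_lt' z hz))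

theorem measurable_div (E : HermiteBiehler) {f : ℂ → ℂ} (hf : Continuous f) :
    Measurable (fun t : ℝ => f t / E t) :=
  (hf.comp Complex.continuous_ofReal).measurable.div
    (E.differentiable.continuous.comp Complex.continuous_ofReal).measurable

/-- The product `E F` of two Hermite-Biehler functions. -/
instance : Mul HermiteBiehler where
  mul E F :=
    { toFun := fun z => E z * F z
      differentiable' := E.differentiable.mul F.differentiable
      norm_conj_lt' := fun z hz => by
        rw [norm_mul, norm_mul]
        exact mul_lt_mul'' (E.norm_conj_lt' z hz) (F.norm_conj_lt' z hz) (norm_nonneg _)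
          (norm_nonneg _) }

theorem mul_apply (E F : HermiteBiehler) (z : ℂ) : (E * F) z = E z * F z := rfl

/-- `φ` is a phase function of `E`: it is continuous and strictly increasing, and
`E x = |E x| exp (-i φ x)` on the real line. -/
def IsPhase (E : HermiteBiehler) (φ : ℝ → ℝ) : Prop :=
  Continuous φ ∧ StrictMono φ ∧ ∀ x : ℝ, E x = ‖E x‖ * Complex.exp (-Complex.I * φ x)

/-- The set of functions of the de Branges space of `E`, as a linear subspace of the space of all
functions: the entire `f` with `∫ |f / E|² < ∞` on the real line, such that `f / E` and `f* / E` are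
of bounded type and of nonpositive mean type in the upper half-plane. -/
def deBrangesSubmodule (E : HermiteBiehler) : Submodule ℂ (ℂ → ℂ) where
  carrier := {f | Differentiable ℂ f ∧ MeasureTheory.MemLp (fun t : ℝ => f t / E t) 2 ∧
    IsBoundedType (fun z => f z / E z) ∧ meanType (fun z => f z / E z) ≤ 0 ∧
    IsBoundedType (fun z => starFun f z / E z) ∧ meanType (fun z => starFun f z / E z) ≤ 0}
  add_mem' := by
    rintro f g ⟨h1, h2, h3, h4, h5, h6⟩ ⟨k1, k2, k3, k4, k5, k6⟩
    have e1 : (fun z => (f + g) z / E z) = (fun z => f z / E z) + fun z => g z / E z := by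
      funext z; simp [add_div]
    have e2 : (fun z => starFun (f + g) z / E z)
        = (fun z => starFun f z / E z) + fun z => starFun g z / E z := by
      funext z; simp [starFun, add_div]
    have e3 : (fun t : ℝ => (f + g) t / E t) = (fun t : ℝ => f t / E t) + fun t : ℝ => g t / E t := by
      funext z; simp [add_div]
    refine ⟨h1.add k1, ?_, ?_, ?_, ?_, ?_⟩
    · rw [e3]; exact h2.add k2
    · rw [e1]; exact h3.add k3
    · rw [e1]; exact meanType_add_nonpos h4 k4
    · rw [e2]; exact h5.add k5
    · rw [e2]; exact meanType_add_nonpos h6 k6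
  zero_mem' := by
    have e1 : (fun z => (0 : ℂ → ℂ) z / E z) = 0 := by funext z; simp
    have e2 : (fun z => starFun (0 : ℂ → ℂ) z / E z) = 0 := by funext z; simp [starFun]
    have h0 : meanType 0 ≤ 0 :=
      meanType_nonpos_of_bounded (C := 0) (Filter.Eventually.of_forall fun y => by simp)
    refine ⟨differentiable_const 0, ?_, ?_, ?_, ?_, ?_⟩
    · simp
    · rw [e1]; exact isBoundedType_zero
    · rw [e1]; exact h0
    · rw [e2]; exact isBoundedType_zero
    · rw [e2]; exact h0
  smul_mem' := by
    rintro c f ⟨h1, h2, h3, h4, h5, h6⟩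
    have e1 : (fun z => (c • f) z / E z) = fun z => c * (f z / E z) := by
      funext z; simp [mul_div_assoc]
    have e2 : (fun z => starFun (c • f) z / E z) = fun z => conj c * (starFun f z / E z) := by
      funext z; simp [starFun, mul_div_assoc]
    have e3 : (fun t : ℝ => (c • f) t / E t) = fun t : ℝ => c * (f t / E t) := by
      funext z; simp [mul_div_assoc]
    refine ⟨h1.const_smul c, ?_, ?_, ?_, ?_, ?_⟩
    · rw [e3]; exact h2.const_mul c
    · rw [e1]; exact h3.const_mul c
    · rw [e1]; exact meanType_const_mul_nonpos h4 c
    · rw [e2]; exact h5.const_mul _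
    · rw [e2]; exact meanType_const_mul_nonpos h6 _

/-- The de Branges space `H(E)`. -/
def Space (E : HermiteBiehler) : Type := E.deBrangesSubmodule

namespace Space

variable {E : HermiteBiehler}

instance : CoeFun E.Space (fun _ => ℂ → ℂ) := ⟨fun f => f.1⟩

noncomputable instance : AddCommGroup E.Space := inferInstanceAs (AddCommGroup E.deBrangesSubmodule)

noncomputable instance : Module ℂ E.Space := inferInstanceAs (Module ℂ E.deBrangesSubmodule)

theorem ext {f g : E.Space} (h : ∀ z, f z = g z) : f = g := Subtype.ext (funext h)

theorem add_apply (f g : E.Space) (z : ℂ) : (f + g) z = f z + g z := rfl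

theorem smul_apply (c : ℂ) (f : E.Space) (z : ℂ) : (c • f) z = c * f z := rfl

theorem zero_apply (z : ℂ) : (0 : E.Space) z = 0 := rfl

theorem integrable_inner (f g : E.Space) :
    MeasureTheory.Integrable (fun t : ℝ => g t * conj (f t) / ((‖E t‖ : ℂ) ^ 2)) := by
  have h := (f.2.2.1.star).integrable_mul g.2.2.1
  refine h.congr (Filter.Eventually.of_forall fun t => ?_)
  simp only [Pi.mul_apply, Pi.star_apply, RCLike.star_def, map_div₀]
  rw [← Complex.mul_conj', mul_comm (g _), div_mul_div_comm, mul_comm (E _)]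

/-- The inner product of `H(E)`. Mathlib's inner products are conjugate linear in the first
variable, so that this `⟪f, g⟫` is the integral of `g conj(f) / |E|²`. -/
noncomputable instance : Inner ℂ E.Space :=
  ⟨fun f g => ∫ t : ℝ, g t * conj (f t) / ((‖E t‖ : ℂ) ^ 2)⟩

theorem inner_eq (f g : E.Space) :
    inner ℂ f g = ∫ t : ℝ, g t * conj (f t) / ((‖E t‖ : ℂ) ^ 2) := rfl

theorem inner_self (f : E.Space) : inner ℂ f f = ((∫ t : ℝ, ‖f t / E t‖ ^ 2 : ℝ) : ℂ) := by
  rw [inner_eq, ← integral_complex_ofReal]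
  congr 1
  funext t
  rw [Complex.mul_conj', norm_div, div_pow]
  push_cast
  rfl

theorem definite (f : E.Space) (h : inner ℂ f f = 0) : f = 0 := by
  rw [inner_self, Complex.ofReal_eq_zero,
    MeasureTheory.integral_eq_zero_iff_of_nonneg (fun t => by positivity)
      ((MeasureTheory.memLp_two_iff_integrable_sq_norm f.2.2.1.1).1 f.2.2.1)] at h
  have hc1 : Continuous fun z => f z := f.2.1.continuous
  have hc2 : Continuous fun z => E z := E.differentiable.continuous
  have h1 : (fun t : ℝ => f t * E t) =ᵐ[MeasureTheory.volume] fun _ => 0 := by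
    filter_upwards [h] with t ht
    simpa using ht
  have h2 : (fun t : ℝ => f t * E t) = fun _ => 0 :=
    (Continuous.ae_eq_iff_eq MeasureTheory.volume (by fun_prop) (by fun_prop)).1 h1
  have hd : Differentiable ℂ (fun z => f z * E z) := f.2.1.mul E.differentiable
  have h3 : Set.EqOn (fun z => f z * E z) 0 Set.univ := by
    refine (hd.differentiableOn.analyticOnNhd
      isOpen_univ).eqOn_zero_of_preconnected_of_frequently_eq_zero isPreconnected_univ
      (Set.mem_univ 0) ?_
    have ht : Filter.Tendsto (fun t : ℝ => (t : ℂ)) (nhdsWithin 0 {0}ᶜ) (nhdsWithin 0 {0}ᶜ) := by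
      refine tendsto_nhdsWithin_iff.2 ⟨?_, ?_⟩
      · have := Complex.continuous_ofReal.tendsto 0
        simp only [Complex.ofReal_zero] at this
        exact this.mono_left nhdsWithin_le_nhds
      · filter_upwards [self_mem_nhdsWithin] with t ht
        simpa using ht
    exact ht.frequently (Filter.Frequently.of_forall fun t => congrFun h2 t)
  have h4 : Set.EqOn (fun z => f z) 0 Set.univ := by
    refine (f.2.1.differentiableOn.analyticOnNhd
      isOpen_univ).eqOn_zero_of_preconnected_of_eventuallyEq_zero isPreconnected_univ
      (Set.mem_univ Complex.I) ?_
    filter_upwards [isOpen_upperHalf.mem_nhds I_mem_upperHalf] with z hz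
    exact (mul_eq_zero.1 (h3 (Set.mem_univ z))).resolve_right (E.ne_zero hz)
  exact ext fun z => h4 (Set.mem_univ z)

noncomputable instance instCore : InnerProductSpace.Core ℂ E.Space where
  conj_inner_symm f g := by
    rw [inner_eq, inner_eq, ← integral_conj]
    congr 1
    funext t
    simp [mul_comm]
  re_inner_nonneg f := by
    rw [inner_self]
    simp only [RCLike.re_to_complex, Complex.ofReal_re]
    exact MeasureTheory.integral_nonneg fun t => by positivity
  add_left f g h := by
    rw [inner_eq, inner_eq, inner_eq, ← MeasureTheory.integral_add (integrable_inner _ _)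
      (integrable_inner _ _)]
    congr 1
    funext t
    simp [add_apply, mul_add, add_div]
  smul_left f g c := by
    rw [inner_eq, inner_eq, ← MeasureTheory.integral_const_mul]
    congr 1
    funext t
    simp only [smul_apply, map_mul]
    ring
  definite := definite

noncomputable instance : NormedAddCommGroup E.Space := instCore.toNormedAddCommGroup

noncomputable instance : InnerProductSpace ℂ E.Space := InnerProductSpace.ofCore instCore.toCore

end Space

/-- The numerator `conj(E w) E(z) - E(conj w) E*(z)` of the reproducing kernel. -/
noncomputable def kernelNum (E : HermiteBiehler) (w z : ℂ) : ℂ :=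
  conj (E w) * E z - E (conj w) * starFun E z

/-- The reproducing kernel `K_E(w, z)` of `H(E)`, extended by continuity to `z = conj w`. -/
noncomputable def kernelFun (E : HermiteBiehler) (w z : ℂ) : ℂ :=
  if z = conj w then -deriv (E.kernelNum w) (conj w) / (2 * Real.pi * Complex.I)
  else E.kernelNum w z / (2 * Real.pi * Complex.I * (conj w - z))

theorem differentiable_kernelNum (E : HermiteBiehler) (w : ℂ) :
    Differentiable ℂ (E.kernelNum w) :=
  (E.differentiable.const_mul _).sub (E.differentiable.starFun.const_mul _)

theorem kernelNum_conj (E : HermiteBiehler) (w : ℂ) : E.kernelNum w (conj w) = 0 := by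
  simp [kernelNum, starFun, mul_comm]

theorem kernelFun_eq_dslope (E : HermiteBiehler) (w : ℂ) :
    E.kernelFun w =
      fun z => -dslope (E.kernelNum w) (conj w) z / (2 * Real.pi * Complex.I) := by
  funext z
  unfold kernelFun
  split_ifs with h
  · rw [h, dslope_same]
  · rw [dslope_of_ne _ h, slope_def_field, kernelNum_conj, sub_zero, ← neg_sub (conj w) z, div_neg,
      neg_neg, div_div, mul_comm (conj w - z)]

theorem differentiable_kernelFun (E : HermiteBiehler) (w : ℂ) :
    Differentiable ℂ (E.kernelFun w) := by
  rw [kernelFun_eq_dslope]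
  have h : Differentiable ℂ (dslope (E.kernelNum w) (conj w)) := by
    rw [← differentiableOn_univ, Complex.differentiableOn_dslope Filter.univ_mem]
    exact (E.differentiable_kernelNum w).differentiableOn
  exact h.neg.div_const _

theorem kernelFun_mul (E : HermiteBiehler) (w z : ℂ) :
    E.kernelFun w z * (2 * Real.pi * Complex.I * (conj w - z)) = E.kernelNum w z := by
  by_cases h : z = conj w
  · simp [h, kernelNum_conj]
  · rw [kernelFun, if_neg h, div_mul_cancel₀]
    have : conj w - z ≠ 0 := sub_ne_zero.2 (Ne.symm h)
    have := Real.pi_ne_zero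
    simp_all

theorem starFun_kernelFun (E : HermiteBiehler) (w : ℂ) :
    starFun (E.kernelFun w) = E.kernelFun (conj w) := by
  refine Continuous.ext_on (dense_compl_singleton w)
    (E.differentiable_kernelFun w).starFun.continuous
    (E.differentiable_kernelFun (conj w)).continuous fun z hz => ?_
  have hz1 : z ≠ w := hz
  have hz2 : conj z ≠ conj w := fun h => hz1 ((starRingEnd ℂ).injective h)
  have hz3 : w - z ≠ 0 := sub_ne_zero.2 hz1.symm
  have hpi : (Real.pi : ℂ) ≠ 0 := by exact_mod_cast Real.pi_ne_zero
  simp only [starFun, kernelFun, Complex.conj_conj, if_neg hz1, if_neg hz2, kernelNum, map_div₀,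
    map_sub, map_mul, Complex.conj_I, Complex.conj_ofReal, Complex.conj_ofNat]
  have hI := Complex.I_ne_zero
  field_simp
  ring

theorem norm_kernelFun_div_le (E : HermiteBiehler) (w z : ℂ) (hz : ‖E (conj z)‖ ≤ ‖E z‖) :
    ‖E.kernelFun w z / E z‖ * ‖conj w - z‖ ≤ ‖E w‖ + ‖E (conj w)‖ := by
  have h1 : ‖E.kernelFun w z‖ * (2 * Real.pi * ‖conj w - z‖)
      ≤ (‖E w‖ + ‖E (conj w)‖) * ‖E z‖ := by
    have h2 := congrArg norm (E.kernelFun_mul w z)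
    rw [norm_mul, norm_mul, norm_mul, norm_mul] at h2
    simp only [Complex.norm_I, Complex.norm_real, Real.norm_eq_abs, abs_of_pos Real.pi_pos,
      RCLike.norm_ofNat, mul_one] at h2
    rw [h2]
    refine (norm_sub_le _ _).trans ?_
    simp only [norm_mul, starFun, RCLike.norm_conj]
    nlinarith [norm_nonneg (E (conj w))]
  have h3 : ‖E.kernelFun w z‖ * ‖conj w - z‖ ≤ (‖E w‖ + ‖E (conj w)‖) * ‖E z‖ := by
    refine le_trans ?_ h1
    have h4 : 0 ≤ ‖conj w - z‖ := norm_nonneg _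
    gcongr
    nlinarith [Real.pi_gt_three]
  rcases (norm_nonneg (E z)).eq_or_lt with h0 | h0
  · rw [norm_div, ← h0]; simp; positivity
  · rw [norm_div, div_mul_eq_mul_div, div_le_iff₀ h0]; exact h3

theorem isBoundedType_kernelFun (E : HermiteBiehler) (w : ℂ) :
    IsBoundedType (fun z => E.kernelFun w z / E z) := by
  have hzI : ∀ z ∈ upperHalf, 1 ≤ ‖z + Complex.I‖ := by
    intro z hz
    have h1 := Complex.abs_im_le_norm (z + Complex.I)
    have h2 : (0 : ℝ) < z.im := hz
    simp only [Complex.add_im, Complex.I_im] at h1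
    rw [abs_of_pos (by linarith)] at h1
    linarith
  have hzI0 : ∀ z ∈ upperHalf, z + Complex.I ≠ 0 := fun z hz h => by
    have := hzI z hz
    rw [h, norm_zero] at this
    linarith
  have hQd : DifferentiableOn ℂ (fun z => (conj w - z) / (z + Complex.I)) upperHalf := fun z hz =>
    DifferentiableAt.differentiableWithinAt (DifferentiableAt.fun_div (by fun_prop) (by fun_prop)
      (hzI0 z hz))
  refine ⟨fun z => E.kernelFun w z / E z * ((conj w - z) / (z + Complex.I)),
    fun z => (conj w - z) / (z + Complex.I), ?_, hQd, ⟨‖E w‖ + ‖E (conj w)‖, fun z hz => ?_⟩,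
    ⟨‖conj w + Complex.I‖ + 1, fun z hz => ?_⟩, ?_, fun z hz => rfl⟩
  · exact ((E.differentiable_kernelFun w).differentiableOn.div E.differentiable.differentiableOn
      fun z hz => E.ne_zero hz).mul hQd
  · rw [norm_mul, norm_div (conj w - z), ← mul_div_assoc]
    exact (div_le_self (by positivity) (hzI z hz)).trans
      (E.norm_kernelFun_div_le w z (E.norm_conj_lt' z hz).le)
  · rw [norm_div, div_le_iff₀ (by linarith [hzI z hz])]
    have h1 : conj w - z = (conj w + Complex.I) - (z + Complex.I) := by ring
    rw [h1]
    refine (norm_sub_le _ _).trans ?_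
    nlinarith [hzI z hz, norm_nonneg (conj w + Complex.I)]
  · by_cases h : conj w = Complex.I
    · refine ⟨2 * Complex.I, by simp [upperHalf], ?_⟩
      refine div_ne_zero ?_ (hzI0 _ (by simp [upperHalf]))
      rw [h]
      intro h'
      have := congrArg Complex.im h'
      norm_num at this
    · exact ⟨Complex.I, I_mem_upperHalf,
        div_ne_zero (sub_ne_zero.2 h) (hzI0 _ I_mem_upperHalf)⟩

theorem meanType_kernelFun (E : HermiteBiehler) (w : ℂ) :
    meanType (fun z => E.kernelFun w z / E z) ≤ 0 := by
  refine meanType_nonpos_of_bounded (C := ‖E w‖ + ‖E (conj w)‖) ?_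
  filter_upwards [Filter.eventually_ge_atTop (‖w‖ + 1)] with y hy
  have hy0 : 0 < y := by linarith [norm_nonneg w]
  have h1 := E.norm_kernelFun_div_le w (y * Complex.I)
    (E.norm_conj_lt' _ (by simpa [upperHalf] using hy0)).le
  have h2 : 1 ≤ ‖conj w - y * Complex.I‖ := by
    have h3 := norm_sub_norm_le (y * Complex.I) (conj w)
    rw [norm_sub_rev] at h3
    simp only [norm_mul, Complex.norm_real, Complex.norm_I, Real.norm_eq_abs, abs_of_pos hy0,
      RCLike.norm_conj, mul_one] at h3
    linarith
  exact (le_mul_of_one_le_right (norm_nonneg _) h2).trans h1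

theorem memLp_kernelFun (E : HermiteBiehler) (w : ℂ) :
    MeasureTheory.MemLp (fun t : ℝ => E.kernelFun w t / E t) 2 := by
  have hcont : Continuous (E.kernelFun w) := (E.differentiable_kernelFun w).continuous
  have hmeas := E.measurable_div hcont
  set C := ‖E w‖ + ‖E (conj w)‖ with hC
  have hC0 : 0 ≤ C := by positivity
  have hb : ∀ t : ℝ, ‖E.kernelFun w t / E t‖ * ‖conj w - t‖ ≤ C := fun t =>
    E.norm_kernelFun_div_le w t (by simp)
  obtain ⟨M, hM⟩ : ∃ M : ℝ, ∀ t : ℝ, ‖E.kernelFun w t / E t‖ ≤ M := by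
    have hdiv : ∀ δ : ℝ, 0 < δ → ∀ t : ℝ, δ ≤ ‖conj w - t‖ →
        ‖E.kernelFun w t / E t‖ ≤ C / δ := by
      intro δ hδ t ht
      rw [le_div_iff₀ hδ]
      exact (mul_le_mul_of_nonneg_left ht (norm_nonneg _)).trans (hb t)
    by_cases hw : w.im = 0
    · obtain ⟨x, rfl⟩ : ∃ x : ℝ, w = x := ⟨w.re, Complex.ext (by simp) (by simp [hw])⟩
      by_cases hE : E x = 0
      · refine ⟨0, fun t => ?_⟩
        have hCz : C = 0 := by simp [hC, hE]
        by_cases ht : t = x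
        · rw [ht, hE]; simp
        · have h1 := hb t
          rw [hCz] at h1
          have h2 : 0 < ‖conj (x : ℂ) - t‖ := by
            rw [norm_pos_iff, Complex.conj_ofReal, sub_ne_zero]
            exact_mod_cast Ne.symm ht
          nlinarith [norm_nonneg (E.kernelFun x t / E t)]
      · have hca : ContinuousAt (fun t : ℝ => ‖E.kernelFun x t / E t‖) x := by
          refine ContinuousAt.norm (ContinuousAt.div ?_ ?_ hE)
          · exact (hcont.comp Complex.continuous_ofReal).continuousAt
          · exact (E.differentiable.continuous.comp Complex.continuous_ofReal).continuousAt
        obtain ⟨δ, hδ, hδ'⟩ := Metric.eventually_nhds_iff.1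
          (hca.eventually_lt_const (lt_add_one _))
        refine ⟨max (C / δ) (‖E.kernelFun x x / E x‖ + 1), fun t => ?_⟩
        by_cases ht : dist t x < δ
        · exact (hδ' ht).le.trans (le_max_right _ _)
        · refine (hdiv δ hδ t ?_).trans (le_max_left _ _)
          rw [Complex.conj_ofReal, ← Complex.ofReal_sub, Complex.norm_real, ← dist_eq_norm,
            dist_comm]
          exact not_lt.1 ht
    · refine ⟨C / |w.im|, fun t => hdiv _ (abs_pos.2 hw) t ?_⟩
      have := Complex.abs_im_le_norm (conj w - t)
      simpa using this
  have hM0 : 0 ≤ M := (norm_nonneg _).trans (hM 0)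
  rw [MeasureTheory.memLp_two_iff_integrable_sq_norm hmeas.aestronglyMeasurable]
  refine (integrable_inv_one_add_sq.const_mul (M ^ 2 + (C + ‖w‖ * M) ^ 2)).mono'
    (hmeas.norm.pow_const 2).aestronglyMeasurable (Filter.Eventually.of_forall fun t => ?_)
  set g := ‖E.kernelFun w t / E t‖
  have hg : 0 ≤ g := norm_nonneg _
  have h1 : g * |t| ≤ C + ‖w‖ * M := by
    have h2 : |t| ≤ ‖conj w - t‖ + ‖w‖ := by
      have := norm_sub_norm_le (t : ℂ) (conj w)
      rw [norm_sub_rev, Complex.norm_real, Real.norm_eq_abs, RCLike.norm_conj] at this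
      linarith
    have h3 := hb t
    have h4 := hM t
    calc g * |t| ≤ g * (‖conj w - t‖ + ‖w‖) := mul_le_mul_of_nonneg_left h2 hg
      _ = g * ‖conj w - t‖ + ‖w‖ * g := by ring
      _ ≤ C + ‖w‖ * M := add_le_add h3 (mul_le_mul_of_nonneg_left h4 (norm_nonneg _))
  rw [Real.norm_eq_abs, abs_of_nonneg (by positivity), ← div_eq_mul_inv,
    le_div_iff₀ (by positivity), mul_add, mul_one]
  refine add_le_add (pow_le_pow_left₀ hg (hM t) 2) ?_
  rw [← sq_abs t, ← mul_pow]
  exact pow_le_pow_left₀ (by positivity) h1 2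

/-- The kernel function `K_E(w, ·)` as an element of `H(E)`. -/
noncomputable def kernel (E : HermiteBiehler) (w : ℂ) : E.Space :=
  ⟨E.kernelFun w, E.differentiable_kernelFun w, E.memLp_kernelFun w, E.isBoundedType_kernelFun w,
    E.meanType_kernelFun w, by rw [starFun_kernelFun]; exact E.isBoundedType_kernelFun _,
    by rw [starFun_kernelFun]; exact E.meanType_kernelFun _⟩

/-- The entire function `e^{iα} E - e^{-iα} E*`. -/
noncomputable def angleFun (E : HermiteBiehler) (α : ℝ) : ℂ → ℂ := fun z =>
  Complex.exp (Complex.I * α) * E z - Complex.exp (-Complex.I * α) * starFun E z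

open Classical in
/-- The subspace of `H(E)` that is `H(E) ⊖ span {h}` if `h = e^{iα} E - e^{-iα} E*` belongs to
`H(E)`, and all of `H(E)` if it does not. -/
noncomputable def angleSpace (E : HermiteBiehler) (α : ℝ) : Submodule ℂ E.Space :=
  if h : E.angleFun α ∈ E.deBrangesSubmodule then (Submodule.span ℂ {(⟨_, h⟩ : E.Space)})ᗮ else ⊤

end HermiteBiehler

/-- A Parseval frame: `∑ₙ |⟪f, xₙ⟫|² = ‖f‖²` for every `f`. -/
def IsParsevalFrame {ι H : Type*} [NormedAddCommGroup H] [InnerProductSpace ℂ H] (x : ι → H) :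
    Prop :=
  ∀ f : H, HasSum (fun n => ‖⟪f, x n⟫_ℂ‖ ^ 2) (‖f‖ ^ 2)

/-- The isometric embedding `T : H → K` embeds the sequence `x` of `H` into the sequence `e` of `K`:
the orthogonal projection of `e n` to the range of `T` is `T (x n)`. In other words `x`, carried
over to `T(H)`, is the orthogonal compression of `e`, and `e` is an orthogonal dilation of it. -/
def EmbedsInto {ι H K : Type*} [NormedAddCommGroup H] [InnerProductSpace ℂ H]
    [NormedAddCommGroup K] [InnerProductSpace ℂ K] (T : H →ₗᵢ[ℂ] K) (x : ι → H) (e : ι → K) :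
    Prop :=
  ∀ n, e n - T (x n) ∈ (LinearMap.range T.toLinearMap)ᗮ

/-! Everything takes place in H(EF). The numerators of the kernels telescope to K_EF(w,z) =
conj(F(w)) K_E(w,z) F(z) + E(conj w) K_F(w,z) E*(z) (`kernelFun_mul_eq`). On the real line ⟨fF, gE*⟩
becomes the integral of (f*/E)(g/F), a product of two functions of Hardy type, and such an integral
is zero; so the ranges of the two isometries are orthogonal. If h is orthogonal to the range of I,
the kernel identity and the reproducing property give h = J(J* h), so the two ranges exhaust H(EF)
(`orthogonal_range_mulRight`).

For the basis, write G = EF. On the real line h_α is 2i|G| sin(α - φ), so its zeros are exactly the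
λ_n. At such a point the numerator of K_G(λ_n, ·) is a multiple of h_α, which makes these kernels
mutually orthogonal, and the zeros of h_α simple. An f in K(α) orthogonal to all of them vanishes at
every λ_n, so f/h_α is entire. The function (e^{iα}G + e^{-iα}G*)/h_α has nonnegative real part in
the upper half-plane, and this bounds ‖K_G(z, ·)‖/|h_α(z)|, hence f/h_α, by a multiple of (1 +
|z|)/|Im z|; then f/h_α is a constant c (`exists_eq_const_mul_angleFun`). If c is not 0, h_α lies in
the space and f in K(α) is orthogonal to it, so f = 0. By the kernel identity e_n is the normalized
K_G(λ_n, ·). The embedding in (3) is general: the analysis operator of a Parseval frame is an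
isometry into ℓ², and any orthonormal basis with the same index set carries it into K.

The bulk of the file derives the reproducing property and completeness from the definition of H(E)
by bounded type and mean type. Let u = f/E. Bounded type gives the growth exp(C(1 + |z|)²/Im z), and
a maximum principle of Phragmén-Lindelöf type then holds for functions of nonpositive mean type with
bounded boundary values. As u is only square integrable on the real line, the principle is applied
to the averages of u(z + s) against a weight in s, which Cauchy-Schwarz bounds there. The right
weight turns this into an L² bound on every horizontal line, and from it follow the vanishing of
integrals of products (`IsHardy.integral_mul_eq_zero`) and Cauchy's formula
(`IsHardy.integral_mul_inv_sub`). Completeness holds because Cauchy's formula survives limits, and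
the Cauchy transform of an L² function is again of bounded type and nonpositive mean type. -/

/-! ### Growth of quotients of bounded functions on the unit disc -/

open Filter Topology in
/-- The maximum principle on a bounded open set, with boundary values in the `limsup` sense. -/
theorem norm_le_of_frontier_eventually_le {U : Set ℂ} (hU : IsOpen U)
    (hb : Bornology.IsBounded U) {f : ℂ → ℂ} (hf : DifferentiableOn ℂ f U) {B : ℝ}
    (h : ∀ ζ ∈ frontier U, ∀ η : ℝ, 0 < η → ∀ᶠ z in 𝓝[U] ζ, ‖f z‖ ≤ B + η) {z : ℂ} (hz : z ∈ U) :
    ‖f z‖ ≤ B := by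
  by_contra! hlt
  obtain ⟨c, hBc, hcz⟩ := exists_between hlt
  -- Since B < c, the boundary condition keeps this superlevel set away from the frontier of U. It
  -- is therefore compact, and the maximum is attained.
  set K : Set ℂ := {x | x ∈ U ∧ c ≤ ‖f x‖} with hK
  have hcont : ContinuousOn (fun x => ‖f x‖) U := hf.continuousOn.norm
  have hKcl : IsClosed K := by
    refine isClosed_of_closure_subset fun ζ hζ => ?_
    have hζU : ζ ∈ closure U := closure_mono (fun x hx => hx.1) hζ
    rw [mem_closure_iff_frequently] at hζ
    by_cases hm : ζ ∈ U
    · refine ⟨hm, ?_⟩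
      by_contra! hcon
      have := (hcont.continuousAt (hU.mem_nhds hm)).eventually_lt_const hcon
      obtain ⟨x, hx1, hx2⟩ := (hζ.and_eventually this).exists
      exact absurd hx2 (not_lt.2 hx1.2)
    · have hfr : ζ ∈ frontier U := by
        rw [frontier, hU.interior_eq]; exact ⟨hζU, hm⟩
      have := h ζ hfr ((c - B) / 2) (by linarith)
      rw [eventually_nhdsWithin_iff] at this
      obtain ⟨x, hx1, hx2⟩ := (hζ.and_eventually this).exists
      have := hx2 hx1.1
      linarith [hx1.2]
  have hKc : IsCompact K := Metric.isCompact_of_isClosed_isBounded hKcl (hb.subset fun x hx => hx.1)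
  obtain ⟨z₁, hz₁, hmax⟩ := hKc.exists_isMaxOn ⟨z, hz, hcz.le⟩
    (hcont.mono fun x hx => hx.1)
  have hle : ∀ x ∈ U, ‖f x‖ ≤ ‖f z₁‖ := fun x hx => by
    by_cases hx' : c ≤ ‖f x‖
    · exact hmax ⟨hx, hx'⟩
    · exact (not_le.1 hx').le.trans hz₁.2
  -- The set of maximum points is closed, and open by the strong maximum principle. As ℂ is
  -- connected it would be all of ℂ, which is not compact; U itself need not be connected.
  set S : Set ℂ := {x | x ∈ U ∧ ‖f x‖ = ‖f z₁‖} with hS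
  have hSK : S = K ∩ (fun x => ‖f x‖) ⁻¹' {‖f z₁‖} := by
    ext x
    constructor
    · rintro ⟨h1, h2⟩
      exact ⟨⟨h1, h2 ▸ hz₁.2⟩, h2⟩
    · rintro ⟨h1, h2⟩
      exact ⟨h1.1, h2⟩
  have hScl : IsClosed S := by
    rw [hSK]
    exact (hcont.mono fun x hx => hx.1).preimage_isClosed_of_isClosed hKcl isClosed_singleton
  have hSop : IsOpen S := by
    rw [isOpen_iff_eventually]
    rintro x ⟨hx1, hx2⟩
    have hnhds := hU.mem_nhds hx1
    have hloc : IsLocalMax (norm ∘ f) x := by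
      filter_upwards [hnhds] with y hy
      simp only [Function.comp]
      rw [hx2]; exact hle y hy
    have hd : ∀ᶠ y in 𝓝 x, DifferentiableAt ℂ f y := by
      filter_upwards [hU.mem_nhds hx1] with y hy using hf.differentiableAt (hU.mem_nhds hy)
    filter_upwards [hnhds, Complex.norm_eventually_eq_of_isLocalMax hd hloc] with y h1 h2
    exact ⟨h1, h2.trans hx2⟩
  have huniv : S = Set.univ := (IsClopen.eq_univ ⟨hScl, hSop⟩ ⟨z₁, hz₁.1, rfl⟩)
  have : IsCompact (Set.univ : Set ℂ) := by
    rw [← huniv]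
    exact hKc.of_isClosed_subset hScl (by rw [hSK]; exact Set.inter_subset_left)
  exact noncompact_univ ℂ this

open Filter Topology Metric in
/-- Division of a bounded function on the unit disc by the Blaschke factor of one of its zeros. -/
theorem norm_dslope_mul_le_one {Q : ℂ → ℂ} (hQ : DifferentiableOn ℂ Q (ball 0 1))
    (hQ1 : ∀ z ∈ ball (0 : ℂ) 1, ‖Q z‖ ≤ 1) {a : ℂ} (ha : ‖a‖ < 1) (hQa : Q a = 0) {z : ℂ}
    (hz : z ∈ ball (0 : ℂ) 1) : ‖dslope Q a z * (1 - conj a * z)‖ ≤ 1 := by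
  have hball : ball (0 : ℂ) 1 ∈ 𝓝 a := isOpen_ball.mem_nhds (by simpa using ha)
  refine norm_le_of_frontier_eventually_le isOpen_ball isBounded_ball
    (f := fun z => dslope Q a z * (1 - conj a * z))
    (((Complex.differentiableOn_dslope hball).2 hQ).mul (by fun_prop)) ?_ hz
  intro ζ hζ η hη
  have hζ1 : ‖ζ‖ = 1 := by
    rw [frontier_ball _ one_ne_zero] at hζ; simpa using hζ
  have hne : ζ - a ≠ 0 := fun h => by
    rw [sub_eq_zero.1 h] at hζ1; linarith
  -- The Blaschke factor of a has modulus one on the unit circle, so dividing by it leaves the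
  -- boundary bound intact.
  have hlim : Tendsto (fun x : ℂ => ‖1 - conj a * x‖ / ‖x - a‖) (𝓝 ζ) (𝓝 1) := by
    have h1 : ‖1 - conj a * ζ‖ = ‖ζ - a‖ := by
      have : 1 - conj a * ζ = ζ * conj (ζ - a) := by
        rw [map_sub, mul_sub, Complex.mul_conj', hζ1]; push_cast; ring
      rw [this, norm_mul, hζ1, one_mul, RCLike.norm_conj]
    have h2 : Tendsto (fun x : ℂ => ‖1 - conj a * x‖ / ‖x - a‖) (𝓝 ζ)
        (𝓝 (‖1 - conj a * ζ‖ / ‖ζ - a‖)) :=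
      ContinuousAt.tendsto (f := fun x : ℂ => ‖1 - conj a * x‖ / ‖x - a‖) (by
        have := norm_ne_zero_iff.2 hne
        fun_prop (disch := assumption))
    rwa [h1, div_self (norm_ne_zero_iff.2 hne)] at h2
  have hne' : ∀ᶠ x in 𝓝 ζ, x ≠ a :=
    (continuousAt_id (x := ζ)).eventually_ne (sub_ne_zero.1 hne)
  filter_upwards [self_mem_nhdsWithin, mem_nhdsWithin_of_mem_nhds
    (hlim.eventually_le_const (show (1 : ℝ) < 1 + η by linarith)),
    mem_nhdsWithin_of_mem_nhds hne'] with x hx1 hx2 hx3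
  rw [dslope_of_ne _ hx3, slope_def_field, hQa, sub_zero, norm_mul, norm_div, div_mul_eq_mul_div,
    mul_div_assoc]
  exact (mul_le_of_le_one_left (by positivity) (hQ1 x hx1)).trans hx2

open Filter Topology Metric in
/-- The zeros in a smaller disc of a bounded denominator can be removed. -/
theorem exists_denominator_ne_zero {W : ℂ → ℂ} (hW : DifferentiableOn ℂ W (ball 0 1)) {r : ℝ}
    (hr0 : 0 < r) (hr : r < 1) (n : ℕ) : ∀ Q : ℂ → ℂ, DifferentiableOn ℂ Q (ball 0 1) →
    (∀ z ∈ ball (0 : ℂ) 1, ‖Q z‖ ≤ 1) → (∀ z ∈ ball (0 : ℂ) 1, ‖W z * Q z‖ ≤ 1) →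
    r ^ n < ‖Q 0‖ → ∃ Q' : ℂ → ℂ, DifferentiableOn ℂ Q' (ball 0 1) ∧
      (∀ z ∈ ball (0 : ℂ) 1, ‖Q' z‖ ≤ 1) ∧ (∀ z ∈ ball (0 : ℂ) 1, ‖W z * Q' z‖ ≤ 1) ∧
      ‖Q 0‖ ≤ ‖Q' 0‖ ∧ ∀ z ∈ ball (0 : ℂ) r, Q' z ≠ 0 := by
  -- Dividing out a zero a with |a| < r multiplies |Q 0| by 1/|a| > 1/r, while the bound 1 on Q
  -- persists. So r ^ n < |Q 0| leaves room for fewer than n divisions, and n = 0 is contradictory.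
  induction n with
  | zero =>
    intro Q _ h1 _ h2
    have := h1 0 (by simp)
    rw [pow_zero] at h2
    linarith
  | succ n ih =>
    intro Q hQ hQ1 hWQ hn
    by_cases hzero : ∀ z ∈ ball (0 : ℂ) r, Q z ≠ 0
    · exact ⟨Q, hQ, hQ1, hWQ, le_rfl, hzero⟩
    push Not at hzero
    obtain ⟨a, ha, hQa⟩ := hzero
    have har : ‖a‖ < r := by simpa using ha
    have ha1 : ‖a‖ < 1 := har.trans hr
    have hball : ball (0 : ℂ) 1 ∈ 𝓝 a := isOpen_ball.mem_nhds (by simpa using ha1)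
    have hQ0 : Q 0 ≠ 0 := fun h => by
      rw [h, norm_zero] at hn; exact absurd hn (not_lt.2 (by positivity))
    have ha0 : a ≠ 0 := fun h => hQ0 (h ▸ hQa)
    have hapos : 0 < ‖a‖ := norm_pos_iff.2 ha0
    have hval : ‖dslope Q a 0 * (1 - conj a * 0)‖ = ‖Q 0‖ / ‖a‖ := by
      rw [dslope_of_ne _ (Ne.symm ha0), slope_def_field, hQa]
      simp
    have hWeq : ∀ z, W z * (dslope Q a z * (1 - conj a * z)) = dslope (fun z => W z * Q z) a z *
        (1 - conj a * z) ∨ z = a := by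
      intro z
      by_cases hz : z = a
      · exact Or.inr hz
      · left
        rw [dslope_of_ne _ hz, dslope_of_ne _ hz, slope_def_field, slope_def_field, hQa]
        ring
    have hWa : W a * dslope Q a a = dslope (fun z => W z * Q z) a a := by
      rw [dslope_same, dslope_same, deriv_fun_mul (hW.differentiableAt hball)
        (hQ.differentiableAt hball), hQa]
      ring
    -- The product W Q vanishes at a as well, so the same division applies to it and its bound
    -- survives.
    have hWQ' : ∀ z ∈ ball (0 : ℂ) 1, ‖W z * (dslope Q a z * (1 - conj a * z))‖ ≤ 1 := by
      intro z hz
      have heq : W z * (dslope Q a z * (1 - conj a * z)) = dslope (fun z => W z * Q z) a z *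
          (1 - conj a * z) := by
        rcases hWeq z with h | rfl
        · exact h
        · rw [← mul_assoc, hWa]
      rw [heq]
      exact norm_dslope_mul_le_one (hW.mul hQ) hWQ ha1 (by simp [hQa]) hz
    obtain ⟨Q', h1, h2, h3, h4, h5⟩ := ih (fun z => dslope Q a z * (1 - conj a * z))
      (((Complex.differentiableOn_dslope hball).2 hQ).mul (by fun_prop))
      (fun z hz => norm_dslope_mul_le_one hQ hQ1 ha1 hQa hz) hWQ' (by
        rw [hval, lt_div_iff₀ hapos]
        refine lt_of_le_of_lt ?_ hn
        rw [pow_succ]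
        gcongr)
    refine ⟨Q', h1, h2, h3, le_trans ?_ h4, h5⟩
    rw [hval, le_div_iff₀ hapos]
    exact mul_le_of_le_one_right (norm_nonneg _) ha1.le

open Filter Topology Metric in
/-- The Carathéodory inequality for functions with nonnegative real part on a disc. -/
theorem norm_le_of_re_nonneg_ball {S : ℂ → ℂ} {r : ℝ} (hr : 0 < r)
    (hS : DifferentiableOn ℂ S (ball 0 r)) (hre : ∀ z ∈ ball (0 : ℂ) r, 0 ≤ (S z).re) {z : ℂ}
    (hz : z ∈ ball (0 : ℂ) r) : ‖S z‖ ≤ ‖S 0‖ * (r + ‖z‖) / (r - ‖z‖) := by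
  -- Borel-Carathéodory asks for a positive bound M on the real part of -S; letting M tend to 0
  -- removes its first term.
  have h : ∀ M : ℝ, 0 < M →
      ‖S z‖ ≤ 2 * M * ‖z‖ / (r - ‖z‖) + ‖S 0‖ * (r + ‖z‖) / (r - ‖z‖) := fun M hM => by
    have := Complex.borelCaratheodory (f := fun z => -S z) hM hS.neg (fun x hx => by
      have := hre x hx
      simp only [Set.mem_ofPred_eq, Complex.neg_re]; linarith) hr hz
    simpa using this
  have hlim : Tendsto (fun M : ℝ => 2 * M * ‖z‖ / (r - ‖z‖) + ‖S 0‖ * (r + ‖z‖) / (r - ‖z‖))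
      (𝓝[>] 0) (𝓝 (‖S 0‖ * (r + ‖z‖) / (r - ‖z‖))) := by
    refine (Continuous.tendsto' (by fun_prop) _ _ (by simp)).mono_left nhdsWithin_le_nhds
  exact ge_of_tendsto hlim (by filter_upwards [self_mem_nhdsWithin] with M hM using h M hM)

open Filter Topology Metric in
/-- A quotient `P / Q` of functions bounded by one on the unit disc has at most the growth of the
inverse of a zero-free function. -/
theorem norm_le_exp_of_denominator {W Q : ℂ → ℂ} (hW : DifferentiableOn ℂ W (ball 0 1))
    (hQ : DifferentiableOn ℂ Q (ball 0 1)) (hQ1 : ∀ z ∈ ball (0 : ℂ) 1, ‖Q z‖ ≤ 1)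
    (hWQ : ∀ z ∈ ball (0 : ℂ) 1, ‖W z * Q z‖ ≤ 1) (hQ0 : Q 0 ≠ 0) {z : ℂ} (hz : ‖z‖ < 1) :
    ‖W z‖ ≤ Real.exp (-Real.log ‖Q 0‖ * (1 + ‖z‖) / (1 - ‖z‖)) := by
  have key : ∀ r : ℝ, ‖z‖ < r → r < 1 →
      ‖W z‖ ≤ Real.exp (-Real.log ‖Q 0‖ * (r + ‖z‖) / (r - ‖z‖)) := by
    intro r hzr hr1
    have hr0 : 0 < r := (norm_nonneg _).trans_lt hzr
    have hQ0' : 0 < ‖Q 0‖ := norm_pos_iff.2 hQ0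
    obtain ⟨n, hn⟩ := exists_pow_lt_of_lt_one hQ0' hr1
    obtain ⟨g, hg, hg1, hWg, hg0, hne⟩ := exists_denominator_ne_zero hW hr0 hr1 n Q hQ hQ1 hWQ hn
    have hsub : ball (0 : ℂ) r ⊆ ball 0 1 := ball_subset_ball hr1.le
    have hgr := hg.mono hsub
    have hzr' : z ∈ ball (0 : ℂ) r := by simpa using hzr
    have h0r : (0 : ℂ) ∈ ball (0 : ℂ) r := by simpa using hr0
    have hgd : DifferentiableOn ℂ (deriv g) (ball 0 r) := hgr.deriv isOpen_ball
    -- L is a logarithm of g up to a unimodular constant: L' = g'/g, with the real value log |g 0|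
    -- at 0. Hence |g| = exp(Re L), and -L has nonnegative real part because |g| ≤ 1.
    obtain ⟨L, hL0, hL⟩ := (DifferentiableOn.isExactOn_ball
      (hgd.div hgr hne)).with_val_at 0 (Real.log ‖g 0‖ : ℂ)
    have hconst : ∀ x ∈ ball (0 : ℂ) r, g x * Complex.exp (-L x) = g 0 * Complex.exp (-L 0) := by
      intro x hx
      refine (convex_ball (0 : ℂ) r).is_const_of_fderivWithin_eq_zero (𝕜 := ℂ)
        (f := fun x => g x * Complex.exp (-L x)) (fun y hy => ?_) (fun y hy => ?_) hx h0r
      · exact ((hgr.differentiableAt (isOpen_ball.mem_nhds hy)).mul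
          ((hL y hy).differentiableAt.neg.cexp)).differentiableWithinAt
      · have h1 := ((hgr.differentiableAt (isOpen_ball.mem_nhds hy)).hasDerivAt.mul
          ((hL y hy).neg.cexp))
        have h2 : HasDerivAt (fun x => g x * Complex.exp (-L x)) 0 y := by
          refine h1.congr_deriv ?_
          have := hne y hy
          simp only [Pi.div_apply, Pi.neg_apply]
          field_simp
          ring
        rw [fderivWithin_of_isOpen isOpen_ball hy, h2.hasFDerivAt.fderiv]
        ext; simp
    have hg0' : 0 < ‖g 0‖ := hQ0'.trans_le hg0
    have hnorm : ∀ x ∈ ball (0 : ℂ) r, ‖g x‖ = Real.exp (L x).re := by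
      intro x hx
      have h1 := congrArg norm (hconst x hx)
      rw [norm_mul, norm_mul, Complex.norm_exp, Complex.norm_exp, Complex.neg_re, Complex.neg_re,
        hL0, Complex.ofReal_re, Real.exp_neg (Real.log _), Real.exp_log hg0',
        mul_inv_cancel₀ hg0'.ne', Real.exp_neg] at h1
      field_simp at h1
      exact h1
    have hre : ∀ x ∈ ball (0 : ℂ) r, 0 ≤ (-L x).re := by
      intro x hx
      have h1 := hg1 x (hsub hx)
      rw [hnorm x hx, Real.exp_le_one_iff] at h1
      rw [Complex.neg_re]; linarith
    have hLd : DifferentiableOn ℂ (fun x => -L x) (ball 0 r) := fun x hx =>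
      (hL x hx).differentiableAt.neg.differentiableWithinAt
    have hb := norm_le_of_re_nonneg_ball hr0 hLd hre hzr'
    rw [hL0, norm_neg, norm_neg, Complex.norm_real, Real.norm_eq_abs, abs_of_nonpos
      (Real.log_nonpos hg0'.le (hg1 0 (hsub h0r)))] at hb
    have h2 := hWg z (hsub hzr')
    rw [norm_mul, hnorm z hzr'] at h2
    have h3 : ‖W z‖ ≤ Real.exp (-(L z).re) := by
      rw [Real.exp_neg, ← one_div, le_div_iff₀ (Real.exp_pos _)]; exact h2
    refine h3.trans (Real.exp_le_exp.2 ?_)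
    have h4 : -(L z).re ≤ ‖L z‖ := (neg_le_abs _).trans (Complex.abs_re_le_norm _)
    refine h4.trans (hb.trans ?_)
    have h5 : 0 < r - ‖z‖ := by linarith
    have h6 := Real.log_le_log hQ0' hg0
    gcongr
  have h1z : (1 : ℝ) - ‖z‖ ≠ 0 := by linarith
  have hlim : Tendsto (fun r : ℝ => Real.exp (-Real.log ‖Q 0‖ * (r + ‖z‖) / (r - ‖z‖)))
      (𝓝[<] 1) (𝓝 (Real.exp (-Real.log ‖Q 0‖ * (1 + ‖z‖) / (1 - ‖z‖)))) := by
    refine Tendsto.mono_left (ContinuousAt.tendsto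
      (f := fun r : ℝ => Real.exp (-Real.log ‖Q 0‖ * (r + ‖z‖) / (r - ‖z‖))) ?_)
      nhdsWithin_le_nhds
    fun_prop (disch := assumption)
  refine ge_of_tendsto hlim ?_
  filter_upwards [Ioo_mem_nhdsLT hz] with r hr using key r hr.1 hr.2

/-! ### Transfer to the upper half-plane -/

/-- The conformal map of the unit disc onto the upper half-plane that maps `0` to `p`. -/
noncomputable def discToUpperHalf (p ζ : ℂ) : ℂ := (p - conj p * ζ) / (1 - ζ)

theorem discToUpperHalf_zero (p : ℂ) : discToUpperHalf p 0 = p := by simp [discToUpperHalf]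

theorem one_sub_ne_zero_of_norm_lt {ζ : ℂ} (hζ : ‖ζ‖ < 1) : 1 - ζ ≠ 0 := fun h => by
  rw [← sub_eq_zero.1 h, norm_one] at hζ; exact lt_irrefl _ hζ

theorem discToUpperHalf_mem {p ζ : ℂ} (hp : p ∈ upperHalf) (hζ : ‖ζ‖ < 1) :
    discToUpperHalf p ζ ∈ upperHalf := by
  have h1 := one_sub_ne_zero_of_norm_lt hζ
  have hp' : 0 < p.im := hp
  have h2 : Complex.normSq ζ < 1 := by
    rw [Complex.normSq_eq_norm_sq]; nlinarith [norm_nonneg ζ]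
  have h3 : 0 < Complex.normSq (1 - ζ) := Complex.normSq_pos.2 h1
  have h4 : (discToUpperHalf p ζ).im = p.im * (1 - Complex.normSq ζ) / Complex.normSq (1 - ζ) := by
    rw [discToUpperHalf, Complex.div_im]
    simp only [Complex.normSq_apply] at *
    simp only [Complex.sub_im, Complex.sub_re, Complex.mul_im, Complex.mul_re, Complex.conj_re,
      Complex.conj_im, Complex.one_re, Complex.one_im] at *
    field_simp
    ring
  change 0 < (discToUpperHalf p ζ).im
  rw [h4]
  have : 0 < 1 - Complex.normSq ζ := by linarith
  positivity

theorem differentiableOn_discToUpperHalf (p : ℂ) :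
    DifferentiableOn ℂ (discToUpperHalf p) (Metric.ball 0 1) := by
  refine DifferentiableOn.div (by fun_prop) (by fun_prop) fun ζ hζ => ?_
  exact one_sub_ne_zero_of_norm_lt (by simpa using hζ)

/-- The preimage is ζ = (z - p)/(z - conj p), with 1 - |ζ|² = 4 Im p Im z / |z - conj p|². Since (1
+ |ζ|)/(1 - |ζ|) = (1 + |ζ|)²/(1 - |ζ|²), this is at most |z - conj p|²/(Im p Im z). It is the
source of the growth rate (1 + |z|)²/Im z. -/
theorem exists_discToUpperHalf_eq {p z : ℂ} (hp : p ∈ upperHalf) (hz : z ∈ upperHalf) :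
    ∃ ζ : ℂ, ‖ζ‖ < 1 ∧ discToUpperHalf p ζ = z ∧
      (1 + ‖ζ‖) / (1 - ‖ζ‖) ≤ (1 + ‖p‖) ^ 2 / p.im * ((1 + ‖z‖) ^ 2 / z.im) := by
  have hp' : 0 < p.im := hp
  have hz' : 0 < z.im := hz
  have hne : z - conj p ≠ 0 := fun h => by
    have := congrArg Complex.im h
    simp at this; linarith
  have hd : 0 < ‖z - conj p‖ := norm_pos_iff.2 hne
  have hsq : ‖(z - p) / (z - conj p)‖ ^ 2 = 1 - 4 * p.im * z.im / ‖z - conj p‖ ^ 2 := by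
    have : ‖z - conj p‖ ^ 2 ≠ 0 := by positivity
    rw [norm_div, div_pow]
    field_simp
    rw [← Complex.normSq_eq_norm_sq, ← Complex.normSq_eq_norm_sq]
    simp only [Complex.normSq_apply, Complex.sub_im, Complex.sub_re, Complex.conj_re,
      Complex.conj_im]
    ring
  set s := ‖(z - p) / (z - conj p)‖ with hs
  have hs0 : 0 ≤ s := norm_nonneg _
  have hpos : 0 < 4 * p.im * z.im / ‖z - conj p‖ ^ 2 := by positivity
  have hs1 : s < 1 := by nlinarith
  refine ⟨(z - p) / (z - conj p), hs1, ?_, ?_⟩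
  · have hne2 : p - conj p ≠ 0 := fun h => by
      have := congrArg Complex.im h
      simp at this; linarith
    have h1 : 1 - (z - p) / (z - conj p) = (p - conj p) / (z - conj p) := by
      field_simp; ring
    rw [discToUpperHalf, h1]
    field_simp
    ring
  · rw [← hs]
    have h1 : (1 + s) / (1 - s) = (1 + s) ^ 2 / (4 * p.im * z.im / ‖z - conj p‖ ^ 2) := by
      rw [show 4 * p.im * z.im / ‖z - conj p‖ ^ 2 = (1 - s) * (1 + s) by linarith]
      have : 1 - s ≠ 0 := by linarith
      field_simp
    rw [h1]
    have h2 : ‖z - conj p‖ ≤ (1 + ‖p‖) * (1 + ‖z‖) := by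
      have := norm_sub_le z (conj p)
      rw [RCLike.norm_conj] at this
      nlinarith [norm_nonneg z, norm_nonneg p]
    calc (1 + s) ^ 2 / (4 * p.im * z.im / ‖z - conj p‖ ^ 2)
        ≤ 2 ^ 2 / (4 * p.im * z.im / ‖z - conj p‖ ^ 2) := by gcongr; linarith
      _ = ‖z - conj p‖ ^ 2 / (p.im * z.im) := by field_simp; ring
      _ ≤ ((1 + ‖p‖) * (1 + ‖z‖)) ^ 2 / (p.im * z.im) := by gcongr
      _ = _ := by field_simp

/-- `u` has at most the growth of a function of bounded type in the upper half-plane. -/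
def HasNevanlinnaGrowth (u : ℂ → ℂ) : Prop :=
  ∃ C : ℝ, 0 ≤ C ∧ ∀ z ∈ upperHalf, ‖u z‖ ≤ Real.exp (C * ((1 + ‖z‖) ^ 2 / z.im))

/-- The centre of the disc is placed at a point p where the denominator does not vanish, and the
bound for quotients on the disc is carried over. Both functions are divided by m to be bounded by 1.
-/
theorem IsBoundedType.hasNevanlinnaGrowth {u : ℂ → ℂ} (hu : DifferentiableOn ℂ u upperHalf)
    (h : IsBoundedType u) : HasNevanlinnaGrowth u := by
  obtain ⟨P, Q, hP, hQ, ⟨a, ha⟩, ⟨b, hb⟩, ⟨p, hp, hQp⟩, h⟩ := h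
  set m : ℝ := max (max a b) 1 with hm
  have hm0 : 0 < m := lt_of_lt_of_le one_pos (le_max_right _ _)
  set M : ℝ := -Real.log (‖Q p‖ / m) with hM
  have hmaps : Set.MapsTo (discToUpperHalf p) (Metric.ball 0 1) upperHalf := fun ζ hζ =>
    discToUpperHalf_mem hp (by simpa using hζ)
  have hM0 : 0 ≤ M := by
    rw [hM, neg_nonneg]
    refine Real.log_nonpos (by positivity) ?_
    rw [div_le_one hm0]
    exact (hb p hp).trans ((le_max_right _ _).trans (le_max_left _ _))
  have hp' : 0 < p.im := hp
  refine ⟨M * ((1 + ‖p‖) ^ 2 / p.im), by positivity, fun z hz => ?_⟩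
  obtain ⟨ζ, hζ1, rfl, hζ2⟩ := exists_discToUpperHalf_eq hp hz
  have hnm : ‖(m : ℂ)‖ = m := by rw [Complex.norm_real, Real.norm_eq_abs, abs_of_pos hm0]
  have key := norm_le_exp_of_denominator (W := fun ζ => u (discToUpperHalf p ζ))
    (Q := fun ζ => Q (discToUpperHalf p ζ) / m)
    (hu.comp (differentiableOn_discToUpperHalf p) hmaps)
    ((hQ.comp (differentiableOn_discToUpperHalf p) hmaps).div_const _)
    (fun x hx => by
      rw [norm_div, hnm, div_le_one hm0]
      exact (hb _ (hmaps hx)).trans ((le_max_right _ _).trans (le_max_left _ _)))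
    (fun x hx => by
      rw [← mul_div_assoc, h _ (hmaps hx), norm_div, hnm, div_le_one hm0]
      exact (ha _ (hmaps hx)).trans ((le_max_left _ _).trans (le_max_left _ _)))
    (by
      rw [discToUpperHalf_zero]
      exact div_ne_zero hQp (by exact_mod_cast hm0.ne')) hζ1
  refine key.trans (Real.exp_le_exp.2 ?_)
  rw [discToUpperHalf_zero, norm_div, hnm, ← hM, mul_div_assoc, mul_assoc]
  gcongr

/-- The Carathéodory inequality on the unit disc, carried over with centre i. It will be applied to
the quotient (e^{iα}G + e^{-iα}G*)/(e^{iα}G - e^{-iα}G*). -/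
theorem exists_norm_le_of_re_nonneg {S : ℂ → ℂ} (hS : DifferentiableOn ℂ S upperHalf)
    (hre : ∀ z ∈ upperHalf, 0 ≤ (S z).re) :
    ∃ C : ℝ, 0 ≤ C ∧ ∀ z ∈ upperHalf, ‖S z‖ ≤ C * ((1 + ‖z‖) ^ 2 / z.im) := by
  have hmaps : Set.MapsTo (discToUpperHalf Complex.I) (Metric.ball 0 1) upperHalf := fun ζ hζ =>
    discToUpperHalf_mem I_mem_upperHalf (by simpa using hζ)
  refine ⟨‖S Complex.I‖ * ((1 + ‖Complex.I‖) ^ 2 / Complex.I.im), by simp, fun z hz => ?_⟩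
  obtain ⟨ζ, hζ1, rfl, hζ2⟩ := exists_discToUpperHalf_eq I_mem_upperHalf hz
  have key := norm_le_of_re_nonneg_ball (S := fun ζ => S (discToUpperHalf Complex.I ζ)) one_pos
    (hS.comp (differentiableOn_discToUpperHalf _) hmaps) (fun x hx => hre _ (hmaps hx))
    (z := ζ) (by simpa using hζ1)
  refine key.trans ?_
  rw [discToUpperHalf_zero, mul_div_assoc, mul_assoc]
  gcongr

/-! ### The maximum principle of Phragmén-Lindelöf type -/

/-- Im(z/(R² - z²)) serves as a barrier on the half-disc of radius R: it is nonnegative there,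
equals 1/(2 Im z) on the arc, and R² times it tends to Im z as R grows. -/
theorem im_div_sq_sub_sq (R : ℝ) (z : ℂ) :
    (z / ((R : ℂ) ^ 2 - z ^ 2)).im = z.im * (R ^ 2 + ‖z‖ ^ 2) / ‖(R : ℂ) ^ 2 - z ^ 2‖ ^ 2 := by
  rw [Complex.div_im, ← Complex.normSq_eq_norm_sq, ← Complex.normSq_eq_norm_sq]
  simp only [Complex.normSq_apply, pow_two, Complex.sub_re, Complex.sub_im, Complex.mul_re,
    Complex.mul_im, Complex.ofReal_re, Complex.ofReal_im]
  rw [← sub_div]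
  congr 1
  ring

theorem norm_sq_sub_sq_of_norm_eq {R : ℝ} {z : ℂ} (hz : ‖z‖ = R) :
    ‖(R : ℂ) ^ 2 - z ^ 2‖ = 2 * R * |z.im| := by
  have h1 : (R : ℂ) ^ 2 - z ^ 2 = z * (conj z - z) := by
    rw [mul_sub, Complex.mul_conj', hz]; ring
  have h2 : conj z - z = ((-2 * z.im : ℝ) : ℂ) * Complex.I := by
    apply Complex.ext <;> simp; ring
  rw [h1, h2, norm_mul, norm_mul, hz, Complex.norm_I, Complex.norm_real, Real.norm_eq_abs, abs_mul]
  norm_num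
  ring

open Filter Topology in
/-- A function of Nevanlinna growth, bounded on the real line, is of exponential type. -/
theorem HasNevanlinnaGrowth.exists_norm_le_exp_of_le_one {w : ℂ → ℂ}
    (hw : DifferentiableOn ℂ w upperHalf) (hg : HasNevanlinnaGrowth w)
    (hb : ∀ t : ℝ, ∀ η : ℝ, 0 < η → ∀ᶠ z in 𝓝[upperHalf] (t : ℂ), ‖w z‖ ≤ 1 + η) :
    ∃ C : ℝ, 0 ≤ C ∧ ∀ z ∈ upperHalf, ‖w z‖ ≤ Real.exp (C * z.im) := by
  obtain ⟨C, hC, hwC⟩ := hg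
  refine ⟨8 * C, by positivity, fun z hz => ?_⟩
  have hz' : 0 < z.im := hz
  -- The constant 8 comes from the arc |z| = R: there 8CR² times the barrier is C(2R)²/Im z, which
  -- dominates the growth bound C(1 + R)²/Im z because R ≥ 1.
  have key : ∀ R : ℝ, 1 ≤ R → ‖z‖ < R →
      ‖w z‖ ≤ Real.exp (8 * C * R ^ 2 * (z / ((R : ℂ) ^ 2 - z ^ 2)).im) := by
    intro R hR hzR
    have hR0 : 0 < R := by linarith
    set U : Set ℂ := upperHalf ∩ Metric.ball 0 R with hU
    have hUo : IsOpen U := isOpen_upperHalf.inter Metric.isOpen_ball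
    have hne : ∀ x : ℂ, 0 < x.im → (R : ℂ) ^ 2 - x ^ 2 ≠ 0 := by
      intro x hx h
      have h1 : ((R : ℂ) - x) * (R + x) = 0 := by linear_combination h
      rcases mul_eq_zero.1 h1 with h2 | h2 <;>
      · have := congrArg Complex.im h2
        simp at this
        exact hx.ne' this
    set H : ℂ → ℂ := fun x => 8 * C * R ^ 2 * Complex.I * (x / ((R : ℂ) ^ 2 - x ^ 2)) with hH
    have hHre : ∀ x : ℂ, (H x).re = -(8 * C * R ^ 2 * (x / ((R : ℂ) ^ 2 - x ^ 2)).im) := by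
      intro x
      have : H x = ((8 * C * R ^ 2 : ℝ) : ℂ) * (Complex.I * (x / ((R : ℂ) ^ 2 - x ^ 2))) := by
        simp only [hH]; push_cast; ring
      rw [this, Complex.re_ofReal_mul, Complex.I_mul_re]
      ring
    have hHd : ∀ x : ℂ, 0 < x.im → DifferentiableAt ℂ H x := by
      intro x hx
      have := hne x hx
      simp only [hH]
      fun_prop (disch := assumption)
    have hfin : ‖w z * Complex.exp (H z)‖ ≤ 1 := by
      refine norm_le_of_frontier_eventually_le hUo (Metric.isBounded_ball.subset
        Set.inter_subset_right) (f := fun x => w x * Complex.exp (H x)) ?_ ?_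
        ⟨hz, by simpa using hzR⟩
      · intro x hx
        exact ((hw.differentiableAt (isOpen_upperHalf.mem_nhds hx.1)).mul
          (hHd x hx.1).cexp).differentiableWithinAt
      · intro ζ hζ η hη
        have hcl : ζ ∈ closure U := frontier_subset_closure hζ
        have him : 0 ≤ ζ.im := by
          have : closure U ⊆ {x : ℂ | 0 ≤ x.im} :=
            closure_minimal (fun x hx => show 0 ≤ x.im from le_of_lt hx.1)
              (isClosed_le continuous_const Complex.continuous_im)
          exact this hcl
        have hnm : ‖ζ‖ ≤ R := by
          have : closure U ⊆ {x : ℂ | ‖x‖ ≤ R} :=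
            closure_minimal (fun x hx => by simpa using (Metric.mem_ball.1 hx.2).le)
              (isClosed_le continuous_norm continuous_const)
          exact this hcl
        have hnU : ζ ∉ U := by
          rw [frontier, hUo.interior_eq] at hζ; exact hζ.2
        rcases him.eq_or_lt with h0 | h0
        · have hζr : ζ = (ζ.re : ℂ) := Complex.ext (by simp) (by simp [← h0])
          have h1 := hb ζ.re η hη
          rw [← hζr] at h1
          filter_upwards [h1.filter_mono (nhdsWithin_mono _ Set.inter_subset_left),
            self_mem_nhdsWithin] with x hx hxU
          rw [norm_mul, Complex.norm_exp, hHre, im_div_sq_sub_sq]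
          refine (mul_le_of_le_one_right (norm_nonneg _) ?_).trans hx
          rw [Real.exp_le_one_iff, neg_nonpos]
          have : 0 < x.im := hxU.1
          positivity
        · have hnR : ‖ζ‖ = R := by
            refine hnm.antisymm (not_lt.1 fun h => hnU ⟨h0, by simpa using h⟩)
          have hζ0 := hne ζ h0
          have hcont : ContinuousAt (fun x : ℂ =>
              Real.exp (C * ((1 + ‖x‖) ^ 2 / x.im) + (H x).re)) ζ := by
            refine Real.continuous_exp.continuousAt.comp (ContinuousAt.add (ContinuousAt.mul
              continuousAt_const (ContinuousAt.div (by fun_prop) (by fun_prop) h0.ne')) ?_)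
            exact Complex.continuous_re.continuousAt.comp (hHd ζ h0).continuousAt
          have hval : Real.exp (C * ((1 + ‖ζ‖) ^ 2 / ζ.im) + (H ζ).re) ≤ 1 := by
            rw [Real.exp_le_one_iff, hHre, im_div_sq_sub_sq, norm_sq_sub_sq_of_norm_eq hnR, hnR,
              abs_of_pos h0]
            have h3 : 8 * C * R ^ 2 * (ζ.im * (R ^ 2 + R ^ 2) / (2 * R * ζ.im) ^ 2)
                = C * ((2 * R) ^ 2 / ζ.im) := by field_simp; ring
            rw [h3, ← sub_eq_add_neg, sub_nonpos]
            gcongr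
            linarith
          have h4 := hcont.eventually_lt_const (hval.trans_lt (show (1 : ℝ) < 1 + η by linarith))
          filter_upwards [mem_nhdsWithin_of_mem_nhds h4, self_mem_nhdsWithin] with x hx hxU
          rw [norm_mul, Complex.norm_exp]
          refine le_trans ?_ (le_of_lt hx)
          rw [Real.exp_add]
          gcongr
          exact hwC x hxU.1
    rw [norm_mul, Complex.norm_exp, hHre, Real.exp_neg, ← div_eq_mul_inv,
      div_le_one (Real.exp_pos _)] at hfin
    exact hfin
  have hlim : Tendsto (fun R : ℝ => Real.exp (8 * C * R ^ 2 * (z / ((R : ℂ) ^ 2 - z ^ 2)).im))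
      atTop (𝓝 (Real.exp (8 * C * z.im))) := by
    refine (Real.continuous_exp.tendsto _).comp ?_
    have h1 : Tendsto (fun R : ℝ => ((R : ℂ) ^ 2)⁻¹) atTop (𝓝 0) := by
      have : Tendsto (fun R : ℝ => (((R ^ 2)⁻¹ : ℝ) : ℂ)) atTop (𝓝 ((0 : ℝ) : ℂ)) :=
        (Complex.continuous_ofReal.tendsto 0).comp
          (tendsto_inv_atTop_zero.comp (tendsto_pow_atTop two_ne_zero))
      simpa using this
    have h2 : Tendsto (fun R : ℝ => (z / (1 - z ^ 2 * ((R : ℂ) ^ 2)⁻¹)).im) atTop (𝓝 z.im) := by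
      refine (Complex.continuous_im.tendsto z).comp ?_
      have : Tendsto (fun R : ℝ => z / (1 - z ^ 2 * ((R : ℂ) ^ 2)⁻¹)) atTop
          (𝓝 (z / (1 - z ^ 2 * 0))) :=
        tendsto_const_nhds.div (tendsto_const_nhds.sub (tendsto_const_nhds.mul h1)) (by simp)
      simpa using this
    refine (h2.const_mul (8 * C)).congr' ?_
    filter_upwards [eventually_gt_atTop 0] with R hR
    have hR' : (R : ℂ) ≠ 0 := by exact_mod_cast hR.ne'
    rw [mul_assoc (8 * C)]
    congr 1
    have : z / (1 - z ^ 2 * ((R : ℂ) ^ 2)⁻¹) = ((R ^ 2 : ℝ) : ℂ) * (z / ((R : ℂ) ^ 2 - z ^ 2)) := by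
      have e : 1 - z ^ 2 * ((R : ℂ) ^ 2)⁻¹ = ((R : ℂ) ^ 2 - z ^ 2) / (R : ℂ) ^ 2 := by
        field_simp
      rw [e, div_div_eq_mul_div]
      push_cast
      ring
    rw [this, Complex.im_ofReal_mul]
  refine ge_of_tendsto hlim ?_
  filter_upwards [eventually_ge_atTop 1, eventually_gt_atTop ‖z‖] with R h1 h2 using key R h1 h2

theorem one_le_nevanlinna {z : ℂ} (hz : z ∈ upperHalf) : 1 ≤ (1 + ‖z‖) ^ 2 / z.im := by
  have hz' : 0 < z.im := hz
  rw [le_div_iff₀ hz']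
  have := (le_abs_self _).trans (Complex.abs_im_le_norm z)
  nlinarith [norm_nonneg z]

/-- The factor A can be absorbed in the exponent because (1 + |z|)²/Im z is at least 1. -/
theorem HasNevanlinnaGrowth.of_le_mul {w : ℂ → ℂ} {A C : ℝ} (hC : 0 ≤ C)
    (h : ∀ z ∈ upperHalf, ‖w z‖ ≤ A * Real.exp (C * ((1 + ‖z‖) ^ 2 / z.im))) :
    HasNevanlinnaGrowth w := by
  refine ⟨C + |A|, by positivity, fun z hz => (h z hz).trans ?_⟩
  have h1 := one_le_nevanlinna hz
  rw [add_mul, Real.exp_add, mul_comm]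
  gcongr
  have h2 := Real.add_one_le_exp (|A| * ((1 + ‖z‖) ^ 2 / z.im))
  nlinarith [le_abs_self A, abs_nonneg A]

open Filter Topology in
theorem HasNevanlinnaGrowth.exists_norm_le_exp {w : ℂ → ℂ}
    (hw : DifferentiableOn ℂ w upperHalf) (hg : HasNevanlinnaGrowth w) {B : ℝ} (hB : 0 < B)
    (hb : ∀ t : ℝ, ∀ η : ℝ, 0 < η → ∀ᶠ z in 𝓝[upperHalf] (t : ℂ), ‖w z‖ ≤ B + η) :
    ∃ C : ℝ, 0 ≤ C ∧ ∀ z ∈ upperHalf, ‖w z‖ ≤ B * Real.exp (C * z.im) := by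
  have hnB : ‖(B : ℂ)‖ = B := by rw [Complex.norm_real, Real.norm_eq_abs, abs_of_pos hB]
  have hgB : HasNevanlinnaGrowth (fun z => w z / B) := by
    obtain ⟨C, hC, h⟩ := hg
    refine HasNevanlinnaGrowth.of_le_mul (A := B⁻¹) hC fun z hz => ?_
    rw [norm_div, hnB, div_eq_inv_mul]
    gcongr
    exact h z hz
  obtain ⟨C, hC, h⟩ := hgB.exists_norm_le_exp_of_le_one (hw.div_const _) fun t η hη => by
    filter_upwards [hb t (B * η) (by positivity)] with z hz
    rw [norm_div, hnB, div_le_iff₀ hB]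
    linarith
  refine ⟨C, hC, fun z hz => ?_⟩
  have := h z hz
  rwa [norm_div, hnB, div_le_iff₀ hB, mul_comm] at this

-- Phragmén-Lindelöf in a half-plane: the mean type excludes exponential growth along the imaginary
-- axis, and this one ray suffices for a function of exponential type that is bounded on horizontal
-- lines.
open Filter Topology Asymptotics in
theorem norm_le_of_exp_type_of_meanType {w : ℂ → ℂ} (hw : DifferentiableOn ℂ w upperHalf)
    {B C : ℝ} (hC : 0 ≤ C) (h : ∀ z ∈ upperHalf, ‖w z‖ ≤ B * Real.exp (C * z.im))
    (hm : meanType w ≤ 0) {z : ℂ} (hz : z ∈ upperHalf) : ‖w z‖ ≤ B := by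
  have hz' : 0 < z.im := hz
  have hB : 0 ≤ B := by
    have := (norm_nonneg _).trans (h z hz)
    exact nonneg_of_mul_nonneg_left this (Real.exp_pos _)
  rw [meanType_nonpos_iff] at hm
  have key : ∀ t : ℝ, 0 < t → t < z.im →
      ‖w z‖ ≤ B * Real.exp (C * t) * Real.exp (t * (z.im - t)) := by
    intro t ht htz
    -- The parameter t has two roles: it raises the boundary line to height t, where w is at most B
    -- exp(Ct), and it is the rate of the damping factor, which makes f bounded on the positive real
    -- axis by the mean type condition. Finally t tends to 0.
    set f : ℂ → ℂ := fun x => w (Complex.I * x + Complex.I * t) * Complex.exp (-(t * x)) with hf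
    have him : ∀ x : ℂ, (Complex.I * x + Complex.I * t).im = x.re + t := by
      intro x; simp
    have hfn : ∀ x : ℂ, ‖f x‖ = ‖w (Complex.I * x + Complex.I * t)‖ * Real.exp (-(t * x.re)) := by
      intro x
      rw [hf, norm_mul, Complex.norm_exp, Complex.neg_re, Complex.re_ofReal_mul]
    have hmem : ∀ x : ℂ, 0 ≤ x.re → Complex.I * x + Complex.I * t ∈ upperHalf := by
      intro x hx
      change 0 < (Complex.I * x + Complex.I * t).im
      rw [him]; linarith
    have hle : ∀ x : ℂ, 0 ≤ x.re → ‖f x‖ ≤ B * Real.exp (C * t) * Real.exp (C * x.re) := by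
      intro x hx
      rw [hfn]
      have h1 := h _ (hmem x hx)
      rw [him, mul_add, Real.exp_add] at h1
      have h2 : Real.exp (-(t * x.re)) ≤ 1 := by
        rw [Real.exp_le_one_iff, neg_nonpos]; positivity
      calc _ ≤ ‖w (Complex.I * x + Complex.I * t)‖ * 1 := by gcongr
        _ ≤ _ := by linarith
    have hcl : closure {x : ℂ | 0 < x.re} ⊆ {x : ℂ | 0 ≤ x.re} :=
      closure_minimal (fun x hx => show 0 ≤ x.re from le_of_lt hx)
        (isClosed_le continuous_const Complex.continuous_re)
    have hdiff : DiffContOnCl ℂ f {x : ℂ | 0 < x.re} := by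
      refine DifferentiableOn.diffContOnCl fun x hx => ?_
      refine DifferentiableAt.differentiableWithinAt ?_
      have h1 := hw.differentiableAt (isOpen_upperHalf.mem_nhds (hmem x (hcl hx)))
      exact (DifferentiableAt.comp x h1 (by fun_prop)).mul (by fun_prop)
    set x₀ : ℂ := -Complex.I * z - t with hx₀
    have hx₀re : x₀.re = z.im - t := by simp [hx₀]
    have h0 : Complex.I * x₀ + Complex.I * t = z := by
      have := Complex.I_mul_I
      linear_combination (-z) * this
    have hfin : ‖f x₀‖ ≤ B * Real.exp (C * t) := by
      refine PhragmenLindelof.right_half_plane_of_bounded_on_real hdiff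
        ⟨1, one_lt_two, C, ?_⟩ ?_ (fun y => ?_) (by rw [hx₀re]; linarith)
      · refine IsBigO.of_bound (B * Real.exp (C * t)) ?_
        refine eventually_inf_principal.2 (Eventually.of_forall fun x hx => ?_)
        refine (hle x (le_of_lt hx)).trans ?_
        rw [Real.norm_eq_abs, abs_of_pos (Real.exp_pos _), Real.rpow_one]
        gcongr
        exact (le_abs_self _).trans (Complex.abs_re_le_norm x)
      · refine ⟨Real.exp (t * t), ?_⟩
        rw [eventually_map]
        have h1 := (tendsto_atTop_add_const_right atTop t tendsto_id).eventually (hm t ht)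
        filter_upwards [h1] with x hx
        rw [hfn]
        have e : Complex.I * (x : ℂ) + Complex.I * t = ((id x + t : ℝ) : ℂ) * Complex.I := by
          simp only [id]; push_cast; ring
        rw [e]
        calc _ ≤ Real.exp (t * (id x + t)) * Real.exp (-(t * (x : ℂ).re)) := by gcongr
          _ = Real.exp (t * t) := by
            rw [← Real.exp_add]; congr 1; simp; ring
      · have := hle (y * Complex.I) (by simp)
        simpa using this
    rw [hfn, h0, hx₀re, Real.exp_neg, ← div_eq_mul_inv, div_le_iff₀ (Real.exp_pos _)] at hfin
    exact hfin
  have hlim : Tendsto (fun t : ℝ => B * Real.exp (C * t) * Real.exp (t * (z.im - t)))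
      (𝓝[>] 0) (𝓝 B) :=
    (Continuous.tendsto' (by fun_prop) _ _ (by simp)).mono_left nhdsWithin_le_nhds
  refine ge_of_tendsto hlim ?_
  filter_upwards [Ioo_mem_nhdsGT hz'] with t ht using key t ht.1 ht.2

open Filter Topology in
/-- The maximum principle in the upper half-plane for functions of nonpositive mean type. -/
theorem HasNevanlinnaGrowth.norm_le_of_meanType {w : ℂ → ℂ}
    (hw : DifferentiableOn ℂ w upperHalf) (hg : HasNevanlinnaGrowth w) {B : ℝ} (hB : 0 ≤ B)
    (hb : ∀ t : ℝ, ∀ η : ℝ, 0 < η → ∀ᶠ z in 𝓝[upperHalf] (t : ℂ), ‖w z‖ ≤ B + η)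
    (hm : meanType w ≤ 0) {z : ℂ} (hz : z ∈ upperHalf) : ‖w z‖ ≤ B := by
  refine le_of_forall_pos_le_add fun ε hε => ?_
  obtain ⟨C, hC, h⟩ := hg.exists_norm_le_exp hw (B := B + ε) (by linarith) fun t η hη => by
    filter_upwards [hb t η hη] with x hx
    linarith
  exact norm_le_of_exp_type_of_meanType hw hC h hm hz

/-! ### Functions of the Hardy class and their averaged translates -/

open MeasureTheory in
/-- The Cauchy-Schwarz inequality for integrals. -/
theorem norm_integral_mul_le_sqrt {α : Type*} [MeasurableSpace α] {μ : Measure α} {f g : α → ℂ}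
    (hf : MemLp f 2 μ) (hg : MemLp g 2 μ) :
    ‖∫ a, f a * g a ∂μ‖ ≤ √(∫ a, ‖f a‖ ^ 2 ∂μ) * √(∫ a, ‖g a‖ ^ 2 ∂μ) := by
  have h := integral_mul_norm_le_Lp_mul_Lq (μ := μ) (f := f) (g := g) (p := 2) (q := 2)
    Real.HolderConjugate.two_two (by simpa using hf) (by simpa using hg)
  simp only [Real.rpow_two, ← Real.sqrt_eq_rpow] at h
  refine (norm_integral_le_integral_norm _).trans ?_
  simpa only [norm_mul] using h

/-- `u` is analytic on the closed upper half-plane, square integrable on the real line, and of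
bounded type and nonpositive mean type in the upper half-plane. -/
structure IsHardy (u : ℂ → ℂ) : Prop where
  analyticAt : ∀ z : ℂ, 0 ≤ z.im → AnalyticAt ℂ u z
  memLp : MeasureTheory.MemLp (fun t : ℝ => u t) 2
  isBoundedType : IsBoundedType u
  meanType_nonpos : meanType u ≤ 0

/-- The average of the translates `u (z + s)`, `a ≤ s ≤ b`, with weight `φ`. -/
noncomputable def translateIntegral (u : ℂ → ℂ) (φ : ℝ → ℂ) (a b : ℝ) (z : ℂ) : ℂ :=
  ∫ s in a..b, u (z + s) * φ s

section Translate

variable {u : ℂ → ℂ} {φ : ℝ → ℂ} {a b : ℝ}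

theorem continuous_translate (hu : ∀ z : ℂ, 0 ≤ z.im → AnalyticAt ℂ u z) {z : ℂ} (hz : 0 ≤ z.im) :
    Continuous (fun s : ℝ => u (z + s)) := by
  refine continuous_iff_continuousAt.2 fun s => ?_
  exact ContinuousAt.comp (f := fun s : ℝ => z + (s : ℂ)) (hu (z + s) (by simpa)).continuousAt
    (by fun_prop)

theorem continuous_deriv_translate (hu : ∀ z : ℂ, 0 ≤ z.im → AnalyticAt ℂ u z) {z : ℂ}
    (hz : 0 ≤ z.im) : Continuous (fun s : ℝ => deriv u (z + s)) :=
  continuous_translate (u := deriv u) (fun z hz => (hu z hz).deriv) hz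

-- The formula includes real z: u is analytic on a tube around the compact segment z + [a, b], so
-- one may differentiate under the integral. The averages are therefore continuous up to the real
-- line.
open Filter Topology MeasureTheory in
theorem hasDerivAt_translateIntegral (hu : ∀ z : ℂ, 0 ≤ z.im → AnalyticAt ℂ u z)
    (hφ : Continuous φ) {z : ℂ} (hz : 0 ≤ z.im) :
    HasDerivAt (translateIntegral u φ a b) (translateIntegral (deriv u) φ a b z) z := by
  set Ω : Set ℂ := {z | AnalyticAt ℂ u z} with hΩ
  have hΩo : IsOpen Ω := isOpen_analyticAt ℂ u
  have huΩ : AnalyticOnNhd ℂ u Ω := fun x hx => hx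
  set K : Set ℂ := (fun s : ℝ => z + (s : ℂ)) '' Set.uIcc a b with hK
  have hKc : IsCompact K := isCompact_uIcc.image (by fun_prop)
  have hKΩ : K ⊆ Ω := by
    rintro _ ⟨s, _, rfl⟩
    exact hu _ (by simpa)
  obtain ⟨ε, hε, hεΩ⟩ := hKc.exists_cthickening_subset_open hΩo hKΩ
  have hmem : ∀ s ∈ Set.uIoc a b, ∀ x ∈ Metric.ball z ε, x + (s : ℂ) ∈ Metric.cthickening ε K := by
    intro s hs x hx
    refine Metric.mem_cthickening_of_dist_le _ (z + s) _ _ ⟨s, Set.uIoc_subset_uIcc hs, rfl⟩ ?_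
    rw [dist_add_right]
    exact (Metric.mem_ball.1 hx).le
  obtain ⟨M, hM⟩ := (hKc.cthickening (r := ε)).exists_bound_of_continuousOn
    (f := deriv u) ((huΩ.deriv.continuousOn).mono hεΩ)
  obtain ⟨A, hA⟩ := (isCompact_uIcc (a := a) (b := b)).exists_bound_of_continuousOn
    hφ.continuousOn
  refine (intervalIntegral.hasDerivAt_integral_of_dominated_loc_of_deriv_le
    (F := fun x s => u (x + s) * φ s) (F' := fun x s => deriv u (x + s) * φ s)
    (bound := fun _ => M * A) (Metric.ball_mem_nhds z hε) ?_ ?_ ?_ ?_ ?_ ?_).2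
  · filter_upwards [Metric.ball_mem_nhds z hε] with x hx
    refine ContinuousOn.aestronglyMeasurable (fun s hs => ?_) measurableSet_uIoc
    refine ContinuousAt.continuousWithinAt (ContinuousAt.mul ?_ hφ.continuousAt)
    exact ContinuousAt.comp (f := fun s : ℝ => x + (s : ℂ))
      (huΩ _ (hεΩ (hmem s hs x hx))).continuousAt (by fun_prop)
  · exact ((continuous_translate hu hz).mul hφ).intervalIntegrable _ _
  · exact ((continuous_deriv_translate hu hz).mul hφ).aestronglyMeasurable
  · refine Eventually.of_forall fun s hs x hx => ?_
    rw [norm_mul]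
    have h1 := hM _ (hmem s hs x hx)
    exact mul_le_mul h1 (hA s (Set.uIoc_subset_uIcc hs)) (norm_nonneg _) ((norm_nonneg _).trans h1)
  · exact intervalIntegrable_const
  · refine Eventually.of_forall fun s hs x hx => ?_
    have h1 := (huΩ _ (hεΩ (hmem s hs x hx))).differentiableAt.hasDerivAt
    exact (h1.comp_add_const x s).mul_const _

/-- Integration by parts: the weight 1 - s is 1 at s = 0 and 0 at s = 1, so the only boundary term
is u z. This recovers u from two of its averages. -/
theorem deriv_translateIntegral_one_sub (hu : ∀ z : ℂ, 0 ≤ z.im → AnalyticAt ℂ u z) {z : ℂ}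
    (hz : 0 ≤ z.im) : deriv (translateIntegral u (fun s => 1 - s) 0 1) z =
      translateIntegral u (fun _ => 1) 0 1 z - u z := by
  rw [(hasDerivAt_translateIntegral hu (by fun_prop) hz).deriv, translateIntegral,
    translateIntegral]
  have h1 : ∀ s ∈ Set.uIcc (0 : ℝ) 1, HasDerivAt (fun s : ℝ => u (z + s)) (deriv u (z + s)) s := by
    intro s _
    have h := ((hu (z + s) (by simpa)).differentiableAt.hasDerivAt).comp_const_add z s
    exact h.comp_ofReal
  have h2 : ∀ s ∈ Set.uIcc (0 : ℝ) 1, HasDerivAt (fun s : ℝ => (1 : ℂ) - s) (-1) s := by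
    intro s _
    simpa using ((hasDerivAt_id s).ofReal_comp.const_sub (1 : ℂ))
  have h3 := intervalIntegral.integral_mul_deriv_eq_deriv_mul h1 h2
    ((continuous_deriv_translate hu hz).intervalIntegrable _ _) intervalIntegrable_const
  have h4 : ∫ s in (0 : ℝ)..1, u (z + s) * (-1 : ℂ) = -∫ s in (0 : ℝ)..1, u (z + s) * (1 : ℂ) := by
    rw [← intervalIntegral.integral_neg]
    congr 1; funext s; ring
  rw [h4] at h3
  simp only [Complex.ofReal_one, sub_self, mul_zero, Complex.ofReal_zero, add_zero, sub_zero,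
    mul_one, zero_sub] at h3 ⊢
  linear_combination h3

-- The reason for averaging: u is only square integrable on the real line, but by Cauchy-Schwarz its
-- averages are bounded there.
open MeasureTheory in
theorem norm_translateIntegral_ofReal_le (hL : MemLp (fun t : ℝ => u t) 2) (hφ : Continuous φ)
    (hab : a ≤ b) (t : ℝ) :
    ‖translateIntegral u φ a b t‖ ≤ √(∫ x : ℝ, ‖u x‖ ^ 2) * √(∫ s in a..b, ‖φ s‖ ^ 2) := by
  have hLt : MemLp (fun s : ℝ => u ((t : ℂ) + s)) 2 := by
    have := hL.comp_measurePreserving (measurePreserving_add_left volume t)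
    simpa [Function.comp_def] using this
  have hφL : MemLp φ 2 (volume.restrict (Set.Ioc a b)) := by
    refine (memLp_two_iff_integrable_sq_norm hφ.aestronglyMeasurable).2 ?_
    exact ((hφ.norm.pow 2).integrableOn_Ioc)
  rw [translateIntegral, intervalIntegral.integral_of_le hab, intervalIntegral.integral_of_le hab]
  refine (norm_integral_mul_le_sqrt (hLt.restrict _) hφL).trans ?_
  gcongr
  calc ∫ s in Set.Ioc a b, ‖u ((t : ℂ) + s)‖ ^ 2 ≤ ∫ s : ℝ, ‖u ((t : ℂ) + s)‖ ^ 2 :=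
        setIntegral_le_integral
          ((memLp_two_iff_integrable_sq_norm hLt.1).1 hLt)
          (Filter.Eventually.of_forall fun s => by positivity)
    _ = ∫ s : ℝ, ‖u (((t + s : ℝ)) : ℂ)‖ ^ 2 := by simp
    _ = _ := integral_add_left_eq_self (fun x : ℝ => ‖u x‖ ^ 2) t

theorem norm_translateIntegral_le (hab : a ≤ b) {z : ℂ} {A M : ℝ}
    (hφ : ∀ s ∈ Set.uIcc a b, ‖φ s‖ ≤ A) (hM : ∀ s ∈ Set.uIcc a b, ‖u (z + s)‖ ≤ M) :
    ‖translateIntegral u φ a b z‖ ≤ M * A * (b - a) := by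
  have h := intervalIntegral.norm_integral_le_of_norm_le_const (a := a) (b := b)
    (f := fun s => u (z + s) * φ s) (C := M * A) fun s hs => by
      have hs' := Set.uIoc_subset_uIcc hs
      rw [norm_mul]
      exact mul_le_mul (hM s hs') (hφ s hs') (norm_nonneg _) ((norm_nonneg _).trans (hM s hs'))
  rwa [abs_of_nonneg (sub_nonneg.2 hab)] at h

theorem HasNevanlinnaGrowth.translateIntegral (hg : HasNevanlinnaGrowth u) (hφ : Continuous φ)
    (hab : a ≤ b) : HasNevanlinnaGrowth (translateIntegral u φ a b) := by
  obtain ⟨C, hC, h⟩ := hg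
  obtain ⟨A, hA⟩ := (isCompact_uIcc (a := a) (b := b)).exists_bound_of_continuousOn
    hφ.continuousOn
  obtain ⟨D, hD⟩ := (isCompact_uIcc (a := a) (b := b)).exists_bound_of_continuousOn
    (f := fun s : ℝ => (s : ℂ)) (by fun_prop)
  have hD0 : 0 ≤ D := (norm_nonneg _).trans (hD a Set.left_mem_uIcc)
  refine HasNevanlinnaGrowth.of_le_mul (A := A * (b - a)) (C := C * (1 + D) ^ 2) (by positivity)
    fun z hz => ?_
  have hz' : 0 < z.im := hz
  refine (norm_translateIntegral_le hab hA (M := Real.exp (C * (1 + D) ^ 2 *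
    ((1 + ‖z‖) ^ 2 / z.im))) fun s hs => ?_).trans (le_of_eq (by ring))
  have him : (z + s).im = z.im := by simp
  refine (h (z + s) (show 0 < (z + s).im by rwa [him])).trans (Real.exp_le_exp.2 ?_)
  rw [him, mul_assoc, show (1 + D) ^ 2 * ((1 + ‖z‖) ^ 2 / z.im) =
    ((1 + D) * (1 + ‖z‖)) ^ 2 / z.im by ring]
  gcongr
  have := norm_add_le z (s : ℂ)
  have := hD s hs
  nlinarith [norm_nonneg z]

open Filter Topology MeasureTheory in
theorem eventually_norm_translateIntegral_le (hu : ∀ z : ℂ, 0 ≤ z.im → AnalyticAt ℂ u z)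
    (hL : MemLp (fun t : ℝ => u t) 2) (hφ : Continuous φ) (hab : a ≤ b) (t : ℝ) {η : ℝ}
    (hη : 0 < η) : ∀ᶠ z in 𝓝[upperHalf] (t : ℂ), ‖translateIntegral u φ a b z‖ ≤
      √(∫ x : ℝ, ‖u x‖ ^ 2) * √(∫ s in a..b, ‖φ s‖ ^ 2) + η := by
  have h1 := (hasDerivAt_translateIntegral (a := a) (b := b) hu hφ (z := t)
    (by simp)).continuousAt.norm
  have h2 := norm_translateIntegral_ofReal_le hL hφ hab t
  filter_upwards [mem_nhdsWithin_of_mem_nhds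
    (h1.eventually_lt_const (h2.trans_lt (lt_add_of_pos_right _ hη)))] with z hz
  exact le_of_lt hz

theorem differentiableOn_translateIntegral (hu : ∀ z : ℂ, 0 ≤ z.im → AnalyticAt ℂ u z)
    (hφ : Continuous φ) : DifferentiableOn ℂ (translateIntegral u φ a b) upperHalf := fun _ hz =>
  (hasDerivAt_translateIntegral hu hφ (le_of_lt hz)).differentiableAt.differentiableWithinAt

/-- u is an average minus the derivative of another one, and Cauchy's estimate on the circle of
radius r bounds the derivative by B / r. -/
theorem norm_le_of_translateIntegral_le (hu : ∀ z : ℂ, 0 ≤ z.im → AnalyticAt ℂ u z) {z : ℂ}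
    {r B : ℝ} (hr : 0 < r) (hz : r < z.im)
    (hB : ∀ φ : ℝ → ℂ, (φ = (fun _ => 1) ∨ φ = fun s : ℝ => 1 - (s : ℂ)) →
      ∀ x ∈ Metric.closedBall z r, ‖translateIntegral u φ 0 1 x‖ ≤ B) :
    ‖u z‖ ≤ B + B / r := by
  have him : ∀ x ∈ Metric.closedBall z r, 0 ≤ x.im := by
    intro x hx
    have h1 := Complex.abs_im_le_norm (z - x)
    rw [Metric.mem_closedBall, dist_comm, dist_eq_norm] at hx
    rw [Complex.sub_im] at h1
    linarith [(le_abs_self _).trans h1]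
  have h1 := deriv_translateIntegral_one_sub hu (hr.trans hz).le
  have h2 : ‖deriv (translateIntegral u (fun s => 1 - s) 0 1) z‖ ≤ B / r := by
    refine Complex.norm_deriv_le_of_forall_mem_sphere_norm_le hr ?_ fun x hx =>
      hB _ (Or.inr rfl) x (Metric.sphere_subset_closedBall hx)
    refine DifferentiableOn.diffContOnCl fun x hx => ?_
    exact (hasDerivAt_translateIntegral hu (by fun_prop)
      (him x (Metric.closure_ball_subset_closedBall hx))).differentiableAt.differentiableWithinAt
  have h3 : u z = translateIntegral u (fun _ => 1) 0 1 z -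
      deriv (translateIntegral u (fun s => 1 - s) 0 1) z := by rw [h1]; ring
  rw [h3]
  exact (norm_sub_le _ _).trans (add_le_add (hB _ (Or.inl rfl) z
    (Metric.mem_closedBall_self hr.le)) h2)

end Translate

/-! ### Bounds for Hardy functions on horizontal lines -/

namespace IsHardy

variable {u v : ℂ → ℂ}

theorem differentiableOn (hu : IsHardy u) : DifferentiableOn ℂ u upperHalf := fun z hz =>
  (hu.analyticAt z (le_of_lt hz)).differentiableAt.differentiableWithinAt

theorem hasNevanlinnaGrowth (hu : IsHardy u) : HasNevanlinnaGrowth u :=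
  hu.isBoundedType.hasNevanlinnaGrowth hu.differentiableOn

-- Mean type sees only the imaginary axis, while an average involves u on horizontal segments, so
-- the mean type of the averages is not known at first. The averages are of exponential type in any
-- case, hence so is u(z + i), and it is to this function that the mean type of u is applied.
open MeasureTheory in
theorem exists_norm_le_of_one_lt_im (hu : IsHardy u) :
    ∃ B : ℝ, ∀ z : ℂ, 1 < z.im → ‖u z‖ ≤ B := by
  have hex : ∀ φ : ℝ → ℂ, Continuous φ → ∃ B C : ℝ, 0 ≤ B ∧ 0 ≤ C ∧ ∀ z ∈ upperHalf,
      ‖translateIntegral u φ 0 1 z‖ ≤ B * Real.exp (C * z.im) := by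
    intro φ hφ
    set B := √(∫ x : ℝ, ‖u x‖ ^ 2) * √(∫ s in (0 : ℝ)..1, ‖φ s‖ ^ 2)
    have hB : 0 ≤ B := by positivity
    obtain ⟨C, hC, h⟩ := (hu.hasNevanlinnaGrowth.translateIntegral hφ
      zero_le_one).exists_norm_le_exp (differentiableOn_translateIntegral hu.analyticAt hφ)
      (B := B + 1) (by positivity) fun t η hη => by
        filter_upwards [eventually_norm_translateIntegral_le hu.analyticAt hu.memLp hφ
          zero_le_one t hη] with z hz
        linarith
    exact ⟨B + 1, C, by positivity, hC, h⟩
  obtain ⟨B₁, C₁, hB₁, hC₁, h₁⟩ := hex (fun _ => 1) continuous_const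
  obtain ⟨B₂, C₂, hB₂, hC₂, h₂⟩ := hex (fun s => 1 - s) (by fun_prop)
  set w : ℂ → ℂ := fun z => u (z + Complex.I) with hw
  set C := max C₁ C₂
  set B := max B₁ B₂
  have hB0 : 0 ≤ B := hB₁.trans (le_max_left _ _)
  have hwb : ∀ z ∈ upperHalf, ‖w z‖ ≤ (3 * B * Real.exp (C * (3 / 2))) * Real.exp (C * z.im) := by
    intro z hz
    have hz' : 0 < z.im := hz
    have him : (z + Complex.I).im = z.im + 1 := by simp
    -- On the disc of radius 1/2 about z + i the imaginary part is at most Im z + 3/2, and B +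
    -- B/(1/2) = 3B.
    have h3 := norm_le_of_translateIntegral_le hu.analyticAt (z := z + Complex.I) (r := 1 / 2)
      (B := B * Real.exp (C * (z.im + 3 / 2))) (by norm_num) (by rw [him]; linarith) ?_
    · refine h3.trans (le_of_eq ?_)
      rw [mul_add, Real.exp_add]; ring
    · intro φ hφ x hx
      have hx1 : |x.im - (z.im + 1)| ≤ 1 / 2 := by
        rw [← him, ← Complex.sub_im]
        exact (Complex.abs_im_le_norm _).trans (by rwa [← dist_eq_norm])
      rw [abs_le] at hx1
      have hx2 : 0 < x.im := by linarith
      rcases hφ with rfl | rfl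
      · refine (h₁ x hx2).trans ?_
        gcongr
        · exact le_max_left _ _
        · exact le_max_left _ _
        · linarith
      · refine (h₂ x hx2).trans ?_
        gcongr
        · exact le_max_right _ _
        · exact le_max_right _ _
        · linarith
  have hwd : DifferentiableOn ℂ w upperHalf := fun z hz => by
    have hz' : 0 < z.im := hz
    have h := (hu.analyticAt (z + Complex.I) (by simp; linarith)).differentiableAt
    exact (DifferentiableAt.comp z h (by fun_prop)).differentiableWithinAt
  have hwm : meanType w ≤ 0 := by
    have h4 := hu.meanType_nonpos
    rw [meanType_nonpos_iff] at h4 ⊢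
    intro ε hε
    have h5 := (Filter.tendsto_atTop_add_const_right Filter.atTop (1 : ℝ)
      Filter.tendsto_id).eventually (h4 (ε / 2) (by positivity))
    filter_upwards [h5, Filter.eventually_ge_atTop 1] with y hy hy1
    have e : (y : ℂ) * Complex.I + Complex.I = ((id y + 1 : ℝ) : ℂ) * Complex.I := by
      simp only [id]; push_cast; ring
    rw [hw]
    simp only
    rw [e]
    refine hy.trans (Real.exp_le_exp.2 ?_)
    simp only [id]
    nlinarith
  refine ⟨3 * B * Real.exp (C * (3 / 2)), fun z hz => ?_⟩
  have h6 := norm_le_of_exp_type_of_meanType hwd (hC₁.trans (le_max_left _ _)) hwb hwm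
    (z := z - Complex.I) (show 0 < (z - Complex.I).im by simp; linarith)
  simpa [hw] using h6

-- Boundedness of u above height 1 gives the averages nonpositive mean type, so the maximum
-- principle carries the Cauchy-Schwarz bound from the real line into the half-plane with the same
-- constant.
open MeasureTheory in
theorem norm_translateIntegral_le (hu : IsHardy u) {φ : ℝ → ℂ} (hφ : Continuous φ) {a b : ℝ}
    (hab : a ≤ b) {z : ℂ} (hz : z ∈ upperHalf) : ‖translateIntegral u φ a b z‖ ≤
      √(∫ x : ℝ, ‖u x‖ ^ 2) * √(∫ s in a..b, ‖φ s‖ ^ 2) := by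
  obtain ⟨B, hB⟩ := hu.exists_norm_le_of_one_lt_im
  obtain ⟨A, hA⟩ := (isCompact_uIcc (a := a) (b := b)).exists_bound_of_continuousOn
    hφ.continuousOn
  refine (hu.hasNevanlinnaGrowth.translateIntegral hφ hab).norm_le_of_meanType
    (differentiableOn_translateIntegral hu.analyticAt hφ) (by positivity)
    (fun t η hη => eventually_norm_translateIntegral_le hu.analyticAt hu.memLp hφ hab t hη)
    (meanType_nonpos_of_bounded (C := B * A * (b - a)) ?_) hz
  filter_upwards [Filter.eventually_gt_atTop 1] with y hy
  exact _root_.norm_translateIntegral_le hab hA fun s _ => hB _ (by simpa)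

theorem exists_norm_le (hu : IsHardy u) {δ : ℝ} (hδ : 0 < δ) :
    ∃ B : ℝ, ∀ z : ℂ, δ ≤ z.im → ‖u z‖ ≤ B := by
  set B : (ℝ → ℂ) → ℝ := fun φ => √(∫ x : ℝ, ‖u x‖ ^ 2) * √(∫ s in (0 : ℝ)..1, ‖φ s‖ ^ 2)
  set M := max (B fun _ => 1) (B fun s => 1 - s)
  refine ⟨M + M / (δ / 2), fun z hz => norm_le_of_translateIntegral_le hu.analyticAt
    (by positivity) (by linarith) fun φ hφ x hx => ?_⟩
  have hx1 : |x.im - z.im| ≤ δ / 2 := by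
    rw [← Complex.sub_im]
    exact (Complex.abs_im_le_norm _).trans (by rwa [← dist_eq_norm])
  rw [abs_le] at hx1
  have hx2 : 0 < x.im := by linarith
  rcases hφ with rfl | rfl
  · exact (hu.norm_translateIntegral_le (by fun_prop) zero_le_one hx2).trans (le_max_left _ _)
  · exact (hu.norm_translateIntegral_le (by fun_prop) zero_le_one hx2).trans (le_max_right _ _)

theorem continuous_line (hu : IsHardy u) {y : ℝ} (hy : 0 ≤ y) :
    Continuous (fun x : ℝ => u (x + y * Complex.I)) := by
  have := continuous_translate hu.analyticAt (z := y * Complex.I) (by simpa)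
  simpa only [add_comm] using this

/-- A duality argument: with conj u on the segment as the weight, the average at iy is exactly T,
and the bound for averages reads T ≤ √N √T, hence T ≤ N. -/
theorem intervalIntegral_norm_sq_le (hu : IsHardy u) {y : ℝ} (hy : 0 < y) {a b : ℝ} (hab : a ≤ b) :
    ∫ x in a..b, ‖u (x + y * Complex.I)‖ ^ 2 ≤ ∫ x : ℝ, ‖u x‖ ^ 2 := by
  set T := ∫ x in a..b, ‖u (x + y * Complex.I)‖ ^ 2 with hT
  have hT0 : 0 ≤ T := intervalIntegral.integral_nonneg hab fun x _ => by positivity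
  have h := hu.norm_translateIntegral_le (φ := fun x => conj (u (x + y * Complex.I)))
    (Complex.continuous_conj.comp (hu.continuous_line hy.le)) hab (z := y * Complex.I)
    (show 0 < (y * Complex.I).im by simpa)
  have h1 : translateIntegral u (fun x => conj (u (x + y * Complex.I))) a b (y * Complex.I) = T := by
    rw [translateIntegral, hT, ← intervalIntegral.integral_ofReal]
    congr 1
    funext x
    rw [add_comm, Complex.mul_conj']
    push_cast
    rfl
  simp only [RCLike.norm_conj] at h
  rw [h1, ← hT, Complex.norm_real, Real.norm_eq_abs, abs_of_nonneg hT0] at h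
  set N := ∫ x : ℝ, ‖u x‖ ^ 2
  rcases hT0.eq_or_lt with h0 | h0
  · rw [← h0]; exact MeasureTheory.integral_nonneg fun x => by positivity
  · have h2 : √T * √T = T := Real.mul_self_sqrt hT0
    have h3 : 0 < √T := Real.sqrt_pos.2 h0
    have h4 : √T ≤ √N := by
      by_contra! hcon
      nlinarith
    exact (Real.sqrt_le_sqrt_iff' h0).1 h4

open MeasureTheory Filter in
theorem integrable_line (hu : IsHardy u) {y : ℝ} (hy : 0 < y) :
    Integrable (fun x : ℝ => ‖u (x + y * Complex.I)‖ ^ 2) := by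
  have hc : Continuous fun x : ℝ => ‖u (x + y * Complex.I)‖ ^ 2 := (hu.continuous_line hy.le).norm.pow 2
  refine integrable_of_intervalIntegral_norm_bounded (ι := ℝ) (l := atTop) (a := fun i => -i)
    (b := fun i => i) (∫ x : ℝ, ‖u x‖ ^ 2) (fun i => hc.integrableOn_Ioc) tendsto_neg_atTop_atBot
    tendsto_id ?_
  filter_upwards [eventually_ge_atTop 0] with i hi
  simp only [norm_pow, norm_norm]
  exact hu.intervalIntegral_norm_sq_le hy (by linarith)

open MeasureTheory Filter in
/-- The integrals of `|u|²` over the lines `Im z = y` are at most the integral over the real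
line. -/
theorem integral_norm_sq_line_le (hu : IsHardy u) {y : ℝ} (hy : 0 < y) :
    ∫ x : ℝ, ‖u (x + y * Complex.I)‖ ^ 2 ≤ ∫ x : ℝ, ‖u x‖ ^ 2 := by
  refine le_of_tendsto (intervalIntegral_tendsto_integral (l := atTop) (a := fun i : ℝ => -i)
    (b := fun i => i) (hu.integrable_line hy) tendsto_neg_atTop_atBot tendsto_id) ?_
  filter_upwards [eventually_ge_atTop 0] with i hi
  exact hu.intervalIntegral_norm_sq_le hy (by linarith)

open MeasureTheory in
theorem memLp_line (hu : IsHardy u) {y : ℝ} (hy : 0 < y) :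
    MemLp (fun x : ℝ => u (x + y * Complex.I)) 2 :=
  (memLp_two_iff_integrable_sq_norm (hu.continuous_line hy.le).aestronglyMeasurable).2
    (hu.integrable_line hy)

end IsHardy

/-! ### Vanishing of integrals of products -/

open MeasureTheory Filter Topology in
/-- Vanishing of the integral over the real line of an analytic function with quadratic decay. -/
theorem integral_eq_zero_of_decay {g : ℂ → ℂ} (hg : ∀ z : ℂ, 0 ≤ z.im → DifferentiableAt ℂ g z)
    {K : ℝ} (hK : ∀ z : ℂ, 0 ≤ z.im → ‖g z‖ ≤ K / (1 + ‖z‖ ^ 2)) : ∫ t : ℝ, g t = 0 := by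
  have hK0 : 0 ≤ K := by
    have := (norm_nonneg _).trans (hK 0 (by simp))
    simpa using this
  have hc : Continuous fun t : ℝ => g t := continuous_iff_continuousAt.2 fun t =>
    ContinuousAt.comp (f := fun t : ℝ => (t : ℂ)) (hg t (by simp)).continuousAt (by fun_prop)
  have hint : Integrable fun t : ℝ => g t := by
    refine (integrable_inv_one_add_sq.const_mul K).mono' hc.aestronglyMeasurable
      (Eventually.of_forall fun t => ?_)
    have := hK t (by simp)
    rwa [Complex.norm_real, Real.norm_eq_abs, sq_abs, div_eq_mul_inv] at this
  have hlim := intervalIntegral_tendsto_integral (l := atTop) (a := fun R : ℝ => -R)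
    (b := fun R : ℝ => R) hint tendsto_neg_atTop_atBot tendsto_id
  -- In the rectangle [-R, R] × [0, R] the other three sides have total length 4R, and on them ‖g‖ ≤
  -- K / R².
  refine tendsto_nhds_unique hlim (squeeze_zero_norm' (a := fun R : ℝ => 4 * K * R⁻¹) ?_ (by
    simpa using tendsto_inv_atTop_zero.const_mul (4 * K)))
  filter_upwards [eventually_ge_atTop 1] with R hR
  have hR0 : 0 < R := by linarith
  have hrect := Complex.integral_boundary_rect_eq_zero_of_differentiableOn g (-R : ℂ)
    (R + R * Complex.I) (fun z hz => by
      have h2 : z.im ∈ Set.uIcc (0 : ℝ) R := by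
        simpa using (Complex.mem_reProdIm.1 hz).2
      rw [Set.uIcc_of_le hR0.le] at h2
      exact (hg z h2.1).differentiableWithinAt)
  simp only [Complex.neg_re, Complex.ofReal_re, Complex.neg_im, Complex.ofReal_im, neg_zero,
    Complex.add_re, Complex.mul_re, Complex.I_re, mul_zero, Complex.I_im, mul_one, sub_self,
    add_zero, Complex.add_im, Complex.mul_im, zero_add, Complex.ofReal_zero, zero_mul,
    smul_eq_mul] at hrect
  have hb : ∀ z : ℂ, 0 ≤ z.im → R ≤ ‖z‖ → ‖g z‖ ≤ K / R ^ 2 := fun z hz hzR => by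
    refine (hK z hz).trans ?_
    gcongr
    nlinarith
  have b1 : ‖∫ x : ℝ in (-R)..R, g (x + R * Complex.I)‖ ≤ K / R ^ 2 * |R - -R| := by
    refine intervalIntegral.norm_integral_le_of_norm_le_const fun x _ => hb _ (by simp [hR0.le]) ?_
    have := Complex.abs_im_le_norm (x + R * Complex.I)
    simpa [abs_of_pos hR0] using this
  have b2 : ‖∫ y : ℝ in (0 : ℝ)..R, g (R + y * Complex.I)‖ ≤ K / R ^ 2 * |R - 0| := by
    refine intervalIntegral.norm_integral_le_of_norm_le_const fun y hy => hb _ ?_ ?_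
    · rw [Set.uIoc_of_le hR0.le] at hy
      simpa using hy.1.le
    · have := Complex.abs_re_le_norm (R + y * Complex.I)
      simpa [abs_of_pos hR0] using this
  have b3 : ‖∫ y : ℝ in (0 : ℝ)..R, g ((-R : ℝ) + y * Complex.I)‖ ≤ K / R ^ 2 * |R - 0| := by
    refine intervalIntegral.norm_integral_le_of_norm_le_const fun y hy => hb _ ?_ ?_
    · rw [Set.uIoc_of_le hR0.le] at hy
      simpa using hy.1.le
    · have := Complex.abs_re_le_norm ((-R : ℝ) + y * Complex.I)
      simpa [abs_of_pos hR0] using this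
  have e : ∫ x : ℝ in (-R)..R, g x = (∫ x : ℝ in (-R)..R, g (x + R * Complex.I)) -
      Complex.I * (∫ y : ℝ in (0 : ℝ)..R, g (R + y * Complex.I)) +
      Complex.I * (∫ y : ℝ in (0 : ℝ)..R, g ((-R : ℝ) + y * Complex.I)) := by
    linear_combination hrect
  rw [e]
  refine (norm_add_le _ _).trans ((add_le_add_left (norm_sub_le _ _) _).trans ?_)
  rw [norm_mul, norm_mul, Complex.norm_I, one_mul, one_mul]
  have e1 : K / R ^ 2 * |R - -R| = 2 * K * R⁻¹ := by
    rw [sub_neg_eq_add, abs_of_pos (by linarith)]; field_simp; ring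
  have e2 : K / R ^ 2 * |R - 0| = K * R⁻¹ := by
    rw [sub_zero, abs_of_pos hR0]; field_simp
  rw [e1] at b1
  rw [e2] at b2 b3
  linarith

namespace IsHardy

variable {u v : ℂ → ℂ}

theorem one_add_sq_le_norm_sq {η : ℝ} (hη : 0 < η) {z : ℂ} (hz : 0 ≤ z.im) :
    min 1 (η ^ 2) * (1 + ‖z‖ ^ 2) ≤ ‖Complex.I + η * z‖ ^ 2 := by
  have h1 : ‖Complex.I + η * z‖ ^ 2 = 1 + η ^ 2 * ‖z‖ ^ 2 + 2 * η * z.im := by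
    rw [← Complex.normSq_eq_norm_sq, ← Complex.normSq_eq_norm_sq]
    simp [Complex.normSq_apply]
    ring
  rw [h1]
  have h2 := min_le_left 1 (η ^ 2)
  have h3 := min_le_right 1 (η ^ 2)
  have : 0 ≤ 2 * η * z.im := by positivity
  nlinarith [sq_nonneg ‖z‖]

-- Above height y both functions are bounded, but their product need not decay. The factor (i/(i +
-- ηz))² supplies quadratic decay, has modulus at most 1 on the real line, and tends to 1 as η tends
-- to 0.
open MeasureTheory Filter Topology in
theorem integral_mul_line_eq_zero (hu : IsHardy u) (hv : IsHardy v) {y : ℝ} (hy : 0 < y) :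
    ∫ x : ℝ, u (x + y * Complex.I) * v (x + y * Complex.I) = 0 := by
  obtain ⟨B, hB⟩ := hu.exists_norm_le hy
  obtain ⟨D, hD⟩ := hv.exists_norm_le hy
  have hne : ∀ η : ℝ, 0 < η → ∀ z : ℂ, 0 ≤ z.im → Complex.I + η * z ≠ 0 := by
    intro η hη z hz h
    have h1 := one_add_sq_le_norm_sq hη hz
    rw [h, norm_zero] at h1
    have : 0 < min 1 (η ^ 2) * (1 + ‖z‖ ^ 2) := by positivity
    linarith
  have hzero : ∀ η : ℝ, 0 < η → ∫ x : ℝ, u (x + y * Complex.I) * v (x + y * Complex.I) *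
      (Complex.I / (Complex.I + η * x)) ^ 2 = 0 := by
    intro η hη
    refine integral_eq_zero_of_decay (g := fun z => u (z + y * Complex.I) * v (z + y * Complex.I) *
      (Complex.I / (Complex.I + η * z)) ^ 2) (K := B * D / min 1 (η ^ 2)) (fun z hz => ?_)
      fun z hz => ?_
    · have hz' : 0 ≤ (z + y * Complex.I).im := by simp; linarith
      have h1 := DifferentiableAt.comp z (hu.analyticAt _ hz').differentiableAt
        (f := fun z => z + y * Complex.I) (by fun_prop)
      have h2 := DifferentiableAt.comp z (hv.analyticAt _ hz').differentiableAt
        (f := fun z => z + y * Complex.I) (by fun_prop)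
      have h3 := hne η hη z hz
      refine (h1.mul h2).mul ?_
      fun_prop (disch := assumption)
    · have hz' : y ≤ (z + y * Complex.I).im := by simp; linarith
      have hm : 0 < min 1 (η ^ 2) := by positivity
      have h1 := hB _ hz'
      have h2 := hD _ hz'
      rw [norm_mul, norm_mul, norm_pow, norm_div, Complex.norm_I, div_pow, one_pow, div_div,
        mul_one_div]
      have h4 := one_add_sq_le_norm_sq hη hz
      have hB0 : 0 ≤ B := (norm_nonneg _).trans h1
      have hD0 : 0 ≤ D := (norm_nonneg _).trans h2
      gcongr
  have hlim : Tendsto (fun η : ℝ => ∫ x : ℝ, u (x + y * Complex.I) * v (x + y * Complex.I) *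
      (Complex.I / (Complex.I + η * x)) ^ 2) (𝓝[>] 0)
      (𝓝 (∫ x : ℝ, u (x + y * Complex.I) * v (x + y * Complex.I))) := by
    have hint : Integrable (fun x : ℝ => u (x + y * Complex.I) * v (x + y * Complex.I)) :=
      (hu.memLp_line hy).integrable_mul (hv.memLp_line hy)
    have hcu := hu.continuous_line hy.le
    have hcv := hv.continuous_line hy.le
    refine tendsto_integral_filter_of_dominated_convergence
      (fun x : ℝ => ‖u (x + y * Complex.I) * v (x + y * Complex.I)‖) ?_ ?_ hint.norm ?_
    · filter_upwards [self_mem_nhdsWithin] with η hη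
      have hη' : 0 < η := hη
      have hq : Continuous fun x : ℝ => Complex.I / (Complex.I + η * x) :=
        Continuous.div continuous_const (by fun_prop) fun x => hne η hη' x (by simp)
      exact ((hcu.mul hcv).mul (hq.pow 2)).aestronglyMeasurable
    · filter_upwards [self_mem_nhdsWithin] with η hη
      refine Eventually.of_forall fun x => ?_
      rw [norm_mul]
      refine mul_le_of_le_one_right (norm_nonneg _) ?_
      rw [norm_pow, norm_div, Complex.norm_I]
      refine pow_le_one₀ (by positivity) (div_le_one_of_le₀ ?_ (norm_nonneg _))
      have := Complex.abs_im_le_norm (Complex.I + η * x)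
      simpa using this
    · refine Eventually.of_forall fun x => ?_
      have h1 : ContinuousAt (fun η : ℝ => u (x + y * Complex.I) * v (x + y * Complex.I) *
          (Complex.I / (Complex.I + η * x)) ^ 2) 0 := by
        refine continuousAt_const.mul ((continuousAt_const.div (by fun_prop) (by simp)).pow 2)
      have h2 := h1.tendsto
      simp only [Complex.ofReal_zero, zero_mul, add_zero, div_self Complex.I_ne_zero, one_pow,
        mul_one] at h2
      exact h2.mono_left nhdsWithin_le_nhds
  refine tendsto_nhds_unique hlim (tendsto_const_nhds.congr' ?_)
  filter_upwards [self_mem_nhdsWithin] with η hη using (hzero η hη).symm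

open MeasureTheory Filter Topology in
/-- The functions `x ↦ u (x + i y)` converge to the boundary function in `L²`. -/
theorem tendsto_integral_norm_sq_sub (hu : IsHardy u) {y : ℕ → ℝ} (hy : ∀ n, 0 < y n)
    (hlim : Tendsto y atTop (𝓝 0)) :
    Tendsto (fun n => ∫ x : ℝ, ‖u (x + y n * Complex.I) - u x‖ ^ 2) atTop (𝓝 0) := by
  set N := ∫ x : ℝ, ‖u x‖ ^ 2 with hN
  have hN0 : 0 ≤ N := integral_nonneg fun x => by positivity
  have hI := (memLp_two_iff_integrable_sq_norm hu.memLp.1).1 hu.memLp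
  have hadd : ∀ n, Integrable fun x : ℝ => ‖u (x + y n * Complex.I) + u x‖ ^ 2 := fun n => by
    have := (hu.memLp_line (hy n)).add hu.memLp
    exact (memLp_two_iff_integrable_sq_norm this.1).1 this
  have hsub : ∀ n, Integrable fun x : ℝ => ‖u (x + y n * Complex.I) - u x‖ ^ 2 := fun n => by
    have := (hu.memLp_line (hy n)).sub hu.memLp
    exact (memLp_two_iff_integrable_sq_norm this.1).1 this
  -- By the parallelogram law and the bound N on each line it is enough that the norms of the sums
  -- tend to the maximal value 4N; Fatou's lemma gives the lower bound.
  have hpar : ∀ n, (∫ x : ℝ, ‖u (x + y n * Complex.I) - u x‖ ^ 2) ≤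
      4 * N - ∫ x : ℝ, ‖u (x + y n * Complex.I) + u x‖ ^ 2 := by
    intro n
    have h1 : (∫ x : ℝ, ‖u (x + y n * Complex.I) + u x‖ ^ 2) +
        (∫ x : ℝ, ‖u (x + y n * Complex.I) - u x‖ ^ 2) =
        2 * (∫ x : ℝ, ‖u (x + y n * Complex.I)‖ ^ 2) + 2 * N := by
      rw [hN, ← integral_add (hadd n) (hsub n), ← integral_const_mul, ← integral_const_mul,
        ← integral_add ((hu.integrable_line (hy n)).const_mul 2) (hI.const_mul 2)]
      congr 1
      funext x
      have := parallelogram_law_with_norm ℂ (u (x + y n * Complex.I)) (u x)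
      nlinarith
    have h2 := hu.integral_norm_sq_line_le (hy n)
    linarith
  have hpt : ∀ x : ℝ, Tendsto (fun n => ENNReal.ofReal (‖u (x + y n * Complex.I) + u x‖ ^ 2)) atTop
      (𝓝 (ENNReal.ofReal (4 * ‖u x‖ ^ 2))) := by
    intro x
    refine (ENNReal.continuous_ofReal.tendsto _).comp ?_
    have h1 : Tendsto (fun n => (x : ℂ) + y n * Complex.I) atTop (𝓝 x) := by
      have h0 : Tendsto (fun r : ℝ => (x : ℂ) + r * Complex.I) (𝓝 0) (𝓝 x) :=
        Continuous.tendsto' (by fun_prop) _ _ (by simp)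
      exact h0.comp hlim
    have h2 := (hu.analyticAt x (by simp)).continuousAt.tendsto.comp h1
    have h3 := ((h2.add_const (u x)).norm.pow 2)
    have h4 : ‖u x + u x‖ ^ 2 = 4 * ‖u x‖ ^ 2 := by
      rw [← two_mul, norm_mul, RCLike.norm_ofNat]; ring
    rw [h4] at h3
    exact h3
  have hfatou := lintegral_liminf_le' (μ := volume) (u := atTop)
    (f := fun n (x : ℝ) => ENNReal.ofReal (‖u (x + y n * Complex.I) + u x‖ ^ 2))
    (fun n => (hadd n).1.aemeasurable.ennreal_ofReal)
  simp only [fun x => (hpt x).liminf_eq] at hfatou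
  rw [← ofReal_integral_eq_lintegral_ofReal (hI.const_mul 4)
    (Eventually.of_forall fun x => by positivity), integral_const_mul, ← hN] at hfatou
  simp only [fun n => (ofReal_integral_eq_lintegral_ofReal (hadd n)
    (Eventually.of_forall fun x => by positivity)).symm] at hfatou
  rw [Metric.tendsto_nhds]
  intro ε hε
  have hev : ∀ᶠ n in atTop, 4 * N - ε < ∫ x : ℝ, ‖u (x + y n * Complex.I) + u x‖ ^ 2 := by
    by_cases hneg : 4 * N - ε < 0
    · exact Eventually.of_forall fun n => hneg.trans_le (integral_nonneg fun x => by positivity)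
    · have hlt : ENNReal.ofReal (4 * N - ε) < ENNReal.ofReal (4 * N) :=
        (ENNReal.ofReal_lt_ofReal_iff (by linarith)).2 (by linarith)
      filter_upwards [eventually_lt_of_lt_liminf (hlt.trans_le hfatou)] with n hn
      exact ENNReal.lt_ofReal_iff_toReal_lt (by simp) |>.1 hn |>.trans_le' (by
        rw [ENNReal.toReal_ofReal (not_lt.1 hneg)])
  filter_upwards [hev] with n hn
  rw [Real.dist_eq, sub_zero, abs_of_nonneg (integral_nonneg fun x => by positivity)]
  linarith [hpar n]

open MeasureTheory Filter Topology in
/-- The integral over the real line of the product of two functions of the Hardy class is zero. -/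
theorem integral_mul_eq_zero (hu : IsHardy u) (hv : IsHardy v) : ∫ x : ℝ, u x * v x = 0 := by
  set y : ℕ → ℝ := fun n => 1 / ((n : ℝ) + 1) with hy
  have hy0 : ∀ n, 0 < y n := fun n => Nat.one_div_pos_of_nat
  have hylim : Tendsto y atTop (𝓝 0) := tendsto_one_div_add_atTop_nhds_zero_nat
  have h1 := hu.tendsto_integral_norm_sq_sub hy0 hylim
  have h2 := hv.tendsto_integral_norm_sq_sub hy0 hylim
  have hbound : ∀ n, ‖∫ x : ℝ, u x * v x‖ ≤
      √(∫ x : ℝ, ‖u (x + y n * Complex.I) - u x‖ ^ 2) * √(∫ x : ℝ, ‖v x‖ ^ 2) +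
      √(∫ x : ℝ, ‖u x‖ ^ 2) * √(∫ x : ℝ, ‖v (x + y n * Complex.I) - v x‖ ^ 2) := by
    intro n
    have hun := hu.memLp_line (hy0 n)
    have hvn := hv.memLp_line (hy0 n)
    -- The product on the line at height y n has integral zero; subtracting it leaves two terms,
    -- each with a factor small in L².
    have e : ∫ x : ℝ, u x * v x = -((∫ x : ℝ, (u (x + y n * Complex.I) - u x) *
        v (x + y n * Complex.I)) + ∫ x : ℝ, u x * (v (x + y n * Complex.I) - v x)) := by
      have i1 : Integrable fun x : ℝ => (u (x + y n * Complex.I) - u x) *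
          v (x + y n * Complex.I) := (hun.sub hu.memLp).integrable_mul hvn
      have i2 : Integrable fun x : ℝ => u x * (v (x + y n * Complex.I) - v x) :=
        hu.memLp.integrable_mul (hvn.sub hv.memLp)
      have i3 : Integrable fun x : ℝ => u x * v x := hu.memLp.integrable_mul hv.memLp
      have i4 : Integrable fun x : ℝ => (u (x + y n * Complex.I) - u x) *
          v (x + y n * Complex.I) + u x * (v (x + y n * Complex.I) - v x) := i1.add i2
      rw [eq_neg_iff_add_eq_zero, ← integral_add i1 i2, ← integral_add i3 i4,
        ← hu.integral_mul_line_eq_zero hv (hy0 n)]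
      congr 1
      funext x
      ring
    rw [e, norm_neg]
    refine (norm_add_le _ _).trans (add_le_add ?_ ?_)
    · refine (norm_integral_mul_le_sqrt (hun.sub hu.memLp) hvn).trans ?_
      have := hv.integral_norm_sq_line_le (hy0 n)
      simp only [Pi.sub_apply]
      gcongr
    · exact norm_integral_mul_le_sqrt hu.memLp (hvn.sub hv.memLp)
  have hlim : Tendsto (fun n => √(∫ x : ℝ, ‖u (x + y n * Complex.I) - u x‖ ^ 2) *
      √(∫ x : ℝ, ‖v x‖ ^ 2) + √(∫ x : ℝ, ‖u x‖ ^ 2) *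
      √(∫ x : ℝ, ‖v (x + y n * Complex.I) - v x‖ ^ 2)) atTop (𝓝 0) := by
    have := (h1.sqrt.mul_const (√(∫ x : ℝ, ‖v x‖ ^ 2))).add
      (h2.sqrt.const_mul (√(∫ x : ℝ, ‖u x‖ ^ 2)))
    simpa using this
  exact norm_le_zero_iff.1 (ge_of_tendsto' hlim hbound)

end IsHardy

/-! ### Algebra of functions of bounded type, and Cauchy's formula -/

open Filter Topology in
theorem exists_mul_ne_zero_upperHalf {f g : ℂ → ℂ} (hf : DifferentiableOn ℂ f upperHalf)
    (hg : DifferentiableOn ℂ g upperHalf) (hf0 : ∃ z ∈ upperHalf, f z ≠ 0)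
    (hg0 : ∃ z ∈ upperHalf, g z ≠ 0) : ∃ z ∈ upperHalf, f z * g z ≠ 0 := by
  obtain ⟨u, hu, hfu⟩ := hf0
  obtain ⟨v, hv, hgv⟩ := hg0
  by_contra! hcon
  refine hgv ((hg.analyticOnNhd
    isOpen_upperHalf).eqOn_zero_of_preconnected_of_eventuallyEq_zero isPreconnected_upperHalf hu
    ?_ hv)
  filter_upwards [(hf.differentiableAt (isOpen_upperHalf.mem_nhds hu)).continuousAt.eventually_ne
    hfu, isOpen_upperHalf.mem_nhds hu] with z hz hz'
  exact (mul_eq_zero.1 (hcon z hz')).resolve_left hz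

namespace IsBoundedType

variable {f g k : ℂ → ℂ}

theorem of_bounded (hf : DifferentiableOn ℂ f upperHalf) {C : ℝ} (h : ∀ z ∈ upperHalf, ‖f z‖ ≤ C) :
    IsBoundedType f :=
  ⟨f, 1, hf, differentiableOn_const 1, ⟨C, h⟩, ⟨1, by simp⟩, ⟨Complex.I, I_mem_upperHalf, by simp⟩,
    by simp⟩

theorem mul (hf : IsBoundedType f) (hg : IsBoundedType g) :
    IsBoundedType (fun z => f z * g z) := by
  obtain ⟨P, Q, hP, hQ, ⟨a, ha⟩, ⟨b, hb⟩, hQ0, h⟩ := hf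
  obtain ⟨P', Q', hP', hQ', ⟨a', ha'⟩, ⟨b', hb'⟩, hQ0', h'⟩ := hg
  refine ⟨fun z => P z * P' z, fun z => Q z * Q' z, hP.mul hP', hQ.mul hQ',
    ⟨a * a', fun z hz => ?_⟩, ⟨b * b', fun z hz => ?_⟩,
    exists_mul_ne_zero_upperHalf hQ hQ' hQ0 hQ0', fun z hz => ?_⟩
  · rw [norm_mul]
    exact mul_le_mul (ha z hz) (ha' z hz) (norm_nonneg _) ((norm_nonneg _).trans (ha z hz))
  · rw [norm_mul]
    exact mul_le_mul (hb z hz) (hb' z hz) (norm_nonneg _) ((norm_nonneg _).trans (hb z hz))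
  · simp only [← h z hz, ← h' z hz]; ring

theorem congr (hf : IsBoundedType f) (h : ∀ z ∈ upperHalf, g z = f z) : IsBoundedType g := by
  obtain ⟨P, Q, hP, hQ, ha, hb, hQ0, hPQ⟩ := hf
  exact ⟨P, Q, hP, hQ, ha, hb, hQ0, fun z hz => by rw [h z hz, hPQ z hz]⟩

/-- A quotient of functions of bounded type is of bounded type. -/
theorem of_mul_eq (hf : IsBoundedType f) (hfd : DifferentiableOn ℂ f upperHalf)
    (hf0 : ∃ z ∈ upperHalf, f z ≠ 0) (hg : IsBoundedType g)
    (h : ∀ z ∈ upperHalf, k z * f z = g z) : IsBoundedType k := by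
  obtain ⟨P, Q, hP, hQ, ⟨a, ha⟩, ⟨b, hb⟩, hQ0, hf⟩ := hf
  obtain ⟨P', Q', hP', hQ', ⟨a', ha'⟩, ⟨b', hb'⟩, hQ0', hg⟩ := hg
  have hP0 : ∃ z ∈ upperHalf, P z ≠ 0 := by
    obtain ⟨z, hz, hz'⟩ := exists_mul_ne_zero_upperHalf hfd hQ hf0 hQ0
    exact ⟨z, hz, by rwa [← hf z hz]⟩
  refine ⟨fun z => P' z * Q z, fun z => P z * Q' z, hP'.mul hQ, hP.mul hQ',
    ⟨a' * b, fun z hz => ?_⟩, ⟨a * b', fun z hz => ?_⟩,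
    exists_mul_ne_zero_upperHalf hP hQ' hP0 hQ0', fun z hz => ?_⟩
  · rw [norm_mul]
    exact mul_le_mul (ha' z hz) (hb z hz) (norm_nonneg _) ((norm_nonneg _).trans (ha' z hz))
  · rw [norm_mul]
    exact mul_le_mul (ha z hz) (hb' z hz) (norm_nonneg _) ((norm_nonneg _).trans (ha z hz))
  · simp only [← hg z hz, ← h z hz, ← hf z hz]; ring

end IsBoundedType

theorem isBoundedType_const (c : ℂ) : IsBoundedType (fun _ => c) :=
  IsBoundedType.of_bounded (differentiableOn_const c) (C := ‖c‖) fun _ _ => le_rfl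

theorem one_le_norm_add_I {z : ℂ} (hz : z ∈ upperHalf) : 1 ≤ ‖z + Complex.I‖ := by
  have h1 := (le_abs_self _).trans (Complex.abs_im_le_norm (z + Complex.I))
  have h2 : (0 : ℝ) < z.im := hz
  simp only [Complex.add_im, Complex.I_im] at h1
  linarith

/-- z is the quotient of 1 - i/(z + i) by 1/(z + i), both bounded. -/
theorem isBoundedType_id : IsBoundedType (fun z => z) := by
  have hne : ∀ z ∈ upperHalf, z + Complex.I ≠ 0 := fun z hz h => by
    have := one_le_norm_add_I hz
    rw [h, norm_zero] at this; linarith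
  have hd : DifferentiableOn ℂ (fun z : ℂ => 1 / (z + Complex.I)) upperHalf := fun z hz => by
    have := hne z hz
    refine DifferentiableAt.differentiableWithinAt ?_
    fun_prop (disch := assumption)
  refine IsBoundedType.of_mul_eq (f := fun z => 1 / (z + Complex.I))
    (g := fun z => 1 - Complex.I * (1 / (z + Complex.I)))
    (IsBoundedType.of_bounded hd (C := 1) fun z hz => ?_) hd ⟨Complex.I, I_mem_upperHalf, ?_⟩
    (IsBoundedType.of_bounded ((differentiableOn_const 1).sub (hd.const_mul _))
      (C := 2) fun z hz => ?_) fun z hz => ?_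
  · rw [norm_div, norm_one]
    exact div_le_one_of_le₀ (one_le_norm_add_I hz) (norm_nonneg _)
  · exact one_div_ne_zero (hne _ I_mem_upperHalf)
  · refine (norm_sub_le _ _).trans ?_
    rw [norm_mul, norm_div, norm_one, Complex.norm_I, one_mul]
    linarith [div_le_one_of_le₀ (one_le_norm_add_I hz) (norm_nonneg _)]
  · have := hne z hz
    field_simp
    ring

theorem meanType_nonpos_of_le {f g : ℂ → ℂ} (hg : meanType g ≤ 0) {A B : ℝ} (hA : 0 ≤ A)
    (hB : 0 ≤ B) (h : ∀ᶠ y : ℝ in Filter.atTop,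
      ‖f (y * Complex.I)‖ ≤ A * ‖g (y * Complex.I)‖ + B) : meanType f ≤ 0 := by
  rw [meanType_nonpos_iff] at *
  intro ε hε
  filter_upwards [h, hg (ε / 2) (by linarith), Filter.eventually_ge_atTop (2 * (A + B) / ε),
    Filter.eventually_ge_atTop 0] with y h1 h2 h3 h0
  rw [div_le_iff₀ hε] at h3
  have h5 := Real.add_one_le_exp (ε / 2 * y)
  have h6 : Real.exp (ε * y) = Real.exp (ε / 2 * y) * Real.exp (ε / 2 * y) := by
    rw [← Real.exp_add]; ring_nf
  have h7 : 1 ≤ Real.exp (ε / 2 * y) := Real.one_le_exp (by positivity)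
  rw [h6]
  calc _ ≤ A * ‖g (y * Complex.I)‖ + B := h1
    _ ≤ A * Real.exp (ε / 2 * y) + B * Real.exp (ε / 2 * y) := by gcongr; nlinarith
    _ = (A + B) * Real.exp (ε / 2 * y) := by ring
    _ ≤ _ := by gcongr; linarith

open MeasureTheory in
theorem integrable_inv_norm_sub_sq {w : ℂ} (hw : w.im ≠ 0) :
    Integrable (fun t : ℝ => (‖(t : ℂ) - w‖ ^ 2)⁻¹) ∧
      ∫ t : ℝ, (‖(t : ℂ) - w‖ ^ 2)⁻¹ = Real.pi / |w.im| := by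
  have e : (fun t : ℝ => (‖(t : ℂ) - w‖ ^ 2)⁻¹) =
      fun t : ℝ => (w.im ^ 2)⁻¹ * (1 + ((t - w.re) / w.im) ^ 2)⁻¹ := by
    funext t
    rw [← mul_inv]
    congr 1
    rw [← Complex.normSq_eq_norm_sq, Complex.normSq_apply]
    simp
    field_simp
    ring
  rw [e]
  have h1 : Integrable fun t : ℝ => (1 + (t / w.im) ^ 2)⁻¹ :=
    integrable_inv_one_add_sq.comp_div hw
  refine ⟨(h1.comp_sub_right w.re).const_mul _, ?_⟩
  rw [integral_const_mul, integral_sub_right_eq_self (fun t : ℝ => (1 + (t / w.im) ^ 2)⁻¹) w.re,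
    Measure.integral_comp_div (fun t : ℝ => (1 + t ^ 2)⁻¹), integral_univ_inv_one_add_sq,
    smul_eq_mul, ← sq_abs]
  have : |w.im| ≠ 0 := abs_ne_zero.2 hw
  field_simp

open MeasureTheory in
theorem memLp_inv_sub {w : ℂ} (hw : w.im ≠ 0) : MemLp (fun t : ℝ => ((t : ℂ) - w)⁻¹) 2 := by
  have hc : Continuous (fun t : ℝ => ((t : ℂ) - w)⁻¹) :=
    Continuous.inv₀ (by fun_prop) fun t h => hw (by
      have := congrArg Complex.im h
      simpa using this)
  refine (memLp_two_iff_integrable_sq_norm hc.aestronglyMeasurable).2 ?_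
  simpa only [norm_inv, inv_pow] using (integrable_inv_norm_sub_sq hw).1

theorem isHardy_inv_sub_conj {w : ℂ} (hw : w ∈ upperHalf) : IsHardy (fun z => (z - conj w)⁻¹) := by
  have hw' : 0 < w.im := hw
  have hle : ∀ z : ℂ, 0 ≤ z.im → w.im ≤ ‖z - conj w‖ := fun z hz => by
    have h1 := (le_abs_self _).trans (Complex.abs_im_le_norm (z - conj w))
    simp only [Complex.sub_im, Complex.conj_im] at h1
    linarith
  have hne : ∀ z : ℂ, 0 ≤ z.im → z - conj w ≠ 0 := fun z hz h => by
    have := hle z hz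
    rw [h, norm_zero] at this
    linarith
  have hb : ∀ z : ℂ, 0 ≤ z.im → ‖(z - conj w)⁻¹‖ ≤ w.im⁻¹ := fun z hz => by
    rw [norm_inv]
    exact inv_anti₀ hw' (hle z hz)
  have han : ∀ z : ℂ, 0 ≤ z.im → AnalyticAt ℂ (fun z => (z - conj w)⁻¹) z := fun z hz =>
    (analyticAt_id.sub analyticAt_const).inv (hne z hz)
  refine ⟨han, memLp_inv_sub (by simpa using hw'.ne'), IsBoundedType.of_bounded
    (fun z hz => (han z (le_of_lt hz)).differentiableAt.differentiableWithinAt)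
    fun z hz => hb z (le_of_lt hz), meanType_nonpos_of_bounded (C := w.im⁻¹) ?_⟩
  filter_upwards [Filter.eventually_ge_atTop 0] with y hy
  exact hb _ (by simpa)

namespace IsHardy

variable {u : ℂ → ℂ}

theorem integral_mul_inv_sub_conj (hu : IsHardy u) {w : ℂ} (hw : w ∈ upperHalf) :
    ∫ t : ℝ, u t * ((t : ℂ) - conj w)⁻¹ = 0 :=
  hu.integral_mul_eq_zero (isHardy_inv_sub_conj hw)

/-- Subtracting the value at w removes the pole of u(z)(z - conj w)/(z - w). On the real line (t -
conj w)/(t - w) is unimodular, so square integrability is kept. -/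
theorem dslope_mul (hu : IsHardy u) {w : ℂ} (hw : w ∈ upperHalf) :
    IsHardy (dslope (fun z => u z * (z - conj w)) w) := by
  have hw' : 0 < w.im := hw
  set g : ℂ → ℂ := fun z => u z * (z - conj w) with hg
  have hga : ∀ z : ℂ, 0 ≤ z.im → AnalyticAt ℂ g z := fun z hz =>
    (hu.analyticAt z hz).mul (analyticAt_id.sub analyticAt_const)
  have heq : ∀ z, z ≠ w → dslope g w z = (g z - g w) / (z - w) := fun z hz => by
    rw [dslope_of_ne _ hz, slope_def_field]
  have hre : ∀ t : ℝ, (t : ℂ) ≠ w := fun t h => by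
    rw [← h] at hw'; simp at hw'
  have han : ∀ z : ℂ, 0 ≤ z.im → AnalyticAt ℂ (dslope g w) z := by
    intro z hz
    by_cases hzw : z = w
    · rw [hzw]
      have hd : DifferentiableOn ℂ (dslope g w) upperHalf :=
        (Complex.differentiableOn_dslope (isOpen_upperHalf.mem_nhds hw)).2 fun x hx =>
          (hga x (le_of_lt hx)).differentiableAt.differentiableWithinAt
      exact hd.analyticAt (isOpen_upperHalf.mem_nhds hw)
    · refine AnalyticAt.congr (((hga z hz).sub (analyticAt_const (v := g w))).div
        (analyticAt_id.sub analyticAt_const) (sub_ne_zero.2 hzw)) ?_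
      filter_upwards [isOpen_ne.mem_nhds hzw] with x hx
      exact (heq x hx).symm
  refine ⟨han, ?_, ?_, ?_⟩
  · have h1 : MeasureTheory.MemLp (fun t : ℝ => u t * (((t : ℂ) - conj w) / (t - w)) -
        g w * ((t : ℂ) - w)⁻¹) 2 := by
      refine MeasureTheory.MemLp.sub ?_ ((memLp_inv_sub hw'.ne').const_mul _)
      have hne : ∀ t : ℝ, (t : ℂ) - w ≠ 0 := fun t => sub_ne_zero.2 (hre t)
      have hc : Continuous fun t : ℝ => ((t : ℂ) - conj w) / (t - w) :=
        Continuous.div (by fun_prop) (by fun_prop) hne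
      refine hu.memLp.of_le (hu.memLp.1.mul hc.aestronglyMeasurable)
        (Filter.Eventually.of_forall fun t => ?_)
      have h2 : ‖(t : ℂ) - conj w‖ = ‖(t : ℂ) - w‖ := by
        rw [← RCLike.norm_conj ((t : ℂ) - w), map_sub, Complex.conj_ofReal]
      rw [norm_mul, norm_div, h2, div_self (norm_ne_zero_iff.2 (hne t)), mul_one]
    have e : (fun t : ℝ => dslope g w t) = fun t : ℝ => u t * (((t : ℂ) - conj w) / (t - w)) -
        g w * ((t : ℂ) - w)⁻¹ := by
      funext t
      rw [heq _ (hre t)]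
      ring
    rw [e]
    exact h1
  · refine IsBoundedType.of_mul_eq (f := fun z => z - w) (g := fun z => u z * (z - conj w) - g w)
      ?_ (by fun_prop) ?_ ?_ ?_
    · exact (isBoundedType_id.add (isBoundedType_const (-w))).congr fun z _ => by
        simp [sub_eq_add_neg]
    · refine ⟨w + Complex.I, ?_, by simp⟩
      change 0 < (w + Complex.I).im
      simp; linarith
    · refine ((hu.isBoundedType.mul (isBoundedType_id.add (isBoundedType_const (-conj w)))).add
        (isBoundedType_const (-g w))).congr fun z _ => by simp [sub_eq_add_neg]
    · intro z _
      by_cases hzw : z = w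
      · simp [hzw, hg]
      · rw [heq z hzw, div_mul_cancel₀ _ (sub_ne_zero.2 hzw)]
  · refine meanType_nonpos_of_le hu.meanType_nonpos (A := 2) (B := ‖g w‖) (by norm_num)
      (norm_nonneg _) ?_
    -- From y = 3‖w‖ on, y + ‖w‖ ≤ 2(y - ‖w‖), which gives the factor 2; the extra 1 ensures ‖iy -
    -- w‖ ≥ 1.
    filter_upwards [Filter.eventually_ge_atTop (3 * ‖w‖ + 1)] with y hy
    have hwn := norm_nonneg w
    have hny : ‖(y : ℂ) * Complex.I‖ = y := by
      rw [norm_mul, Complex.norm_I, mul_one, Complex.norm_real, Real.norm_eq_abs,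
        abs_of_nonneg (by linarith)]
    have h1 : y - ‖w‖ ≤ ‖y * Complex.I - w‖ := by
      have := norm_sub_norm_le (y * Complex.I) w
      rwa [hny] at this
    have h2 : ‖y * Complex.I - conj w‖ ≤ y + ‖w‖ := by
      have := norm_sub_le (y * Complex.I) (conj w)
      rwa [hny, RCLike.norm_conj] at this
    have h3 : 0 < ‖y * Complex.I - w‖ := by linarith
    rw [heq _ (fun h => by rw [h, sub_self, norm_zero] at h3; exact lt_irrefl _ h3), norm_div,
      div_le_iff₀ h3]
    refine (norm_sub_le _ _).trans ?_
    rw [hg, norm_mul, add_mul]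
    have h4 : ‖u (↑y * Complex.I)‖ * ‖y * Complex.I - conj w‖ ≤
        ‖u (↑y * Complex.I)‖ * (2 * ‖y * Complex.I - w‖) := by
      gcongr; linarith
    have h5 := le_mul_of_one_le_right (norm_nonneg (u w * (w - conj w)))
      (show 1 ≤ ‖y * Complex.I - w‖ by linarith)
    nlinarith

/-- **Cauchy's formula** in the upper half-plane. -/
theorem integral_mul_inv_sub (hu : IsHardy u) {w : ℂ} (hw : w ∈ upperHalf) :
    ∫ t : ℝ, u t * ((t : ℂ) - w)⁻¹ = 2 * Real.pi * Complex.I * u w := by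
  have hw' : 0 < w.im := hw
  have hw0 : w.im ≠ 0 := hw'.ne'
  have hne : ∀ t : ℝ, (t : ℂ) - w ≠ 0 := fun t h => hw0 (by
    have := congrArg Complex.im h
    simpa using this)
  have hne' : ∀ t : ℝ, (t : ℂ) - conj w ≠ 0 := fun t h => hw0 (by
    have := congrArg Complex.im h
    simpa using this)
  have h1 := (hu.dslope_mul hw).integral_mul_inv_sub_conj hw
  -- The first term is a product of two Hardy functions and integrates to zero. The second is a
  -- multiple of the Poisson kernel, with integral u(w) · 2i Im w · π/Im w.
  have e : ∀ t : ℝ, u t * ((t : ℂ) - w)⁻¹ =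
      dslope (fun z => u z * (z - conj w)) w t * ((t : ℂ) - conj w)⁻¹ +
        u w * (w - conj w) * (((‖(t : ℂ) - w‖ ^ 2)⁻¹ : ℝ) : ℂ) := by
    intro t
    rw [dslope_of_ne _ (sub_ne_zero.1 (hne t)), slope_def_field]
    have h2 : (((‖(t : ℂ) - w‖ ^ 2)⁻¹ : ℝ) : ℂ) = ((t : ℂ) - w)⁻¹ * ((t : ℂ) - conj w)⁻¹ := by
      push_cast
      rw [← Complex.mul_conj', map_sub, Complex.conj_ofReal, mul_inv]
    rw [h2]
    have := hne t
    have := hne' t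
    field_simp
    ring
  have i1 : MeasureTheory.Integrable fun t : ℝ =>
      dslope (fun z => u z * (z - conj w)) w t * ((t : ℂ) - conj w)⁻¹ :=
    (hu.dslope_mul hw).memLp.integrable_mul (isHardy_inv_sub_conj hw).memLp
  have i2 : MeasureTheory.Integrable fun t : ℝ =>
      u w * (w - conj w) * (((‖(t : ℂ) - w‖ ^ 2)⁻¹ : ℝ) : ℂ) :=
    (integrable_inv_norm_sub_sq hw0).1.ofReal.const_mul _
  rw [MeasureTheory.integral_congr_ae (Filter.Eventually.of_forall e),
    MeasureTheory.integral_add i1 i2, h1, MeasureTheory.integral_const_mul, integral_complex_ofReal,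
    (integrable_inv_norm_sub_sq hw0).2, abs_of_pos hw', Complex.sub_conj]
  have : (w.im : ℂ) ≠ 0 := by exact_mod_cast hw0
  push_cast
  field_simp
  ring

end IsHardy

/-! ### Cauchy transforms of square integrable functions -/

section CauchyTransform

open MeasureTheory Filter Topology

theorem ofReal_sub_ne_zero {w : ℂ} (hw : w.im ≠ 0) (t : ℝ) : (t : ℂ) - w ≠ 0 := fun h => hw (by
  have := congrArg Complex.im h
  simpa using this)

theorem integrable_mul_inv_sub {g : ℝ → ℂ} (hg : MemLp g 2) {w : ℂ} (hw : w.im ≠ 0) :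
    Integrable fun t : ℝ => g t * ((t : ℂ) - w)⁻¹ :=
  hg.integrable_mul (memLp_inv_sub hw)

theorem norm_integral_mul_inv_sub_le {g : ℝ → ℂ} (hg : MemLp g 2) {w : ℂ} (hw : w.im ≠ 0) :
    ‖∫ t : ℝ, g t * ((t : ℂ) - w)⁻¹‖ ≤ √(∫ t : ℝ, ‖g t‖ ^ 2) * √(Real.pi / |w.im|) := by
  have h := norm_integral_mul_le_sqrt hg (memLp_inv_sub hw)
  simpa only [norm_inv, inv_pow, (integrable_inv_norm_sub_sq hw).2] using h

theorem differentiableOn_cauchyTransform {g : ℝ → ℂ} (hg : MemLp g 2) :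
    DifferentiableOn ℂ (fun w : ℂ => ∫ t : ℝ, g t * ((t : ℂ) - w)⁻¹) upperHalf := by
  intro w₀ hw₀
  have hy : 0 < w₀.im := hw₀
  have hlow : ∀ t : ℝ, w₀.im ≤ ‖(t : ℂ) - w₀‖ := fun t => by
    have := Complex.abs_im_le_norm ((t : ℂ) - w₀)
    simp only [Complex.sub_im, Complex.ofReal_im, zero_sub, abs_neg] at this
    exact (le_abs_self _).trans this
  have hhalf : ∀ w ∈ Metric.ball w₀ (w₀.im / 2), ∀ t : ℝ,
      ‖(t : ℂ) - w₀‖ / 2 ≤ ‖(t : ℂ) - w‖ := fun w hw t => by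
    have h1 := norm_sub_norm_le ((t : ℂ) - w₀) (w - w₀)
    have h2 : (t : ℂ) - w₀ - (w - w₀) = t - w := by ring
    rw [h2] at h1
    rw [Metric.mem_ball, dist_eq_norm] at hw
    linarith [hlow t]
  have hne : ∀ w ∈ Metric.ball w₀ (w₀.im / 2), ∀ t : ℝ, (t : ℂ) - w ≠ 0 := fun w hw t h => by
    have h1 := hhalf w hw t
    rw [h, norm_zero] at h1
    linarith [hlow t]
  have hball : Metric.ball w₀ (w₀.im / 2) ∈ 𝓝 w₀ := Metric.ball_mem_nhds _ (by positivity)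
  have hmeas : ∀ w ∈ Metric.ball w₀ (w₀.im / 2),
      Continuous fun t : ℝ => ((t : ℂ) - w)⁻¹ := fun w hw =>
    Continuous.inv₀ (by fun_prop) (hne w hw)
  -- On the ball of radius Im w₀ / 2 one has |t - w| ≥ |t - w₀|/2, whence the 4; one of the two
  -- factors 1/|t - w₀| is then estimated by 1/Im w₀.
  refine (hasDerivAt_integral_of_dominated_loc_of_deriv_le
    (F := fun w (t : ℝ) => g t * ((t : ℂ) - w)⁻¹)
    (F' := fun w (t : ℝ) => g t * (((t : ℂ) - w)⁻¹ * ((t : ℂ) - w)⁻¹))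
    (bound := fun t => ‖g t * ((t : ℂ) - w₀)⁻¹‖ * (4 / w₀.im)) hball
    ?_ (integrable_mul_inv_sub hg hy.ne') ?_ ?_ ?_ ?_).2.differentiableAt.differentiableWithinAt
  · filter_upwards [hball] with w hw
    exact hg.1.mul (hmeas w hw).aestronglyMeasurable
  · have h0 := hmeas w₀ (Metric.mem_ball_self (by positivity))
    exact hg.1.mul (h0.mul h0).aestronglyMeasurable
  · refine Eventually.of_forall fun t w hw => ?_
    have h1 := hhalf w hw t
    have h2 := hlow t
    rw [norm_mul, norm_mul, norm_mul, mul_assoc, norm_inv, norm_inv]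
    refine mul_le_mul_of_nonneg_left ?_ (norm_nonneg _)
    have h3 : ‖(t : ℂ) - w‖⁻¹ ≤ (‖(t : ℂ) - w₀‖ / 2)⁻¹ := inv_anti₀ (by linarith) h1
    have h4 : ‖(t : ℂ) - w₀‖⁻¹ ≤ w₀.im⁻¹ := inv_anti₀ hy h2
    calc ‖(t : ℂ) - w‖⁻¹ * ‖(t : ℂ) - w‖⁻¹
        ≤ (‖(t : ℂ) - w₀‖ / 2)⁻¹ * (‖(t : ℂ) - w₀‖ / 2)⁻¹ := by gcongr
      _ = 4 * (‖(t : ℂ) - w₀‖⁻¹ * ‖(t : ℂ) - w₀‖⁻¹) := by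
        rw [inv_div]; ring
      _ ≤ 4 * (‖(t : ℂ) - w₀‖⁻¹ * w₀.im⁻¹) := by gcongr
      _ = _ := by ring
  · exact (integrable_mul_inv_sub hg hy.ne').norm.mul_const _
  · refine Eventually.of_forall fun t w hw => ?_
    have h1 := ((hasDerivAt_id w).const_sub (t : ℂ)).inv (hne w hw t)
    refine (h1.const_mul (g t)).congr_deriv ?_
    simp only [neg_neg, id]
    field_simp [hne w hw t]

theorem im_cauchyTransform_nonneg {p : ℝ → ℝ} (hp : MemLp (fun t => (p t : ℂ)) 2)
    (hp0 : ∀ t, 0 ≤ p t) {w : ℂ} (hw : w ∈ upperHalf) :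
    0 ≤ (∫ t : ℝ, (p t : ℂ) * ((t : ℂ) - w)⁻¹).im := by
  have hy : 0 < w.im := hw
  have h : (∫ t : ℝ, (p t : ℂ) * ((t : ℂ) - w)⁻¹).im =
      ∫ t : ℝ, ((p t : ℂ) * ((t : ℂ) - w)⁻¹).im :=
    (integral_im (integrable_mul_inv_sub hp hy.ne')).symm
  rw [h]
  refine integral_nonneg fun t => ?_
  rw [Pi.zero_apply, Complex.im_ofReal_mul, Complex.inv_im]
  refine mul_nonneg (hp0 t) (div_nonneg ?_ (Complex.normSq_nonneg _))
  simp [hy.le]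

/-- An analytic function with nonnegative imaginary part is of bounded type. -/
theorem isBoundedType_of_im_nonneg {f : ℂ → ℂ} (hf : DifferentiableOn ℂ f upperHalf)
    (him : ∀ z ∈ upperHalf, 0 ≤ (f z).im) : IsBoundedType f := by
  have hle : ∀ z ∈ upperHalf, 1 ≤ ‖f z + Complex.I‖ := fun z hz => by
    have h1 := (le_abs_self _).trans (Complex.abs_im_le_norm (f z + Complex.I))
    simp only [Complex.add_im, Complex.I_im] at h1
    linarith [him z hz]
  have hne : ∀ z ∈ upperHalf, f z + Complex.I ≠ 0 := fun z hz h => by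
    have := hle z hz
    rw [h, norm_zero] at this; linarith
  have hd : DifferentiableOn ℂ (fun z : ℂ => 1 / (f z + Complex.I)) upperHalf :=
    (differentiableOn_const 1).div (hf.add_const _) hne
  -- f is the quotient of 1 - i/(f + i) by 1/(f + i), and |f + i| ≥ 1 makes both bounded.
  refine IsBoundedType.of_mul_eq (f := fun z => 1 / (f z + Complex.I))
    (g := fun z => 1 - Complex.I * (1 / (f z + Complex.I)))
    (IsBoundedType.of_bounded hd (C := 1) fun z hz => ?_) hd ⟨Complex.I, I_mem_upperHalf, ?_⟩
    (IsBoundedType.of_bounded ((differentiableOn_const 1).sub (hd.const_mul _))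
      (C := 2) fun z hz => ?_) fun z hz => ?_
  · rw [norm_div, norm_one]
    exact div_le_one_of_le₀ (hle z hz) (norm_nonneg _)
  · exact one_div_ne_zero (hne _ I_mem_upperHalf)
  · refine (norm_sub_le _ _).trans ?_
    rw [norm_mul, norm_div, norm_one, Complex.norm_I, one_mul]
    linarith [div_le_one_of_le₀ (hle z hz) (norm_nonneg _)]
  · have := hne z hz
    field_simp
    ring

/-- Split g into the positive and negative parts of its real and imaginary parts. The transform of a
nonnegative function has nonnegative imaginary part, hence is of bounded type. -/
theorem isBoundedType_cauchyTransform {g : ℝ → ℂ} (hg : MemLp g 2) :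
    IsBoundedType (fun w : ℂ => ∫ t : ℝ, g t * ((t : ℂ) - w)⁻¹) := by
  have hpos : ∀ p : ℝ → ℝ, AEMeasurable p → (∀ t, 0 ≤ p t) → (∀ t, p t ≤ ‖g t‖) →
      MemLp (fun t => (p t : ℂ)) 2 ∧
        IsBoundedType (fun w : ℂ => ∫ t : ℝ, (p t : ℂ) * ((t : ℂ) - w)⁻¹) := by
    intro p hpm hp0 hpg
    have hL : MemLp (fun t => (p t : ℂ)) 2 := by
      refine hg.of_le (Complex.measurable_ofReal.comp_aemeasurable hpm).aestronglyMeasurable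
        (Eventually.of_forall fun t => ?_)
      rw [Complex.norm_real, Real.norm_eq_abs, abs_of_nonneg (hp0 t)]
      exact hpg t
    exact ⟨hL, isBoundedType_of_im_nonneg (differentiableOn_cauchyTransform hL)
      fun w hw => im_cauchyTransform_nonneg hL hp0 hw⟩
  have hgm := hg.1.aemeasurable
  have hre := Complex.measurable_re.comp_aemeasurable hgm
  have him := Complex.measurable_im.comp_aemeasurable hgm
  obtain ⟨L1, b1⟩ := hpos (fun t => max (g t).re 0) (hre.max aemeasurable_const)
    (fun t => le_max_right _ _)
    fun t => max_le ((le_abs_self _).trans (Complex.abs_re_le_norm _)) (norm_nonneg _)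
  obtain ⟨L2, b2⟩ := hpos (fun t => max (-(g t).re) 0) (hre.neg.max aemeasurable_const)
    (fun t => le_max_right _ _)
    fun t => max_le ((neg_le_abs _).trans (Complex.abs_re_le_norm _)) (norm_nonneg _)
  obtain ⟨L3, b3⟩ := hpos (fun t => max (g t).im 0) (him.max aemeasurable_const)
    (fun t => le_max_right _ _)
    fun t => max_le ((le_abs_self _).trans (Complex.abs_im_le_norm _)) (norm_nonneg _)
  obtain ⟨L4, b4⟩ := hpos (fun t => max (-(g t).im) 0) (him.neg.max aemeasurable_const)
    (fun t => le_max_right _ _)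
    fun t => max_le ((neg_le_abs _).trans (Complex.abs_im_le_norm _)) (norm_nonneg _)
  refine ((b1.add (b2.const_mul (-1))).add ((b3.add (b4.const_mul (-1))).const_mul
    Complex.I)).congr fun w hw => ?_
  have hw' : w.im ≠ 0 := ne_of_gt (show 0 < w.im from hw)
  have i1 := integrable_mul_inv_sub L1 hw'
  have i2 := integrable_mul_inv_sub L2 hw'
  have i3 := integrable_mul_inv_sub L3 hw'
  have i4 := integrable_mul_inv_sub L4 hw'
  simp only [Pi.add_apply]
  have hmax : ∀ r : ℝ, ((max r 0 : ℝ) : ℂ) - ((max (-r) 0 : ℝ) : ℂ) = r := fun r => by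
    rw [← Complex.ofReal_sub]
    congr 1
    rcases le_total r 0 with h | h
    · rw [max_eq_right h, max_eq_left (by linarith)]; ring
    · rw [max_eq_left h, max_eq_right (by linarith)]; ring
  have e : ∀ t : ℝ, g t * ((t : ℂ) - w)⁻¹ =
      (((max (g t).re 0 : ℝ) : ℂ) * ((t : ℂ) - w)⁻¹ -
        ((max (-(g t).re) 0 : ℝ) : ℂ) * ((t : ℂ) - w)⁻¹) +
      Complex.I * (((max (g t).im 0 : ℝ) : ℂ) * ((t : ℂ) - w)⁻¹ -
        ((max (-(g t).im) 0 : ℝ) : ℂ) * ((t : ℂ) - w)⁻¹) := fun t => by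
    rw [← sub_mul, ← sub_mul, hmax, hmax, ← mul_assoc, ← add_mul]
    congr 1
    rw [mul_comm]
    exact (Complex.re_add_im _).symm
  have j1 := integral_sub i1 i2
  have j2 := integral_sub i3 i4
  have j3 := integral_const_mul (μ := volume) Complex.I fun t : ℝ =>
    ((max (g t).im 0 : ℝ) : ℂ) * ((t : ℂ) - w)⁻¹ -
      ((max (-(g t).im) 0 : ℝ) : ℂ) * ((t : ℂ) - w)⁻¹
  have j4 := integral_add (i1.sub i2) ((i3.sub i4).const_mul Complex.I)
  simp only [Pi.sub_apply] at j4
  rw [integral_congr_ae (Eventually.of_forall e), j4, j3, j2, j1]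
  ring

theorem meanType_cauchyTransform_nonpos {g : ℝ → ℂ} (hg : MemLp g 2) :
    meanType (fun w : ℂ => ∫ t : ℝ, g t * ((t : ℂ) - w)⁻¹) ≤ 0 := by
  refine meanType_nonpos_of_bounded (C := √(∫ t : ℝ, ‖g t‖ ^ 2) * √Real.pi) ?_
  filter_upwards [eventually_ge_atTop 1] with y hy
  have him : ((y : ℂ) * Complex.I).im = y := by simp
  refine (norm_integral_mul_inv_sub_le hg (by rw [him]; linarith)).trans ?_
  rw [him, abs_of_nonneg (by linarith)]
  gcongr
  exact div_le_self Real.pi_pos.le hy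

end CauchyTransform

/-! ### The reproducing property -/

namespace HermiteBiehler

variable {E : HermiteBiehler}

theorem ne_zero_of_im_nonneg (hE : ∀ x : ℝ, E x ≠ 0) {z : ℂ} (hz : 0 ≤ z.im) : E z ≠ 0 := by
  rcases hz.eq_or_lt with h | h
  · have : z = (z.re : ℂ) := Complex.ext (by simp) (by simp [← h])
    rw [this]
    exact hE _
  · exact E.ne_zero h

theorem starFun_ofReal (f : ℂ → ℂ) (t : ℝ) : starFun f t = conj (f t) := by simp [starFun]

namespace Space

theorem isHardy_div (hE : ∀ x : ℝ, E x ≠ 0) (f : E.Space) : IsHardy (fun z => f z / E z) where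
  analyticAt z hz := (f.2.1.analyticAt z).div (E.differentiable.analyticAt z)
    (ne_zero_of_im_nonneg hE hz)
  memLp := f.2.2.1
  isBoundedType := f.2.2.2.1
  meanType_nonpos := f.2.2.2.2.1

/-- The conjugation `f ↦ f*` of the de Branges space. -/
def conjStar (f : E.Space) : E.Space :=
  ⟨starFun f, f.2.1.starFun, by
    have hm := E.measurable_div (f := starFun f) f.2.1.starFun.continuous
    refine f.2.2.1.of_le hm.aestronglyMeasurable (Filter.Eventually.of_forall fun t => ?_)
    rw [starFun_ofReal, norm_div, norm_div, RCLike.norm_conj], f.2.2.2.2.2.1, f.2.2.2.2.2.2, by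
    rw [starFun_starFun]; exact f.2.2.2.1, by rw [starFun_starFun]; exact f.2.2.2.2.1⟩

theorem conjStar_apply (f : E.Space) (z : ℂ) : f.conjStar z = conj (f (conj z)) := rfl

theorem conjStar_ofReal (f : E.Space) (t : ℝ) : f.conjStar t = conj (f t) := starFun_ofReal _ t

theorem inner_conjStar (f g : E.Space) : inner ℂ f.conjStar g.conjStar = conj (inner ℂ f g) := by
  rw [inner_eq, inner_eq, ← integral_conj]
  congr 1
  funext t
  rw [conjStar_ofReal, conjStar_ofReal]
  simp

theorem conjStar_kernel (w : ℂ) : (E.kernel w).conjStar = E.kernel (conj w) :=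
  ext fun z => congrFun (E.starFun_kernelFun w) z

theorem kernel_apply (w z : ℂ) : E.kernel w z = E.kernelFun w z := rfl

-- On the real line the two terms of the kernel turn the inner product into a Cauchy integral of f/E
-- at w and the conjugate of one of f*/E at conj w. The first yields f(w) by Cauchy's formula, the
-- second vanishes.
open MeasureTheory in
theorem inner_kernel_of_mem_upperHalf (hE : ∀ x : ℝ, E x ≠ 0) (f : E.Space) {w : ℂ}
    (hw : w ∈ upperHalf) : inner ℂ (E.kernel w) f = f w := by
  have hw' : 0 < w.im := hw
  have hcw : (conj w).im ≠ 0 := by simpa using hw'.ne'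
  have hpi : (Real.pi : ℂ) ≠ 0 := by exact_mod_cast Real.pi_ne_zero
  have h1 := (isHardy_div hE f).integral_mul_inv_sub hw
  have h2 := congrArg conj ((isHardy_div hE f.conjStar).integral_mul_inv_sub_conj hw)
  rw [← integral_conj, map_zero] at h2
  have i1 := integrable_mul_inv_sub f.2.2.1 hw'.ne'
  have i2 : Integrable fun t : ℝ =>
      conj (f.conjStar t / E t * ((t : ℂ) - conj w)⁻¹) := by
    have := integrable_mul_inv_sub f.conjStar.2.2.1 hcw
    exact (Complex.conjCLE.toContinuousLinearMap.integrable_comp this)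
  rw [inner_eq]
  have e : ∀ t : ℝ, f t * conj (E.kernel w t) / ((‖E t‖ : ℂ) ^ 2) =
      E w / (2 * Real.pi * Complex.I) * (f t / E t * ((t : ℂ) - w)⁻¹) -
      conj (E (conj w)) / (2 * Real.pi * Complex.I) *
        conj (f.conjStar t / E t * ((t : ℂ) - conj w)⁻¹) := by
    intro t
    have hk := congrArg conj (E.kernelFun_mul w t)
    simp only [kernelNum, starFun_ofReal, map_mul, map_sub, Complex.conj_conj, Complex.conj_I,
      Complex.conj_ofReal, Complex.conj_ofNat] at hk
    have hne := ofReal_sub_ne_zero hw'.ne' t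
    have hk' : conj (E.kernel w t) = (E w * conj (E t) - conj (E (conj w)) * E t) /
        (2 * Real.pi * Complex.I * ((t : ℂ) - w)) := by
      rw [kernel_apply, eq_div_iff (by simp [hpi, hne]), ← hk]
      ring
    have hEt := hE t
    have hEt' : conj (E t) ≠ 0 := (map_ne_zero _).2 hEt
    rw [hk', ← Complex.mul_conj', conjStar_ofReal]
    simp only [map_mul, map_div₀, map_inv₀, map_sub, Complex.conj_conj, Complex.conj_ofReal]
    have hI := Complex.I_ne_zero
    field_simp
  rw [integral_congr_ae (Filter.Eventually.of_forall e), integral_sub (i1.const_mul _)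
    (i2.const_mul _), integral_const_mul, integral_const_mul, h1, h2]
  have hEw := E.ne_zero hw
  have hI := Complex.I_ne_zero
  field_simp
  ring

end Space

/-- The reproducing kernel is locally bounded. -/
theorem exists_norm_kernelFun_le (E : HermiteBiehler) (w₀ : ℂ) {r : ℝ} (hr : 2 ≤ r) :
    ∃ M : ℝ, 0 ≤ M ∧ ∀ w ∈ Metric.ball w₀ 1, ∀ z ∈ Metric.closedBall (conj w₀) r,
      ‖E.kernelFun w z‖ ≤ M := by
  have hr0 : 0 ≤ r := by linarith
  have hrne : r ≠ 0 := by linarith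
  have hcont : Continuous E := E.differentiable.continuous
  have hcs : Continuous (starFun E) := E.differentiable.starFun.continuous
  obtain ⟨A, hA⟩ := (isCompact_closedBall w₀ 1).exists_bound_of_continuousOn hcont.continuousOn
  obtain ⟨A', hA'⟩ := (isCompact_closedBall w₀ 1).exists_bound_of_continuousOn
    (hcont.comp Complex.continuous_conj).continuousOn
  obtain ⟨B, hB⟩ := (isCompact_closedBall (conj w₀) r).exists_bound_of_continuousOn
    hcont.continuousOn
  obtain ⟨B', hB'⟩ := (isCompact_closedBall (conj w₀) r).exists_bound_of_continuousOn
    hcs.continuousOn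
  have hA0 : 0 ≤ A := (norm_nonneg _).trans (hA w₀ (by simp))
  have hA0' : 0 ≤ A' := (norm_nonneg _).trans (hA' w₀ (by simp))
  have hB0 : 0 ≤ B := (norm_nonneg _).trans (hB (conj w₀) (by simp [hr0]))
  have hB0' : 0 ≤ B' := (norm_nonneg _).trans (hB' (conj w₀) (by simp [hr0]))
  refine ⟨A * B + A' * B', by positivity, fun w hw z hz => ?_⟩
  have hwc := Metric.ball_subset_closedBall hw
  rw [← closure_ball _ hrne] at hz
  -- On the sphere of radius r ≥ 2 the denominator satisfies |conj w - x| ≥ 1. The maximum principle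
  -- thus avoids the removable singularity at conj w.
  refine Complex.norm_le_of_forall_mem_frontier_norm_le Metric.isBounded_ball
    (E.differentiable_kernelFun w).diffContOnCl (fun x hx => ?_) hz
  rw [frontier_ball _ hrne] at hx
  have hxc := Metric.sphere_subset_closedBall hx
  have h1 := congrArg norm (E.kernelFun_mul w x)
  rw [norm_mul, norm_mul, norm_mul, norm_mul, Complex.norm_I, Complex.norm_real, Real.norm_eq_abs,
    abs_of_pos Real.pi_pos, RCLike.norm_ofNat, mul_one] at h1
  have h2 : ‖E.kernelNum w x‖ ≤ A * B + A' * B' := by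
    refine (norm_sub_le _ _).trans (add_le_add ?_ ?_)
    · rw [norm_mul, RCLike.norm_conj]
      exact mul_le_mul (hA w hwc) (hB x hxc) (norm_nonneg _) hA0
    · rw [norm_mul]
      exact mul_le_mul (hA' w hwc) (hB' x hxc) (norm_nonneg _) hA0'
  have h3 : 1 ≤ ‖conj w - x‖ := by
    have h4 := dist_triangle x (conj w) (conj w₀)
    have h5 : dist (conj w) (conj w₀) < 1 := by
      rw [dist_eq_norm, ← map_sub, RCLike.norm_conj, ← dist_eq_norm]
      exact hw
    rw [Metric.mem_sphere] at hx
    rw [← dist_eq_norm, dist_comm]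
    linarith
  rw [← h1] at h2
  refine le_trans ?_ h2
  refine le_mul_of_one_le_right (norm_nonneg _) ?_
  nlinarith [Real.pi_gt_three]

namespace Space

-- The formula at a + iy is passed to the limit y → 0. The kernels divided by E are dominated by a
-- fixed multiple of 1/|t - (a + i)|, which is square integrable.
open MeasureTheory Filter Topology in
theorem inner_kernel_ofReal (hE : ∀ x : ℝ, E x ≠ 0) (f : E.Space) (a : ℝ) :
    inner ℂ (E.kernel a) f = f a := by
  have hcont : Continuous E := E.differentiable.continuous
  set w : ℝ → ℂ := fun y => a + y * Complex.I with hw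
  have hw0 : Tendsto w (𝓝[>] 0) (𝓝 a) :=
    (Continuous.tendsto' (by fun_prop) _ _ (by simp [hw])).mono_left nhdsWithin_le_nhds
  have hlim1 : Tendsto (fun y => f (w y)) (𝓝[>] 0) (𝓝 (f a)) :=
    (f.2.1.continuous.tendsto _).comp hw0
  obtain ⟨M, hM0, hM⟩ := E.exists_norm_kernelFun_le a le_rfl
  obtain ⟨D, hD⟩ := (isCompact_closedBall (a : ℝ) 2).exists_bound_of_continuousOn
    (f := fun t : ℝ => (E t)⁻¹)
    ((hcont.comp Complex.continuous_ofReal).inv₀ hE).continuousOn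
  have hD0 : 0 ≤ D := (norm_nonneg _).trans (hD a (by simp))
  obtain ⟨C, hC⟩ := (isCompact_closedBall (a : ℂ) 1).exists_bound_of_continuousOn
    hcont.continuousOn
  have hC0 : 0 ≤ C := (norm_nonneg _).trans (hC a (by simp))
  have hwball : ∀ y : ℝ, 0 < y → y < 1 → w y ∈ Metric.ball (a : ℂ) 1 := by
    intro y h0 h1
    rw [Metric.mem_ball, dist_eq_norm]
    simp [hw, abs_of_pos h0, h1]
  have hp : (a + Complex.I).im ≠ 0 := by simp
  have hbound : ∀ y : ℝ, 0 < y → y < 1 → ∀ t : ℝ, ‖E.kernelFun (w y) t / E t‖ ≤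
      (3 * (M * D) + 4 * C) * ‖((t : ℂ) - (a + Complex.I))⁻¹‖ := by
    intro y h0 h1 t
    have hne : 0 < ‖(t : ℂ) - (a + Complex.I)‖ := norm_pos_iff.2 (ofReal_sub_ne_zero hp t)
    rw [norm_inv, ← div_eq_mul_inv, le_div_iff₀ hne]
    have h2 : ‖(t : ℂ) - (a + Complex.I)‖ ≤ |t - a| + 1 := by
      have := norm_sub_le ((t - a : ℝ) : ℂ) Complex.I
      rw [Complex.norm_real, Complex.norm_I, Real.norm_eq_abs] at this
      rwa [show (t : ℂ) - (a + Complex.I) = ((t - a : ℝ) : ℂ) - Complex.I by push_cast; ring]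
    have hMD : 0 ≤ M * D := mul_nonneg hM0 hD0
    -- Near a the kernel is locally bounded and |t - (a + i)| ≤ 3. Farther away the decay of the
    -- kernel is used, with |t - (a + i)| ≤ |t - a| + 1 ≤ 2|t - a|.
    by_cases ht : |t - a| ≤ 2
    · have h3 : ‖E.kernelFun (w y) t / E t‖ ≤ M * D := by
        rw [div_eq_mul_inv, norm_mul]
        refine mul_le_mul (hM _ (hwball y h0 h1) t ?_) (hD t ?_) (norm_nonneg _) hM0
        · rw [Metric.mem_closedBall, Complex.conj_ofReal, dist_eq_norm, ← Complex.ofReal_sub,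
            Complex.norm_real]
          exact ht
        · rwa [Metric.mem_closedBall, Real.dist_eq]
      calc _ ≤ (M * D) * 3 := mul_le_mul h3 (by linarith) hne.le hMD
        _ ≤ _ := by linarith
    · push Not at ht
      have h3 := E.norm_kernelFun_div_le (w y) t (by simp)
      have h4 : |t - a| ≤ ‖conj (w y) - t‖ := by
        have := Complex.abs_re_le_norm (conj (w y) - t)
        simp only [hw, Complex.sub_re, Complex.conj_re, Complex.add_re, Complex.ofReal_re,
          Complex.re_ofReal_mul, Complex.I_re, mul_zero, add_zero] at this
        rwa [abs_sub_comm]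
      have h5 := hC (w y) (Metric.ball_subset_closedBall (hwball y h0 h1))
      have h6 := hC (conj (w y)) (by
        have := Metric.ball_subset_closedBall (hwball y h0 h1)
        rw [Metric.mem_closedBall, dist_eq_norm] at this ⊢
        rwa [← RCLike.norm_conj, map_sub, Complex.conj_conj, Complex.conj_ofReal])
      have h7 : ‖(t : ℂ) - (a + Complex.I)‖ ≤ 2 * ‖conj (w y) - t‖ := by linarith
      calc _ ≤ ‖E.kernelFun (w y) t / E t‖ * (2 * ‖conj (w y) - t‖) := by gcongr
        _ ≤ 4 * C := by linarith
        _ ≤ _ := by linarith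
  have hlim2 : Tendsto (fun y => inner ℂ (E.kernel (w y)) f) (𝓝[>] 0)
      (𝓝 (inner ℂ (E.kernel a) f)) := by
    have hev : ∀ᶠ y : ℝ in 𝓝[>] 0, 0 < y ∧ y < 1 := by
      filter_upwards [Ioo_mem_nhdsGT one_pos] with y hy using hy
    simp only [inner_eq]
    refine tendsto_integral_filter_of_dominated_convergence
      (fun t : ℝ => (3 * (M * D) + 4 * C) * ‖f t / E t * ((t : ℂ) - (a + Complex.I))⁻¹‖) ?_ ?_ ?_ ?_
    · exact Eventually.of_forall fun y => (integrable_inner (E.kernel (w y)) f).1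
    · filter_upwards [hev] with y hy
      refine Eventually.of_forall fun t => ?_
      have h1 := hbound y hy.1 hy.2 t
      have h2 : ‖f t * conj (E.kernel (w y) t) / ((‖E t‖ : ℂ) ^ 2)‖ =
          ‖f t / E t‖ * ‖E.kernelFun (w y) t / E t‖ := by
        rw [norm_div, norm_mul, norm_div, norm_div, RCLike.norm_conj, norm_pow, Complex.norm_real,
          norm_norm, kernel_apply]
        ring
      rw [h2, norm_mul]
      calc _ ≤ ‖f t / E t‖ * ((3 * (M * D) + 4 * C) * ‖((t : ℂ) - (a + Complex.I))⁻¹‖) := by gcongr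
        _ = _ := by ring
    · exact (integrable_mul_inv_sub f.2.2.1 hp).norm.const_mul _
    · have hae : ∀ᵐ t : ℝ, t ≠ a := by
        simp [ae_iff]
      filter_upwards [hae] with t ht
      refine Tendsto.div_const (Tendsto.const_mul _ ((Complex.continuous_conj.tendsto _).comp ?_)) _
      have hta : (t : ℂ) ≠ conj (a : ℂ) := by
        rw [Complex.conj_ofReal]; exact_mod_cast ht
      simp only [kernel_apply]
      have hval : E.kernelFun a t = E.kernelNum a t /
          (2 * Real.pi * Complex.I * (conj (a : ℂ) - t)) := if_neg hta
      have hval' : ∀ᶠ y in 𝓝[>] (0 : ℝ), E.kernelNum (w y) t /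
          (2 * Real.pi * Complex.I * (conj (w y) - t)) = E.kernelFun (w y) t := by
        filter_upwards [self_mem_nhdsWithin] with y hy
        refine (if_neg fun h => ?_).symm
        have h1 := congrArg Complex.im h
        have h2 : (0 : ℝ) < y := hy
        simp [hw] at h1
        exact h2.ne' h1
      rw [hval]
      refine Tendsto.congr' hval' ?_
      have hpi : (Real.pi : ℂ) ≠ 0 := by exact_mod_cast Real.pi_ne_zero
      have hd : 2 * Real.pi * Complex.I * (conj (a : ℂ) - t) ≠ 0 := by
        simp [hpi, sub_ne_zero]
        exact fun h => ht h.symm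
      have hc : ContinuousAt (fun x : ℂ => E.kernelNum x t /
          (2 * Real.pi * Complex.I * (conj x - t))) a := by
        refine ContinuousAt.div ?_ ?_ hd
        · unfold kernelNum
          have h1 : Continuous fun x : ℂ => conj (E x) := Complex.continuous_conj.comp hcont
          have h2 : Continuous fun x : ℂ => E (conj x) := hcont.comp Complex.continuous_conj
          fun_prop
        · have := Complex.continuous_conj
          fun_prop
      exact hc.tendsto.comp hw0
  refine tendsto_nhds_unique hlim2 (hlim1.congr' ?_)
  filter_upwards [self_mem_nhdsWithin] with y hy
  refine (inner_kernel_of_mem_upperHalf hE f ?_).symm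
  have : (0 : ℝ) < y := hy
  change 0 < (w y).im
  simpa [hw]

/-- The reproducing property of the kernel. -/
theorem inner_kernel (hE : ∀ x : ℝ, E x ≠ 0) (f : E.Space) (w : ℂ) :
    inner ℂ (E.kernel w) f = f w := by
  rcases lt_trichotomy w.im 0 with h | h | h
  · have h1 := inner_kernel_of_mem_upperHalf hE f.conjStar (w := conj w)
      (show 0 < (conj w).im by simpa)
    rw [← conjStar_kernel, inner_conjStar, conjStar_apply, Complex.conj_conj] at h1
    exact (starRingEnd ℂ).injective h1
  · have : w = (w.re : ℂ) := Complex.ext (by simp) (by simp [h])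
    rw [this]
    exact inner_kernel_ofReal hE f _
  · exact inner_kernel_of_mem_upperHalf hE f h

theorem norm_kernel_sq (hE : ∀ x : ℝ, E x ≠ 0) (w : ℂ) :
    ((‖E.kernel w‖ ^ 2 : ℝ) : ℂ) = E.kernelFun w w := by
  have h := inner_kernel hE (E.kernel w) w
  rw [inner_self_eq_norm_sq_to_K] at h
  rw [← kernel_apply, ← h]
  push_cast
  rfl

theorem norm_apply_le (hE : ∀ x : ℝ, E x ≠ 0) (f : E.Space) (w : ℂ) :
    ‖f w‖ ≤ ‖E.kernel w‖ * ‖f‖ := by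
  rw [← inner_kernel hE f w]
  exact norm_inner_le_norm _ _

/-- The norms of the kernel functions are locally bounded. -/
theorem exists_norm_kernel_le (hE : ∀ x : ℝ, E x ≠ 0) (w₀ : ℂ) :
    ∃ M : ℝ, 0 ≤ M ∧ ∀ w ∈ Metric.ball w₀ 1, ‖E.kernel w‖ ≤ M := by
  obtain ⟨M, hM0, hM⟩ := E.exists_norm_kernelFun_le w₀
    (show 2 ≤ 2 + dist w₀ (conj w₀) by linarith [dist_nonneg (x := w₀) (y := conj w₀)])
  refine ⟨√M, Real.sqrt_nonneg _, fun w hw => ?_⟩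
  refine Real.le_sqrt_of_sq_le ?_
  have h1 := hM w hw w (by
    rw [Metric.mem_ball] at hw
    rw [Metric.mem_closedBall]
    linarith [dist_triangle w w₀ (conj w₀)])
  rw [← norm_kernel_sq hE, Complex.norm_real, Real.norm_eq_abs, abs_of_nonneg (by positivity)] at h1
  exact h1

end Space

end HermiteBiehler

/-! ### Completeness of H(E) -/

open MeasureTheory in
theorem sqrt_integral_norm_sq_eq {g : ℝ → ℂ} (hg : MemLp g 2) :
    √(∫ t : ℝ, ‖g t‖ ^ 2) = (eLpNorm g 2 volume).toReal := by
  rw [hg.eLpNorm_eq_integral_rpow_norm two_ne_zero ENNReal.ofNat_ne_top,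
    ENNReal.toReal_ofReal (by positivity), Real.sqrt_eq_rpow]
  norm_num

open MeasureTheory Filter Topology in
/-- Limits of functions of the Hardy class, pointwise in the upper half-plane and in the mean on the
real line, are of bounded type and of nonpositive mean type. -/
theorem isBoundedType_of_tendsto_isHardy {g : ℂ → ℂ} {v : ℕ → ℂ → ℂ} (hv : ∀ n, IsHardy (v n))
    (hg : MemLp (fun t : ℝ => g t) 2)
    (hlim : ∀ w ∈ upperHalf, Tendsto (fun n => v n w) atTop (𝓝 (g w)))
    (hL : Tendsto (fun n => eLpNorm (fun t : ℝ => v n t - g t) 2 volume) atTop (𝓝 0)) :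
    IsBoundedType g ∧ meanType g ≤ 0 := by
  have hpi : (2 * Real.pi * Complex.I : ℂ) ≠ 0 := by
    simp [Real.pi_ne_zero]
  -- Both sides of Cauchy's formula pass to the limit, so g is the Cauchy transform of its own
  -- boundary values.
  have key : ∀ w ∈ upperHalf, g w =
      (2 * Real.pi * Complex.I)⁻¹ * ∫ t : ℝ, g t * ((t : ℂ) - w)⁻¹ := by
    intro w hw
    have hw' : 0 < w.im := hw
    rw [eq_inv_mul_iff_mul_eq₀ hpi]
    refine tendsto_nhds_unique ((hlim w hw).const_mul _) ?_
    rw [tendsto_iff_norm_sub_tendsto_zero]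
    have hL' := ((ENNReal.tendsto_toReal ENNReal.zero_ne_top).comp hL).mul_const
      √(Real.pi / |w.im|)
    rw [ENNReal.toReal_zero, zero_mul] at hL'
    refine squeeze_zero (fun n => norm_nonneg _) (fun n => ?_) hL'
    have hd : MemLp (fun t : ℝ => v n t - g t) 2 := (hv n).memLp.sub hg
    have h1 := norm_integral_mul_inv_sub_le hd hw'.ne'
    rw [sqrt_integral_norm_sq_eq hd] at h1
    refine le_trans (le_of_eq ?_) h1
    have j := integral_sub (integrable_mul_inv_sub (hv n).memLp hw'.ne')
      (integrable_mul_inv_sub hg hw'.ne')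
    rw [← (hv n).integral_mul_inv_sub hw, ← j]
    simp only [sub_mul]
  refine ⟨((isBoundedType_cauchyTransform hg).const_mul _).congr key,
    meanType_nonpos_of_le (meanType_const_mul_nonpos (meanType_cauchyTransform_nonpos hg)
      (2 * Real.pi * Complex.I)⁻¹) (A := 1) (B := 0) zero_le_one le_rfl ?_⟩
  filter_upwards [eventually_gt_atTop 0] with y hy
  rw [one_mul, add_zero, key _ (show 0 < ((y : ℂ) * Complex.I).im by simpa)]

namespace HermiteBiehler

variable {E F : HermiteBiehler}

namespace Space

theorem norm_sq_eq (f : E.Space) : ‖f‖ ^ 2 = ∫ t : ℝ, ‖f t / E t‖ ^ 2 := by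
  have h := inner_self_eq_norm_sq_to_K (𝕜 := ℂ) f
  rw [inner_self] at h
  refine Complex.ofReal_injective ?_
  rw [h]
  push_cast
  rfl

theorem norm_eq_sqrt (f : E.Space) : ‖f‖ = √(∫ t : ℝ, ‖f t / E t‖ ^ 2) := by
  rw [← norm_sq_eq, Real.sqrt_sq (norm_nonneg _)]

theorem sub_apply (f g : E.Space) (z : ℂ) : (f - g) z = f z - g z := rfl

open MeasureTheory in
theorem eLpNorm_sub_div (f g : E.Space) :
    eLpNorm (fun t : ℝ => f t / E t - g t / E t) 2 volume = ENNReal.ofReal ‖f - g‖ := by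
  have h : (fun t : ℝ => f t / E t - g t / E t) = fun t : ℝ => (f - g) t / E t := by
    funext t
    rw [sub_apply, sub_div]
  rw [h, norm_eq_sqrt, sqrt_integral_norm_sq_eq (f - g).2.2.1,
    ENNReal.ofReal_toReal (f - g).2.2.1.2.ne]

-- The kernel norms are locally bounded, so norm-Cauchy sequences converge locally uniformly and the
-- limit is entire; Fatou's lemma gives convergence in norm. Bounded type and mean type do not pass
-- to pointwise limits by themselves: they come from the Cauchy representation of g/E and g*/E.
open MeasureTheory Filter Topology in
theorem completeSpace (hE : ∀ x : ℝ, E x ≠ 0) : CompleteSpace E.Space := by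
  refine Metric.complete_of_cauchySeq_tendsto fun u hu => ?_
  have hd : ∀ ε > 0, ∃ N, ∀ n ≥ N, ∀ m ≥ N, ‖u n - u m‖ ≤ ε := fun ε hε => by
    obtain ⟨N, hN⟩ := Metric.cauchySeq_iff.1 hu ε hε
    exact ⟨N, fun n hn m hm => by rw [← dist_eq_norm]; exact (hN n hn m hm).le⟩
  have hpt : ∀ w n m, ‖u n w - u m w‖ ≤ ‖E.kernel w‖ * ‖u n - u m‖ := fun w n m =>
    norm_apply_le hE (u n - u m) w
  have hex : ∀ w, ∃ a, Tendsto (fun n => u n w) atTop (𝓝 a) := fun w => by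
    refine cauchySeq_tendsto_of_complete (Metric.cauchySeq_iff.2 fun ε hε => ?_)
    obtain ⟨N, hN⟩ := hd (ε / (‖E.kernel w‖ + 1)) (by positivity)
    refine ⟨N, fun n hn m hm => ?_⟩
    rw [dist_eq_norm]
    refine (hpt w n m).trans_lt ?_
    calc _ ≤ ‖E.kernel w‖ * (ε / (‖E.kernel w‖ + 1)) := by gcongr; exact hN n hn m hm
      _ < (‖E.kernel w‖ + 1) * (ε / (‖E.kernel w‖ + 1)) := by gcongr; linarith
      _ = ε := by field_simp
  choose g hg using hex
  have hunif : ∀ ε > 0, ∃ N, ∀ n ≥ N, ∀ w, ‖g w - u n w‖ ≤ ‖E.kernel w‖ * ε := fun ε hε => by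
    obtain ⟨N, hN⟩ := hd ε hε
    refine ⟨N, fun n hn w => le_of_tendsto ((hg w).sub_const (u n w)).norm ?_⟩
    filter_upwards [eventually_ge_atTop N] with m hm
    exact (hpt w m n).trans (by gcongr; exact hN m hm n hn)
  have hgd : Differentiable ℂ g := by
    rw [← differentiableOn_univ]
    refine TendstoLocallyUniformlyOn.differentiableOn (F := fun n z => u n z) (φ := atTop)
      (Metric.tendstoLocallyUniformlyOn_iff.2 fun ε hε w₀ _ => ?_)
      (Eventually.of_forall fun n => (u n).2.1.differentiableOn) isOpen_univ
    obtain ⟨M, hM0, hM⟩ := exists_norm_kernel_le hE w₀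
    refine ⟨Metric.ball w₀ 1, mem_nhdsWithin_of_mem_nhds (Metric.ball_mem_nhds _ one_pos), ?_⟩
    obtain ⟨N, hN⟩ := hunif (ε / (M + 1)) (by positivity)
    filter_upwards [eventually_ge_atTop N] with n hn w hw
    rw [dist_eq_norm]
    refine (hN n hn w).trans_lt ?_
    calc _ ≤ M * (ε / (M + 1)) := by gcongr; exact hM w hw
      _ < (M + 1) * (ε / (M + 1)) := by gcongr; linarith
      _ = ε := by field_simp
  have hmeas : ∀ {f : ℂ → ℂ}, Continuous f → AEStronglyMeasurable (fun t : ℝ => f t / E t) :=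
    fun hf => (E.measurable_div hf).aestronglyMeasurable
  have hfatou : ∀ ε > 0, ∃ N, ∀ n ≥ N,
      eLpNorm (fun t : ℝ => u n t / E t - g t / E t) 2 volume ≤ ENNReal.ofReal ε := fun ε hε => by
    obtain ⟨N, hN⟩ := hd ε hε
    refine ⟨N, fun n hn => (Lp.eLpNorm_lim_le_liminf_eLpNorm
      (f := fun m (t : ℝ) => u n t / E t - u m t / E t)
      (fun m => (hmeas (u n).2.1.continuous).sub (hmeas (u m).2.1.continuous)) _
      (Eventually.of_forall fun t => ((hg t).div_const (E t)).const_sub _)).trans ?_⟩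
    refine liminf_le_of_frequently_le' (Eventually.frequently ?_)
    filter_upwards [eventually_ge_atTop N] with m hm
    rw [eLpNorm_sub_div]
    exact ENNReal.ofReal_le_ofReal (hN n hn m hm)
  have hL : Tendsto (fun n => eLpNorm (fun t : ℝ => u n t / E t - g t / E t) 2 volume) atTop
      (𝓝 0) := by
    refine ENNReal.tendsto_atTop_zero.2 fun ε hε => ?_
    rcases eq_or_ne ε ⊤ with rfl | hε'
    · exact ⟨0, fun _ _ => le_top⟩
    · obtain ⟨N, hN⟩ := hfatou ε.toReal (ENNReal.toReal_pos hε.ne' hε')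
      exact ⟨N, fun n hn => (hN n hn).trans (ENNReal.ofReal_toReal hε').le⟩
  have hgL : MemLp (fun t : ℝ => g t / E t) 2 := by
    obtain ⟨N, hN⟩ := hfatou 1 one_pos
    have h1 : MemLp (fun t : ℝ => u N t / E t - g t / E t) 2 :=
      ⟨(hmeas (u N).2.1.continuous).sub (hmeas hgd.continuous),
        (hN N le_rfl).trans_lt ENNReal.ofReal_lt_top⟩
    have h2 := (u N).2.2.1.sub h1
    refine h2.congr_norm (hmeas hgd.continuous) (Eventually.of_forall fun t => ?_)
    simp
  have hgstarL : MemLp (fun t : ℝ => starFun g t / E t) 2 := by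
    refine hgL.congr_norm (hmeas hgd.starFun.continuous) (Eventually.of_forall fun t => ?_)
    rw [starFun_ofReal, norm_div, norm_div, RCLike.norm_conj]
  obtain ⟨b1, m1⟩ := isBoundedType_of_tendsto_isHardy (g := fun z => g z / E z)
    (fun n => isHardy_div hE (u n)) hgL (fun w _ => (hg w).div_const _) hL
  obtain ⟨b2, m2⟩ := isBoundedType_of_tendsto_isHardy (g := fun z => starFun g z / E z)
    (fun n => isHardy_div hE (u n).conjStar) hgstarL
    (fun w _ => ((Complex.continuous_conj.tendsto _).comp (hg (conj w))).div_const _) (by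
      refine hL.congr fun n => eLpNorm_congr_norm_ae (Eventually.of_forall fun t => ?_)
      rw [conjStar_ofReal, starFun_ofReal, ← sub_div, ← sub_div, norm_div, norm_div, ← map_sub,
        RCLike.norm_conj])
  let G : E.Space := ⟨g, hgd, hgL, b1, m1, b2, m2⟩
  refine ⟨G, tendsto_iff_norm_sub_tendsto_zero.2 ?_⟩
  have h0 := (ENNReal.tendsto_toReal ENNReal.zero_ne_top).comp hL
  refine h0.congr fun n => ?_
  have h1 := eLpNorm_sub_div (u n) G
  rw [Function.comp_apply, ← ENNReal.toReal_ofReal (norm_nonneg (u n - G)), ← h1]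

end Space

end HermiteBiehler

/-! ### The orthogonal decomposition of H(EF) -/

namespace HermiteBiehler

variable {E F : HermiteBiehler}

theorem norm_starFun_div_le (E : HermiteBiehler) {z : ℂ} (hz : z ∈ upperHalf) :
    ‖starFun E z / E z‖ ≤ 1 := by
  rw [norm_div, starFun, RCLike.norm_conj]
  exact div_le_one_of_le₀ (E.norm_conj_lt' z hz).le (norm_nonneg _)

theorem isBoundedType_starFun_div (E : HermiteBiehler) :
    IsBoundedType (fun z => starFun E z / E z) :=
  IsBoundedType.of_bounded (E.differentiable.starFun.differentiableOn.div
    E.differentiable.differentiableOn fun _ hz => E.ne_zero hz) fun _ hz => E.norm_starFun_div_le hz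

theorem norm_starFun_ofReal (f : ℂ → ℂ) (t : ℝ) : ‖starFun f t‖ = ‖f t‖ := by
  rw [starFun_ofReal, RCLike.norm_conj]

theorem meanType_mul_starFun_div {u : ℂ → ℂ} (hu : meanType u ≤ 0) (F : HermiteBiehler) :
    meanType (fun z => u z * (starFun F z / F z)) ≤ 0 := by
  refine meanType_nonpos_of_le hu (A := 1) (B := 0) zero_le_one le_rfl ?_
  filter_upwards [Filter.eventually_gt_atTop 0] with y hy
  rw [norm_mul, one_mul, add_zero]
  exact mul_le_of_le_one_right (norm_nonneg _)
    (F.norm_starFun_div_le (show 0 < ((y : ℂ) * Complex.I).im by simpa))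

theorem meanType_congr {f g : ℂ → ℂ} (hg : meanType g ≤ 0)
    (h : ∀ z ∈ upperHalf, f z = g z) : meanType f ≤ 0 := by
  refine meanType_nonpos_of_le hg (A := 1) (B := 0) zero_le_one le_rfl ?_
  filter_upwards [Filter.eventually_gt_atTop 0] with y hy
  rw [one_mul, add_zero, h _ (show 0 < ((y : ℂ) * Complex.I).im by simpa)]

theorem starFun_mul (f g : ℂ → ℂ) (z : ℂ) :
    starFun (fun z => f z * g z) z = starFun f z * starFun g z := by
  simp [starFun]

/-- Multiplication by `F` maps `H(E)` into `H(EF)`. -/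
theorem mul_mem_deBrangesSubmodule (hF : ∀ x : ℝ, F x ≠ 0) (f : E.Space) :
    (fun z => f z * F z) ∈ (E * F).deBrangesSubmodule := by
  have h1 : ∀ z ∈ upperHalf, f z * F z / (E * F) z = f z / E z := fun z hz => by
    rw [mul_apply, mul_div_mul_right _ _ (F.ne_zero hz)]
  have h2 : ∀ z ∈ upperHalf, starFun (fun z => f z * F z) z / (E * F) z =
      starFun f z / E z * (starFun F z / F z) := fun z _ => by
    rw [mul_apply, starFun_mul, mul_div_mul_comm]
  refine ⟨f.2.1.mul F.differentiable, f.2.2.1.ae_eq (Filter.Eventually.of_forall fun t => ?_),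
    f.2.2.2.1.congr h1, meanType_congr f.2.2.2.2.1 h1,
    (f.2.2.2.2.2.1.mul F.isBoundedType_starFun_div).congr h2,
    meanType_congr (meanType_mul_starFun_div f.2.2.2.2.2.2 F) h2⟩
  simp only [mul_apply]
  rw [mul_div_mul_right _ _ (hF t)]

/-- Multiplication by `E*` maps `H(F)` into `H(EF)`. -/
theorem mul_starFun_mem_deBrangesSubmodule (hE : ∀ x : ℝ, E x ≠ 0) (g : F.Space) :
    (fun z => g z * starFun E z) ∈ (E * F).deBrangesSubmodule := by
  have h1 : ∀ z ∈ upperHalf, g z * starFun E z / (E * F) z =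
      g z / F z * (starFun E z / E z) := fun z _ => by
    rw [mul_apply, mul_comm (E z), mul_div_mul_comm]
  have h2 : ∀ z ∈ upperHalf, starFun (fun z => g z * starFun E z) z / (E * F) z =
      starFun g z / F z := fun z hz => by
    rw [mul_apply, starFun_mul, starFun_starFun, mul_comm (E z),
      mul_div_mul_right _ _ (E.ne_zero hz)]
  have hd : Differentiable ℂ fun z => g z * starFun E z := g.2.1.mul E.differentiable.starFun
  refine ⟨hd, g.2.2.1.congr_norm ((E * F).measurable_div hd.continuous).aestronglyMeasurable
      (Filter.Eventually.of_forall fun t => ?_),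
    (g.2.2.2.1.mul E.isBoundedType_starFun_div).congr h1,
    meanType_congr (meanType_mul_starFun_div g.2.2.2.2.1 E) h1,
    g.2.2.2.2.2.1.congr h2, meanType_congr g.2.2.2.2.2.2 h2⟩
  rw [mul_apply, norm_div, norm_div, norm_mul, norm_mul, norm_starFun_ofReal, mul_comm ‖E t‖,
    mul_div_mul_right _ _ (norm_ne_zero_iff.2 (hE t))]

/-- The isometry `f ↦ f F` of `H(E)` into `H(EF)`. -/
noncomputable def mulRight (E F : HermiteBiehler) (hF : ∀ x : ℝ, F x ≠ 0) :
    E.Space →ₗᵢ[ℂ] (E * F).Space where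
  toFun f := ⟨fun z => f z * F z, mul_mem_deBrangesSubmodule hF f⟩
  map_add' f g := Space.ext fun z => add_mul (f z) (g z) (F z)
  map_smul' c f := Space.ext fun z => mul_assoc c (f z) (F z)
  norm_map' f := by
    rw [Space.norm_eq_sqrt, Space.norm_eq_sqrt]
    congr 2
    funext t
    change ‖f t * F t / (E t * F t)‖ ^ 2 = _
    rw [mul_div_mul_right _ _ (hF t)]

/-- The isometry `g ↦ g E*` of `H(F)` into `H(EF)`. -/
noncomputable def mulStar (E F : HermiteBiehler) (hE : ∀ x : ℝ, E x ≠ 0) :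
    F.Space →ₗᵢ[ℂ] (E * F).Space where
  toFun g := ⟨fun z => g z * starFun E z, mul_starFun_mem_deBrangesSubmodule hE g⟩
  map_add' f g := Space.ext fun z => add_mul (f z) (g z) (starFun E z)
  map_smul' c f := Space.ext fun z => mul_assoc c (f z) (starFun E z)
  norm_map' g := by
    rw [Space.norm_eq_sqrt, Space.norm_eq_sqrt]
    congr 2
    funext t
    change ‖g t * starFun E t / (E t * F t)‖ ^ 2 = _
    rw [norm_div, norm_div, norm_mul, norm_mul, norm_starFun_ofReal, mul_comm ‖E t‖,
      mul_div_mul_right _ _ (norm_ne_zero_iff.2 (hE t))]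

theorem mulRight_apply (hF : ∀ x : ℝ, F x ≠ 0) (f : E.Space) (z : ℂ) :
    E.mulRight F hF f z = f z * F z := rfl

theorem mulStar_apply (hE : ∀ x : ℝ, E x ≠ 0) (g : F.Space) (z : ℂ) :
    E.mulStar F hE g z = g z * starFun E z := rfl

/-- On the real line the integrand is (f*/E)(g/F), a product of two Hardy functions. -/
theorem inner_mulRight_mulStar (hE : ∀ x : ℝ, E x ≠ 0) (hF : ∀ x : ℝ, F x ≠ 0) (f : E.Space)
    (g : F.Space) : inner ℂ (E.mulRight F hF f) (E.mulStar F hE g) = 0 := by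
  rw [Space.inner_eq, ← (Space.isHardy_div hE f.conjStar).integral_mul_eq_zero
    (Space.isHardy_div hF g)]
  congr 1
  funext t
  have h1 := hE t
  have h2 := hF t
  have h3 : conj (E t) ≠ 0 := (map_ne_zero _).2 h1
  have h4 : conj (F t) ≠ 0 := (map_ne_zero _).2 h2
  rw [← Complex.mul_conj', mulRight_apply, mulStar_apply, starFun_ofReal, Space.conjStar_ofReal,
    mul_apply, map_mul, map_mul]
  field_simp

/-- Add and subtract conj(F w) E(conj w) E*(z) F(z) in the numerator of the kernel of E F. The point
z = conj w follows by continuity. -/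
theorem kernelFun_mul_eq (E F : HermiteBiehler) (w z : ℂ) :
    (E * F).kernelFun w z = conj (F w) * (E.kernelFun w z * F z) +
      E (conj w) * (F.kernelFun w z * starFun E z) := by
  revert z
  refine congrFun (Continuous.ext_on (dense_compl_singleton (conj w))
    ((E * F).differentiable_kernelFun w).continuous ?_ fun z hz => ?_)
  · have h1 := (E.differentiable_kernelFun w).continuous
    have h2 := (F.differentiable_kernelFun w).continuous
    have h3 := F.differentiable.continuous
    have h4 := E.differentiable.starFun.continuous
    fun_prop
  · have hpi : (Real.pi : ℂ) ≠ 0 := by exact_mod_cast Real.pi_ne_zero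
    have hne : 2 * Real.pi * Complex.I * (conj w - z) ≠ 0 := by
      simp only [ne_eq, mul_eq_zero, hpi, Complex.I_ne_zero, sub_eq_zero, not_or]
      exact ⟨by norm_num, fun h => hz h.symm⟩
    refine mul_right_cancel₀ hne ?_
    have h1 := E.kernelFun_mul w z
    have h2 := F.kernelFun_mul w z
    have h3 := (E * F).kernelFun_mul w z
    have h4 : starFun (E * F).toFun z = starFun E z * starFun F z := starFun_mul E F z
    rw [h3, add_mul]
    simp only [kernelNum] at h1 h2 ⊢
    rw [h4, mul_apply, mul_apply, mul_apply, map_mul]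
    linear_combination (-conj (F w) * F z) * h1 - (E (conj w) * starFun E z) * h2

theorem kernel_mul_eq (hE : ∀ x : ℝ, E x ≠ 0) (hF : ∀ x : ℝ, F x ≠ 0) (w : ℂ) :
    (E * F).kernel w = conj (F w) • E.mulRight F hF (E.kernel w) +
      E (conj w) • E.mulStar F hE (F.kernel w) :=
  Space.ext fun z => kernelFun_mul_eq E F w z

theorem mul_ne_zero_ofReal (hE : ∀ x : ℝ, E x ≠ 0) (hF : ∀ x : ℝ, F x ≠ 0) (x : ℝ) :
    (E * F) x ≠ 0 := mul_ne_zero (hE x) (hF x)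

/-- `H(EF)` is the orthogonal sum of `H(E) F` and `H(F) E*`. -/
theorem orthogonal_range_mulRight (hE : ∀ x : ℝ, E x ≠ 0) (hF : ∀ x : ℝ, F x ≠ 0) :
    (LinearMap.range (E.mulRight F hF).toLinearMap)ᗮ =
      LinearMap.range (E.mulStar F hE).toLinearMap := by
  have : CompleteSpace F.Space := Space.completeSpace hF
  have : CompleteSpace (E * F).Space := Space.completeSpace (mul_ne_zero_ofReal hE hF)
  ext h
  rw [Submodule.mem_orthogonal]
  constructor
  · intro hh
    -- The witness is J* h. In ⟨K_EF(w, ·), h⟩ = h(w) the first term of the kernel identity drops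
    -- out, and the second is E*(w) times the value of J* h at w.
    refine ⟨ContinuousLinearMap.adjoint (E.mulStar F hE).toContinuousLinearMap h,
      Space.ext fun w => ?_⟩
    have hk : inner ℂ (E.mulRight F hF (E.kernel w)) h = 0 := hh _ ⟨_, rfl⟩
    change E.mulStar F hE _ w = _
    rw [mulStar_apply, ← Space.inner_kernel hF, ContinuousLinearMap.adjoint_inner_right,
      ← Space.inner_kernel (mul_ne_zero_ofReal hE hF) h w, kernel_mul_eq hE hF, inner_add_left,
      inner_smul_left, inner_smul_left, hk, mul_zero, zero_add, mul_comm]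
    rfl
  · rintro ⟨g, rfl⟩ _ ⟨f, rfl⟩
    exact inner_mulRight_mulStar hE hF f g

end HermiteBiehler

/-! ### A Liouville theorem and division of entire functions -/

/-- An entire function bounded by `C (1 + ‖z‖) / |Im z|` off the real line is constant. -/
theorem Differentiable.exists_const_of_norm_le_div_im {q : ℂ → ℂ} (hq : Differentiable ℂ q) {C : ℝ}
    (hC : 0 ≤ C) (h : ∀ z : ℂ, z.im ≠ 0 → ‖q z‖ ≤ C * (1 + ‖z‖) / |z.im|) :
    ∃ c, ∀ z, q z = c := by
  -- On the circle of radius R the factor R² - z² has modulus 2R|Im z|, which cancels the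
  -- singularity of the bound on the real line.
  have hb : ∀ R : ℝ, 1 ≤ R → ∀ z : ℂ, ‖z‖ ≤ R →
      ‖q z * ((R : ℂ) ^ 2 - z ^ 2)‖ ≤ 2 * R * (C * (1 + R)) := by
    intro R hR z hz
    have hd : Differentiable ℂ fun z => q z * ((R : ℂ) ^ 2 - z ^ 2) := by fun_prop
    have hR0 : R ≠ 0 := by linarith
    refine Complex.norm_le_of_forall_mem_frontier_norm_le (U := Metric.ball 0 R)
      (f := fun z => q z * ((R : ℂ) ^ 2 - z ^ 2)) Metric.isBounded_ball hd.diffContOnCl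
      (fun x hx => ?_) (by rw [closure_ball _ hR0]; simpa using hz)
    rw [frontier_ball _ hR0, mem_sphere_zero_iff_norm] at hx
    rw [norm_mul, norm_sq_sub_sq_of_norm_eq hx]
    by_cases him : x.im = 0
    · rw [him, abs_zero, mul_zero, mul_zero]; positivity
    · have h1 := h x him
      rw [le_div_iff₀ (abs_pos.2 him), hx] at h1
      nlinarith
  refine hq.exists_const_forall_eq_of_bounded (isBounded_iff_forall_norm_le.2 ⟨8 * C, ?_⟩)
  rintro _ ⟨z, rfl⟩
  -- With R about twice |z| the factor R² - z² is comparable to R², so dividing by it leaves a bound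
  -- independent of z.
  have h1 := hb (2 * (1 + ‖z‖)) (by linarith [norm_nonneg z]) z (by linarith [norm_nonneg z])
  set R := 2 * (1 + ‖z‖) with hR
  have hzR : ‖z‖ = R / 2 - 1 := by rw [hR]; ring
  have hR2 : 2 ≤ R := by linarith [norm_nonneg z]
  have h2 : 3 / 4 * R ^ 2 ≤ ‖(R : ℂ) ^ 2 - z ^ 2‖ := by
    have := norm_sub_norm_le ((R : ℂ) ^ 2) (z ^ 2)
    rw [norm_pow, norm_pow, Complex.norm_real, Real.norm_eq_abs, sq_abs, hzR] at this
    nlinarith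
  rw [norm_mul] at h1
  have h3 := mul_le_mul_of_nonneg_left h2 (norm_nonneg (q z))
  have h4 : ‖q z‖ * (3 / 4 * R ^ 2) ≤ 4 * C * (3 / 4 * R ^ 2) := by
    nlinarith [mul_nonneg hC (mul_nonneg (show 0 ≤ R by linarith) (sub_nonneg.2 hR2))]
  have h5 := le_of_mul_le_mul_right h4 (by positivity)
  linarith

/-- Division of entire functions: simple zeros of `h` that are zeros of `f` cancel. -/
theorem exists_differentiable_eq_mul {f h : ℂ → ℂ} (hf : Differentiable ℂ f)
    (hh : Differentiable ℂ h) (hz : ∀ z, h z = 0 → f z = 0 ∧ deriv h z ≠ 0) :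
    ∃ q, Differentiable ℂ q ∧ ∀ z, f z = q z * h z := by
  classical
  -- Near a simple zero of h this is the quotient of the difference quotients of f and h.
  refine ⟨fun z => if h z = 0 then deriv f z / deriv h z else f z / h z, fun a => ?_, fun z => ?_⟩
  · by_cases ha : h a = 0
    · obtain ⟨hfa, hda⟩ := hz a ha
      have d : ∀ {g : ℂ → ℂ}, Differentiable ℂ g → Differentiable ℂ (dslope g a) := fun hg => by
        rw [← differentiableOn_univ, Complex.differentiableOn_dslope Filter.univ_mem]
        exact hg.differentiableOn
      have hne : dslope h a a ≠ 0 := by rwa [dslope_same]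
      refine ((d hf a).div (d hh a) hne).congr_of_eventuallyEq ?_
      filter_upwards [(d hh a).continuousAt.eventually_ne hne] with z hz'
      rw [Pi.div_apply]
      by_cases hza : z = a
      · rw [hza, if_pos ha, dslope_same, dslope_same]
      · rw [dslope_of_ne _ hza, dslope_of_ne _ hza, slope_def_field, slope_def_field, hfa, ha,
          sub_zero, sub_zero, div_div_div_cancel_right₀ (sub_ne_zero.2 hza), if_neg]
        intro hhz
        rw [dslope_of_ne _ hza, slope_def_field, ha, hhz, sub_zero, zero_div] at hz'
        exact hz' rfl
    · refine ((hf a).div (hh a) ha).congr_of_eventuallyEq ?_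
      filter_upwards [(hh a).continuousAt.eventually_ne ha] with z hz'
      rw [if_neg hz', Pi.div_apply]
  · dsimp only
    split_ifs with hz0
    · rw [hz0, mul_zero, (hz z hz0).1]
    · rw [div_mul_cancel₀ _ hz0]

theorem re_add_div_sub (a b : ℂ) : ((a + b) / (a - b)).re = (‖a‖ ^ 2 - ‖b‖ ^ 2) / ‖a - b‖ ^ 2 := by
  rw [Complex.div_re, ← Complex.normSq_eq_norm_sq, ← Complex.normSq_eq_norm_sq,
    ← Complex.normSq_eq_norm_sq, ← add_div, Complex.normSq_apply a, Complex.normSq_apply b]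
  congr 1
  simp only [Complex.add_re, Complex.sub_re, Complex.add_im, Complex.sub_im]
  ring

theorem norm_exp_I_mul (α : ℝ) : ‖Complex.exp (Complex.I * α)‖ = 1 := by
  rw [mul_comm]; exact Complex.norm_exp_ofReal_mul_I α

theorem norm_exp_neg_I_mul (α : ℝ) : ‖Complex.exp (-Complex.I * α)‖ = 1 := by
  have := norm_exp_I_mul (-α)
  rwa [Complex.ofReal_neg, mul_neg, ← neg_mul] at this

/-! ### The angle function and the orthonormal basis -/

namespace HermiteBiehler

variable {G : HermiteBiehler} {α : ℝ}

theorem differentiable_angleFun (G : HermiteBiehler) (α : ℝ) : Differentiable ℂ (G.angleFun α) :=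
  (G.differentiable.const_mul _).sub (G.differentiable.starFun.const_mul _)

theorem starFun_angleFun (G : HermiteBiehler) (α : ℝ) (z : ℂ) :
    conj (G.angleFun α (conj z)) = -G.angleFun α z := by
  simp only [angleFun, starFun, map_sub, map_mul, Complex.conj_conj, ← Complex.exp_conj, map_neg,
    Complex.conj_I, Complex.conj_ofReal, neg_neg]
  ring

/-- On the real line the function is 2i|G| sin(α - φ). -/
theorem angleFun_ofReal_eq_zero_iff (hG : ∀ x : ℝ, G x ≠ 0) {φ : ℝ → ℝ} (hφ : G.IsPhase φ)
    (x : ℝ) : G.angleFun α x = 0 ↔ ∃ n : ℤ, φ x = n * Real.pi + α := by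
  have hn : (‖G x‖ : ℂ) ≠ 0 := by exact_mod_cast norm_ne_zero_iff.2 (hG x)
  have h1 : G.angleFun α x = ‖G x‖ * (Complex.exp (Complex.I * (α - φ x)) -
      Complex.exp (-(Complex.I * (α - φ x)))) := by
    have h2 : conj (Complex.exp (-Complex.I * φ x)) = Complex.exp (Complex.I * φ x) := by
      rw [← Complex.exp_conj]
      simp
    rw [angleFun, starFun_ofReal, hφ.2.2 x]
    simp only [norm_mul, norm_exp_neg_I_mul, Complex.norm_real, norm_norm, mul_one, map_mul,
      Complex.conj_ofReal, h2]
    rw [show Complex.I * ((α : ℂ) - φ x) = Complex.I * α + -Complex.I * φ x by ring,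
      Complex.exp_add, show -(Complex.I * (α : ℂ) + -Complex.I * φ x) =
        -Complex.I * α + Complex.I * φ x by ring, Complex.exp_add]
    ring
  rw [h1, mul_eq_zero, or_iff_right hn, sub_eq_zero, Complex.exp_eq_exp_iff_exists_int]
  constructor
  · rintro ⟨n, hn⟩
    refine ⟨-n, ?_⟩
    have h3 : (α - φ x : ℂ) = n * Real.pi := by
      refine mul_left_cancel₀ (mul_ne_zero two_ne_zero Complex.I_ne_zero) ?_
      linear_combination hn
    have h4 : α - φ x = n * Real.pi := by exact_mod_cast h3
    push_cast
    linarith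
  · rintro ⟨n, hn⟩
    refine ⟨-n, ?_⟩
    rw [hn]
    push_cast
    ring

theorem angleFun_ne_zero {z : ℂ} (hz : z.im ≠ 0) : G.angleFun α z ≠ 0 := by
  intro h
  have h1 := congrArg norm (sub_eq_zero.1 h)
  rw [norm_mul, norm_mul, norm_exp_I_mul, norm_exp_neg_I_mul, one_mul, one_mul, starFun,
    RCLike.norm_conj] at h1
  rcases hz.lt_or_gt with h2 | h2
  · have h3 := G.norm_conj_lt' (conj z) (show 0 < (conj z).im by simpa)
    rw [Complex.conj_conj] at h3
    exact h3.ne h1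
  · exact (G.norm_conj_lt' z h2).ne' h1

/-- At a real zero x the values of G and G* differ by the factor e^{2iα}, so the two coefficients in
the numerator are in the ratio of those of h_α. Orthogonality of the kernels and simplicity of the
zeros both rest on this. -/
theorem kernelNum_eq_mul_angleFun {x : ℝ} (hx : G.angleFun α x = 0) (z : ℂ) :
    G.kernelNum x z = conj (G x) * Complex.exp (-Complex.I * α) * G.angleFun α z := by
  have h1 : Complex.exp (-Complex.I * α) * Complex.exp (Complex.I * α) = 1 := by
    rw [← Complex.exp_add]; simp
  have h2 := sub_eq_zero.1 hx
  rw [starFun_ofReal] at h2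
  rw [kernelNum, angleFun, Complex.conj_ofReal]
  linear_combination (-conj (G x) * G z + G x * starFun G z) * h1 -
    (Complex.exp (-Complex.I * α) * starFun G z) * h2

theorem kernel_ne_zero (hG : ∀ x : ℝ, G x ≠ 0) {x : ℝ} (hx : G.angleFun α x = 0) :
    G.kernel x ≠ 0 := by
  intro h
  have h1 := G.kernelFun_mul x Complex.I
  rw [← Space.kernel_apply, h, Space.zero_apply, zero_mul, kernelNum_eq_mul_angleFun hx] at h1
  have h2 : conj (G x) ≠ 0 := (map_ne_zero _).2 (hG x)
  exact mul_ne_zero (mul_ne_zero h2 (Complex.exp_ne_zero _))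
    (angleFun_ne_zero (by simp)) h1.symm

/-- The squared norm of the kernel at x is a multiple of the derivative of h_α there, and the kernel
is not zero. -/
theorem deriv_angleFun_ne_zero (hG : ∀ x : ℝ, G x ≠ 0) {x : ℝ} (hx : G.angleFun α x = 0) :
    deriv (G.angleFun α) x ≠ 0 := by
  intro h
  refine kernel_ne_zero hG hx ?_
  have h1 := Space.norm_kernel_sq hG x
  have h2 : G.kernelNum x = fun z => conj (G x) * Complex.exp (-Complex.I * α) * G.angleFun α z :=
    funext (kernelNum_eq_mul_angleFun hx)
  rw [kernelFun, if_pos (Complex.conj_ofReal x).symm, h2, Complex.conj_ofReal,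
    deriv_const_mul _ (G.differentiable_angleFun α x), h] at h1
  simpa using h1

theorem inner_kernel_kernel_eq_zero (hG : ∀ x : ℝ, G x ≠ 0) {x y : ℝ} (hx : G.angleFun α x = 0)
    (hy : G.angleFun α y = 0) (hxy : x ≠ y) : inner ℂ (G.kernel x) (G.kernel y) = 0 := by
  rw [Space.inner_kernel hG, Space.kernel_apply]
  have h1 := G.kernelFun_mul y x
  rw [kernelNum_eq_mul_angleFun hy, hx, mul_zero, Complex.conj_ofReal] at h1
  refine (mul_eq_zero.1 h1).resolve_right ?_
  have h2 : (y : ℂ) - x ≠ 0 := by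
    rw [sub_ne_zero]; exact_mod_cast hxy.symm
  simp [Real.pi_ne_zero, h2]

theorem norm_kernel_sq_mul (hG : ∀ x : ℝ, G x ≠ 0) (z : ℂ) :
    ‖G.kernel z‖ ^ 2 * (4 * Real.pi * z.im) = ‖G z‖ ^ 2 - ‖G (conj z)‖ ^ 2 := by
  have h1 := G.kernelFun_mul z z
  rw [← Space.norm_kernel_sq hG, kernelNum, starFun, mul_comm (conj (G z)), Complex.mul_conj',
    Complex.mul_conj', show conj z - z = -(2 * z.im : ℝ) * Complex.I by
      linear_combination -Complex.sub_conj z] at h1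
  have h2 : ((‖G.kernel z‖ ^ 2 * (4 * Real.pi * z.im) : ℝ) : ℂ) =
      ((‖G z‖ ^ 2 - ‖G (conj z)‖ ^ 2 : ℝ) : ℂ) := by
    push_cast at h1 ⊢
    rw [← h1]
    linear_combination (4 * ‖G.kernel z‖ ^ 2 * Real.pi * z.im : ℂ) * Complex.I_sq
  exact Complex.ofReal_injective h2

/-- With a = e^{iα}G and b = e^{-iα}G*, the real part of (a + b)/(a - b) is 4π Im z
‖K_z‖²/|h_α(z)|², which is nonnegative. The Carathéodory growth bound therefore controls ‖K_z‖, and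
so every f, by h_α. -/
theorem exists_norm_le_mul_angleFun (hG : ∀ x : ℝ, G x ≠ 0) (α : ℝ) :
    ∃ C : ℝ, 0 ≤ C ∧ ∀ f : G.Space, ∀ z ∈ upperHalf,
      ‖f z‖ ≤ C * ‖f‖ * (1 + ‖z‖) / z.im * ‖G.angleFun α z‖ := by
  set a : ℂ → ℂ := fun z => Complex.exp (Complex.I * α) * G z with ha
  set b : ℂ → ℂ := fun z => Complex.exp (-Complex.I * α) * starFun G z with hb
  have had : Differentiable ℂ a := G.differentiable.const_mul _
  have hbd : Differentiable ℂ b := G.differentiable.starFun.const_mul _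
  have han : ∀ z, ‖a z‖ = ‖G z‖ := fun z => by rw [ha, norm_mul, norm_exp_I_mul, one_mul]
  have hbn : ∀ z, ‖b z‖ = ‖G (conj z)‖ := fun z => by
    rw [hb, norm_mul, norm_exp_neg_I_mul, one_mul, starFun, RCLike.norm_conj]
  have hh : ∀ z, a z - b z = G.angleFun α z := fun z => rfl
  have hne : ∀ z ∈ upperHalf, a z - b z ≠ 0 := fun z hz => by
    rw [hh]; exact angleFun_ne_zero (ne_of_gt hz)
  have hre : ∀ z, ((a z + b z) / (a z - b z)).re =
      ‖G.kernel z‖ ^ 2 * (4 * Real.pi * z.im) / ‖G.angleFun α z‖ ^ 2 := fun z => by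
    rw [re_add_div_sub, han, hbn, norm_kernel_sq_mul hG, hh]
  obtain ⟨C, hC, h⟩ := exists_norm_le_of_re_nonneg (S := fun z => (a z + b z) / (a z - b z))
    ((had.add hbd).differentiableOn.div (had.sub hbd).differentiableOn hne) fun z hz => by
      have hz' : 0 < z.im := hz
      rw [hre]
      positivity
  refine ⟨√(C / (4 * Real.pi)), Real.sqrt_nonneg _, fun f z hz => ?_⟩
  have hz' : 0 < z.im := hz
  have hpi := Real.pi_pos
  have hn : 0 < ‖G.angleFun α z‖ := norm_pos_iff.2 (angleFun_ne_zero hz'.ne')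
  have h1 := (Complex.re_le_norm _).trans (h z hz)
  simp only [hre] at h1
  rw [div_le_iff₀ (by positivity)] at h1
  have h2 : ‖G.kernel z‖ ≤ √(C / (4 * Real.pi)) * (1 + ‖z‖) / z.im * ‖G.angleFun α z‖ := by
    refine le_of_sq_le_sq ?_ (by positivity)
    rw [mul_pow, div_pow, mul_pow, Real.sq_sqrt (by positivity)]
    calc ‖G.kernel z‖ ^ 2 = ‖G.kernel z‖ ^ 2 * (4 * Real.pi * z.im) / (4 * Real.pi * z.im) := by
          field_simp
      _ ≤ C * ((1 + ‖z‖) ^ 2 / z.im) * ‖G.angleFun α z‖ ^ 2 / (4 * Real.pi * z.im) := by gcongr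
      _ = _ := by field_simp
  calc ‖f z‖ ≤ ‖G.kernel z‖ * ‖f‖ := Space.norm_apply_le hG f z
    _ ≤ √(C / (4 * Real.pi)) * (1 + ‖z‖) / z.im * ‖G.angleFun α z‖ * ‖f‖ := by gcongr
    _ = _ := by ring

/-- A function of the de Branges space that vanishes at the zeros of `e^{iα} G - e^{-iα} G*` is a
multiple of that function. -/
theorem exists_eq_const_mul_angleFun (hG : ∀ x : ℝ, G x ≠ 0) (f : G.Space)
    (hf : ∀ x : ℝ, G.angleFun α x = 0 → f x = 0) : ∃ c : ℂ, ∀ z, f z = c * G.angleFun α z := by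
  obtain ⟨q, hq, hfq⟩ := exists_differentiable_eq_mul f.2.1
    (G.differentiable_angleFun α) fun z hz => by
    have him : z.im = 0 := by
      by_contra him
      exact angleFun_ne_zero him hz
    obtain ⟨x, rfl⟩ : ∃ x : ℝ, z = x := ⟨z.re, Complex.ext (by simp) (by simp [him])⟩
    exact ⟨hf x hz, deriv_angleFun_ne_zero hG hz⟩
  obtain ⟨C, hC, h⟩ := exists_norm_le_mul_angleFun hG α
  have hfn : ‖f.conjStar‖ = ‖f‖ := by
    rw [Space.norm_eq_sqrt, Space.norm_eq_sqrt]
    congr 2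
    funext t
    rw [Space.conjStar_ofReal, norm_div, norm_div, RCLike.norm_conj]
  obtain ⟨c, hc⟩ := hq.exists_const_of_norm_le_div_im (C := C * ‖f‖) (by positivity) fun z hz => by
    have hn : 0 < ‖G.angleFun α z‖ := norm_pos_iff.2 (angleFun_ne_zero hz)
    refine le_of_mul_le_mul_right ?_ hn
    rw [← norm_mul, ← hfq]
    rcases hz.lt_or_gt with h2 | h2
    -- The lower half-plane is reached through f*, using that h_α* = -h_α.
    · have h3 := h f.conjStar (conj z) (show 0 < (conj z).im by simpa)
      rw [Space.conjStar_apply, Complex.conj_conj, RCLike.norm_conj, RCLike.norm_conj, hfn,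
        Complex.conj_im, ← abs_of_neg h2] at h3
      rwa [← RCLike.norm_conj (G.angleFun α (conj z)), starFun_angleFun, norm_neg] at h3
    · rw [abs_of_pos h2]
      exact h f z h2
  exact ⟨c, fun z => by rw [hfq, hc]⟩

/-- A form free of cases: if h_α is not in the space, the quantifier is vacuous. -/
theorem mem_angleSpace_iff (G : HermiteBiehler) (α : ℝ) (f : G.Space) : f ∈ G.angleSpace α ↔
    ∀ h : G.Space, (∀ z, h z = G.angleFun α z) → inner ℂ h f = 0 := by
  unfold angleSpace
  split_ifs with hm
  · refine Submodule.mem_orthogonal_singleton_iff_inner_right.trans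
      ⟨fun h1 h hh => ?_, fun h1 => h1 _ fun z => rfl⟩
    rwa [show h = ⟨_, hm⟩ from Space.ext hh]
  · refine ⟨fun _ h hh => (hm ?_).elim, fun _ => Submodule.mem_top⟩
    rw [← funext hh]
    exact h.2

theorem isClosed_angleSpace (G : HermiteBiehler) (α : ℝ) :
    IsClosed (G.angleSpace α : Set G.Space) := by
  unfold angleSpace
  split_ifs
  · exact Submodule.isClosed_orthogonal _
  · exact isClosed_univ

theorem kernel_mem_angleSpace (hG : ∀ x : ℝ, G x ≠ 0) {x : ℝ} (hx : G.angleFun α x = 0) :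
    G.kernel x ∈ G.angleSpace α := by
  rw [mem_angleSpace_iff]
  intro h hh
  rw [← inner_conj_symm, Space.inner_kernel hG, hh, hx, map_zero]

/-- The normalized kernel functions at the points `φ = n π + α` are an orthonormal basis of the
angle space. -/
theorem exists_hilbertBasis_angleSpace (hG : ∀ x : ℝ, G x ≠ 0) {φ : ℝ → ℝ} (hφ : G.IsPhase φ)
    {lam : ℤ → ℝ} (hlam : ∀ n : ℤ, φ (lam n) = n * Real.pi + α) :
    ∃ b : HilbertBasis ℤ ℂ (G.angleSpace α), ∀ n : ℤ, (b n : G.Space) =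
      (1 / (√(G.kernelFun (lam n) (lam n)).re : ℂ)) • G.kernel (lam n) := by
  have : CompleteSpace G.Space := Space.completeSpace hG
  have : CompleteSpace (G.angleSpace α) := (G.isClosed_angleSpace α).completeSpace_coe
  have hz : ∀ n, G.angleFun α (lam n) = 0 := fun n =>
    (angleFun_ofReal_eq_zero_iff hG hφ _).2 ⟨n, hlam n⟩
  have hne : ∀ m n, m ≠ n → lam m ≠ lam n := fun m n hmn h => hmn (by
    have h1 := hlam m
    rw [h, hlam n, add_left_inj] at h1
    exact_mod_cast (mul_right_cancel₀ Real.pi_ne_zero h1).symm)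
  have hnorm : ∀ n, √(G.kernelFun (lam n) (lam n)).re = ‖G.kernel (lam n)‖ := fun n => by
    rw [← Space.norm_kernel_sq hG, Complex.ofReal_re, Real.sqrt_sq (norm_nonneg _)]
  have hn0 : ∀ n, (‖G.kernel (lam n)‖ : ℂ) ≠ 0 := fun n => by
    exact_mod_cast norm_ne_zero_iff.2 (kernel_ne_zero hG (hz n))
  let v : ℤ → G.angleSpace α := fun n => (1 / (√(G.kernelFun (lam n) (lam n)).re : ℂ)) •
    ⟨G.kernel (lam n), kernel_mem_angleSpace hG (hz n)⟩
  have hvc : ∀ n, (v n : G.Space) = (1 / (√(G.kernelFun (lam n) (lam n)).re : ℂ)) •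
    G.kernel (lam n) := fun n => rfl
  have hvo : Orthonormal ℂ v := by
    refine ⟨fun n => ?_, fun m n hmn => ?_⟩
    · rw [Submodule.coe_norm, hvc, norm_smul, hnorm, norm_div, norm_one, Complex.norm_real,
        norm_norm, one_div, inv_mul_cancel₀]
      exact_mod_cast hn0 n
    · change inner ℂ (v m) (v n) = 0
      rw [Submodule.coe_inner, hvc, hvc, inner_smul_left, inner_smul_right,
        inner_kernel_kernel_eq_zero hG (hz m) (hz n) (hne m n hmn), mul_zero, mul_zero]
  have hbot : (Submodule.span ℂ (Set.range v))ᗮ = ⊥ := by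
    rw [eq_bot_iff]
    intro f hf
    rw [Submodule.mem_bot]
    have hf0 : ∀ n, (f : G.Space) (lam n) = 0 := fun n => by
      have h1 := (Submodule.mem_orthogonal _ _).1 hf (v n) (Submodule.subset_span ⟨n, rfl⟩)
      rw [Submodule.coe_inner, hvc, inner_smul_left, Space.inner_kernel hG, hnorm] at h1
      exact (mul_eq_zero.1 h1).resolve_left ((map_ne_zero _).2 (one_div_ne_zero (hn0 n)))
    -- The phase is injective, so the λ_n are all the real zeros of h_α, and f vanishes at each of
    -- them.
    obtain ⟨c, hc⟩ := exists_eq_const_mul_angleFun (α := α) hG (f : G.Space) fun x hx => by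
      obtain ⟨n, hn⟩ := (angleFun_ofReal_eq_zero_iff hG hφ _).1 hx
      rw [← hlam n] at hn
      rw [hφ.2.1.injective hn]
      exact hf0 n
    have hff : inner ℂ (f : G.Space) (f : G.Space) = 0 := by
      -- If c is not zero, h_α = c⁻¹ f lies in the space, and f, being in the angle space, is
      -- orthogonal to it and so to itself.
      by_cases hc0 : c = 0
      · have : (f : G.Space) = 0 := Space.ext fun z => by rw [hc, hc0, zero_mul, Space.zero_apply]
        rw [this, inner_zero_left]
      · have h1 := (mem_angleSpace_iff G α f).1 f.2 (c⁻¹ • (f : G.Space)) fun z => by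
          rw [Space.smul_apply, hc, inv_mul_cancel_left₀ hc0]
        rw [inner_smul_left] at h1
        exact (mul_eq_zero.1 h1).resolve_left ((map_ne_zero _).2 (inv_ne_zero hc0))
    exact Subtype.ext (inner_self_eq_zero.1 hff)
  refine ⟨HilbertBasis.mkOfOrthogonalEqBot hvo hbot, fun n => ?_⟩
  rw [HilbertBasis.coe_mkOfOrthogonalEqBot]
  rfl

end HermiteBiehler

/-! ### Parseval frames and the main theorem -/

section ParsevalFrame

variable {ι H K : Type*} [NormedAddCommGroup H] [InnerProductSpace ℂ H] [NormedAddCommGroup K]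
  [InnerProductSpace ℂ K]

theorem IsParsevalFrame.hasSum_norm_inner {x : ι → H} (hx : IsParsevalFrame x) (f : H) :
    HasSum (fun n => ‖inner ℂ (x n) f‖ ^ 2) (‖f‖ ^ 2) := by
  simpa only [norm_inner_symm] using hx f

/-- The analysis operator of a Parseval frame. -/
noncomputable def IsParsevalFrame.analysis {x : ι → H} (hx : IsParsevalFrame x) :
    H →ₗᵢ[ℂ] lp (fun _ : ι => ℂ) 2 where
  toFun f := ⟨fun n => inner ℂ (x n) f, memℓp_gen (by
    simpa using (hx.hasSum_norm_inner f).summable)⟩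
  map_add' f g := by
    ext n
    exact inner_add_right _ _ _
  map_smul' c f := by
    ext n
    exact inner_smul_right _ _ _
  norm_map' f := by
    refine (pow_left_inj₀ (norm_nonneg _) (norm_nonneg _) two_ne_zero).1 ?_
    rw [← (hx.hasSum_norm_inner f).tsum_eq]
    have h := lp.norm_rpow_eq_tsum (p := 2) (by norm_num) (E := fun _ : ι => ℂ)
      ⟨fun n => inner ℂ (x n) f, memℓp_gen (by
        simpa using (hx.hasSum_norm_inner f).summable)⟩
    simp only [ENNReal.toReal_ofNat, Real.rpow_two] at h
    exact h

/-- A Parseval frame embeds into any orthonormal basis with the same index set. -/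
theorem IsParsevalFrame.exists_embedsInto {x : ι → H} (hx : IsParsevalFrame x)
    (b : HilbertBasis ι ℂ K) : ∃ T : H →ₗᵢ[ℂ] K, EmbedsInto T x b := by
  -- For this T, ⟨T(x n), T f⟩ = ⟨x n, f⟩ is by construction the n-th coordinate of T f, that is ⟨b
  -- n, T f⟩.
  refine ⟨b.repr.symm.toLinearIsometry.comp hx.analysis, fun n => ?_⟩
  rw [Submodule.mem_orthogonal']
  rintro _ ⟨f, rfl⟩
  change inner ℂ _ (b.repr.symm.toLinearIsometry.comp hx.analysis f) = 0
  rw [inner_sub_left, LinearIsometry.inner_map_map, ← b.repr_apply_apply]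
  change b.repr (b.repr.symm (hx.analysis f)) n - _ = 0
  rw [LinearIsometryEquiv.apply_symm_apply]
  exact sub_self _

end ParsevalFrame

/-- The range of the isometry I is closed because H(E) is complete, so the equation for its
orthogonal complement expresses the orthogonal sum decomposition. -/
theorem mainTheorem8 (E F : HermiteBiehler) (hE : ∀ x : ℝ, E x ≠ 0) (hF : ∀ x : ℝ, F x ≠ 0)
    (φ : ℝ → ℝ) (hφ : (E * F).IsPhase φ) (α : ℝ) (hα : α ∈ Set.Ico 0 Real.pi)
    (lam : ℤ → ℝ) (hlam : ∀ n : ℤ, φ (lam n) = n * Real.pi + α)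
    (hframe : IsParsevalFrame (fun n : ℤ => E.kernel (lam n))) :
    ∃ (I : E.Space →ₗᵢ[ℂ] (E * F).Space) (J : F.Space →ₗᵢ[ℂ] (E * F).Space),
      (∀ f z, I f z = f z * F z) ∧ (∀ g z, J g z = g z * starFun E z) ∧
      (LinearMap.range I.toLinearMap)ᗮ = LinearMap.range J.toLinearMap ∧
      ((E * F).angleFun α ∉ (E * F).deBrangesSubmodule → ∀ f, I f ∈ (E * F).angleSpace α) ∧
      ∃ b : HilbertBasis ℤ ℂ ((E * F).angleSpace α),
        (∀ n : ℤ, (b n : (E * F).Space) =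
          (conj (F (lam n)) / (√((E * F).kernelFun (lam n) (lam n)).re : ℂ)) •
              I (E.kernel (lam n)) +
            (E (lam n) / (√((E * F).kernelFun (lam n) (lam n)).re : ℂ)) •
              J (F.kernel (lam n))) ∧
        ∃ T : E.Space →ₗᵢ[ℂ] (E * F).angleSpace α,
          EmbedsInto T (fun n : ℤ => E.kernel (lam n)) (fun n : ℤ => b n) := by
  obtain ⟨b, hb⟩ := HermiteBiehler.exists_hilbertBasis_angleSpace
    (HermiteBiehler.mul_ne_zero_ofReal hE hF) hφ hlam
  refine ⟨E.mulRight F hF, E.mulStar F hE, fun _ _ => rfl, fun _ _ => rfl,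
    HermiteBiehler.orthogonal_range_mulRight hE hF, fun h f => ?_, b, fun n => ?_,
    hframe.exists_embedsInto b⟩
  · rw [HermiteBiehler.angleSpace, dif_neg h]
    exact Submodule.mem_top
  -- As λ_n is real, E(conj λ_n) = E(λ_n), and the normalized kernel of E F at λ_n splits into the
  -- two required terms.
  · rw [hb, HermiteBiehler.kernel_mul_eq hE hF, smul_add, smul_smul, smul_smul, Complex.conj_ofReal,
      one_div_mul_eq_div, one_div_mul_eq_div]
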